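/- **Theorem 1.1.** Let $k$ be a perfect field with $\operatorname{char} k\neq 2$. Let $\Lambda$ be the free $\mathbb Z$-module of Zorn matrices $\begin{pmatrix} a & w\\ \varphi & b\end{pmatrix}$, $a,b\in\mathbb Z$, $w,\varphi\in\mathbb Z^3$, with product $$\begin{pmatrix} a_1 & w_1\\ \varphi_1 & b_1\end{pmatrix}\cdot\begin{pmatrix} a_2 & w_2\\ \varphi_2 & b_2\end{pmatrix}=\begin{pmatrix} a_1a_2-\varphi_2(w_1) & a_1w_2+b_2w_1+\varphi_1\times\varphi_2\\ a_2\varphi_1+b_1\varphi_2+w_1\times w_2 & b_1b_2-\varphi_1(w_2)\end{pmatrix},$$ where $\varphi(w)=\sum_i\varphi_iw_i$ and $\times$ is the cross product; let $q=ab+\varphi(w)$ be its norm form, $\langle x,y\rangle=q(x+y)-q(x)-q(y)$, $e$ its identity element, $\bar x=\langle x,e\rangle e-x$, and $x\star y=\bar x\cdot\bar y$ the split para-octonion product, whose para-unit is $e$. For a commutative ring $A$ put $\mathbf{Aut}(\Lambda,\star)(A)=\{g\in SL(\Lambda\otimes A) : \langle gx,gy\rangle=\langle x,y\rangle,\ g(x\star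 y)=g(x)\star g(y)\}$. Let $C_s=\Lambda\otimes k(\!(t)\!)$, let $G=\mathbf{Aut}(C_s,\star)$ be the resulting group over $k(\!(t)\!)$ (of type $G_2$), and let $\mathscr G$ be the group scheme $\mathbf{Aut}(\Lambda,\star)$ over $k[\![t]\!]$, i.e. the hyperspecial parahoric attached to the standard lattice $\mathbb L_1=\Lambda\otimes k[\![t]\!]$. For $k$-algebras $R$ let $LG(R)=G(R(\!(t)\!))$ and $L^+\mathscr G(R)=\mathscr G(R[\![t]\!])\subset LG(R)$, which is the stabilizer of $\mathbb L_1\otimes R[\![t]\!]$ in $LG(R)$, and let $\mathrm{Gr}_{\mathscr G}=LG/L^+\mathscr G$ be the fpqc quotient sheaf, with the action of $LG$ induced by left translation. Let $\mathscr F$ be the functor sending a $k$-algebra $R$ to the set of $R[\![t]\!]$-lattices $L$ in $C_s\otimes_{k(\!(t)\!)}R(\!(t)\!)$, i.e. finitely generated projective $R[\![t]\!]$-submodules that span it over $R(\!(t)\!)$, such that 1. $L$ is self-dual: $\langle\ ,\ \rangle$ takes values in $R[\![t]\!]$ on $L$ and induces an isomorphism $L\simeq\mathrm{Hom}_{R[\![t]\!]}(L,R[\![t]\!])$;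 2. $L$ is an order: $e\in L$ and $L\star L\subset L$; with $LG$ acting by $L\mapsto g(L)$. Then there is an $LG$-equivariant isomorphism of functors $\mathrm{Gr}_{\mathscr G}\simeq\mathscr F$, induced by $g\mapsto g(\mathbb L_1\otimes_{k[\![t]\!]}R[\![t]\!])$. -/

import Mathlib

universe u

open CategoryTheory MonoidalCategory

namespace ParaOctonion

open Opposite
open scoped Matrix

/-- The `A`-module `Λ ⊗ A` underlying the split (para-)octonion algebra over a commutative ring `A`:
Zorn matrices with entries `a b` on the diagonal, `w = (w₁, w₂, w₃)` above and `φ = (φ₁, φ₂, φ₃)`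
below it, written in coordinates `(a, b, w₁, w₂, w₃, φ₁, φ₂, φ₃)` with respect to the standard
basis `e₁, e₂, u₁, u₂, u₃, v₁, v₂, v₃`. In particular `C_s = Oct k((t))` and
`C_s ⊗ R((t)) = Oct R((t))`. -/
abbrev Oct (A : Type u) : Type u := Fin 8 → A

section Algebra

variable {A B : Type u} [CommRing A] [CommRing B]

/-- The upper right entry `w` of a Zorn matrix. -/
def wPart (x : Oct A) : Fin 3 → A := ![x 2, x 3, x 4]

/-- The lower left entry `φ` of a Zorn matrix. -/
def vPart (x : Oct A) : Fin 3 → A := ![x 5, x 6, x 7]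

/-- The Zorn matrix with diagonal `a, b`, upper right entry `w` and lower left entry `φ`. -/
def zorn (a b : A) (w φ : Fin 3 → A) : Oct A := ![a, b, w 0, w 1, w 2, φ 0, φ 1, φ 2]

/-- The octonion product `x · y`. The identifications `∧² W ≃ W^∨` and `∧² W^∨ ≃ W` given by the
volume form `u₁ ∧ u₂ ∧ u₃` are the cross product in the dual bases `u_i`, `v_i`. -/
def octMul (x y : Oct A) : Oct A :=
  zorn (x 0 * y 0 - vPart y ⬝ᵥ wPart x)
    (x 1 * y 1 - vPart x ⬝ᵥ wPart y)
    (x 0 • wPart y + y 1 • wPart x + vPart x ⨯₃ vPart y)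
    (y 0 • vPart x + x 1 • vPart y + wPart x ⨯₃ wPart y)

/-- The quadratic form `q(a, b, w, φ) = a b + φ(w)`. -/
def normForm (x : Oct A) : A := x 0 * x 1 + vPart x ⬝ᵥ wPart x

/-- The bilinear form `⟨x, y⟩ = q(x + y) - q(x) - q(y)`. -/
def bilin (x y : Oct A) : A := normForm (x + y) - normForm x - normForm y

variable (A) in
/-- The identity `e = e₁ + e₂` of the octonion product; it is the para-unit of `⋆`. -/
def paraUnit : Oct A := zorn 1 1 0 0

/-- The conjugation `x ↦ ⟨x, e⟩ e - x`. -/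
def conj (x : Oct A) : Oct A := bilin x (paraUnit A) • paraUnit A - x

/-- The para-octonion product `x ⋆ y = conj x · conj y`. -/
def paraMul (x y : Oct A) : Oct A := octMul (conj x) (conj y)

theorem normForm_octMul (x y : Oct A) : normForm (octMul x y) = normForm x * normForm y := by
  simp [octMul, normForm, zorn, wPart, vPart, cross_apply]
  ring

theorem bilin_eq (x y : Oct A) : bilin x y =
    x 0 * y 1 + x 1 * y 0 + (x 2 * y 5 + x 3 * y 6 + x 4 * y 7 + x 5 * y 2 + x 6 * y 3 + x 7 * y 4) := by
  simp [bilin, normForm, wPart, vPart]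
  ring

/-- The multiplication table of `⋆` in the standard basis. -/
theorem paraMul_eq (x y : Oct A) : paraMul x y =
    ![x 1 * y 1 - (x 2 * y 5 + x 3 * y 6 + x 4 * y 7),
      x 0 * y 0 - (x 5 * y 2 + x 6 * y 3 + x 7 * y 4),
      -(x 1 * y 2) - y 0 * x 2 + (x 6 * y 7 - x 7 * y 6),
      -(x 1 * y 3) - y 0 * x 3 + (x 7 * y 5 - x 5 * y 7),
      -(x 1 * y 4) - y 0 * x 4 + (x 5 * y 6 - x 6 * y 5),
      -(y 1 * x 5) - x 0 * y 5 + (x 3 * y 4 - x 4 * y 3),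
      -(y 1 * x 6) - x 0 * y 6 + (x 4 * y 2 - x 2 * y 4),
      -(y 1 * x 7) - x 0 * y 7 + (x 2 * y 3 - x 3 * y 2)] := by
  ext i
  fin_cases i <;>
  simp [paraMul, octMul, conj, bilin_eq, paraUnit, zorn, wPart, vPart, cross_apply] <;> ring

/-- The form `⟨x, y⟩` as a bilinear map. -/
def bilinₗ : Oct A →ₗ[A] Oct A →ₗ[A] A :=
  LinearMap.mk₂ A bilin (fun x y z => by simp [bilin_eq]; ring) (fun c x y => by simp [bilin_eq]; ring)
    (fun x y z => by simp [bilin_eq]; ring) (fun c x y => by simp [bilin_eq]; ring)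

/-- The product `x ⋆ y` as a bilinear map. -/
def paraMulₗ : Oct A →ₗ[A] Oct A →ₗ[A] Oct A :=
  LinearMap.mk₂ A paraMul
    (fun x y z => by ext i; fin_cases i <;> simp [paraMul_eq] <;> ring)
    (fun c x y => by ext i; fin_cases i <;> simp [paraMul_eq] <;> ring)
    (fun x y z => by ext i; fin_cases i <;> simp [paraMul_eq] <;> ring)
    (fun c x y => by ext i; fin_cases i <;> simp [paraMul_eq] <;> ring)

theorem bilinₗ_apply (x y : Oct A) : bilinₗ x y = bilin x y := rfl
theorem paraMulₗ_apply (x y : Oct A) : paraMulₗ x y = paraMul x y := rfl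

/-- The map `Λ ⊗ A → Λ ⊗ B` induced by a ring homomorphism `A → B`. -/
def mapVec (f : A →+* B) (x : Oct A) : Oct B := fun i => f (x i)

theorem mapVec_bilin (f : A →+* B) (x y : Oct A) :
    bilin (mapVec f x) (mapVec f y) = f (bilin x y) := by
  simp [bilin_eq, mapVec]

theorem mapVec_paraMul (f : A →+* B) (x y : Oct A) :
    paraMul (mapVec f x) (mapVec f y) = mapVec f (paraMul x y) := by
  ext i
  fin_cases i <;> simp [paraMul_eq, mapVec]

theorem mapVec_paraUnit (f : A →+* B) : mapVec f (paraUnit A) = paraUnit B := by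
  ext i
  fin_cases i <;> simp [paraUnit, zorn, mapVec]

end Algebra

open Matrix.SpecialLinearGroup (toLin')

/-- The `A`-points of the automorphism group scheme `Aut(Λ, ⋆)`: the elements of `SL(Λ ⊗ A)` which
preserve the bilinear form (i.e. the elements of `SO(Λ)(A)`) and the product `⋆`.
For `A` an algebra over `k((t))` these are the `A`-points of the group `G = Aut(C_s, ⋆)` of type
`G₂`; for `A` an algebra over `k[[t]]` they are the `A`-points of the hyperspecial parahoric group
scheme of automorphisms of the standard lattice. -/
def autGroup (A : Type u) [CommRing A] : Subgroup (Matrix.SpecialLinearGroup (Fin 8) A) where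
  carrier := {g | (∀ x y : Oct A, bilin (toLin' g x) (toLin' g y) = bilin x y) ∧
    ∀ x y : Oct A, toLin' g (paraMul x y) = paraMul (toLin' g x) (toLin' g y)}
  one_mem' := by simp
  mul_mem' := by
    rintro g h ⟨hg, hg'⟩ ⟨hh, hh'⟩
    refine ⟨fun x y => ?_, fun x y => ?_⟩
    · simp only [map_mul, LinearEquiv.mul_apply, hg, hh]
    · simp only [map_mul, LinearEquiv.mul_apply, hg', hh']
  inv_mem' := by
    rintro g ⟨hg, hg'⟩
    have h1 : ∀ x : Oct A, toLin' g (toLin' g⁻¹ x) = x := fun x => by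
      rw [← LinearEquiv.mul_apply, ← map_mul, mul_inv_cancel, map_one, LinearEquiv.coe_one, id]
    refine ⟨fun x y => ?_, fun x y => ?_⟩
    · rw [← hg, h1, h1]
    · exact (toLin' g).injective (by rw [hg', h1, h1, h1])

section Aut
variable {A B C: Type u} [CommRing A] [CommRing B] [CommRing C]

theorem mapVec_toLin' (f : A →+* B) (g : Matrix.SpecialLinearGroup (Fin 8) A) (x : Oct A) :
    toLin' (Matrix.SpecialLinearGroup.map f g) (mapVec f x) = mapVec f (toLin' g x) := by
  ext i
  simp [mapVec, Matrix.SpecialLinearGroup.toLin'_apply, Matrix.toLin'_apply, Matrix.mulVec,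
    dotProduct]

theorem mapVec_single (f : A →+* B) (i : Fin 8) :
    (Pi.single i 1 : Oct B) = mapVec f (Pi.single i 1) := by
  ext j
  by_cases h : i = j
  · subst h; simp [mapVec]
  · simp [mapVec, Ne.symm h]

theorem map_mem_autGroup (f : A →+* B) (g : Matrix.SpecialLinearGroup (Fin 8) A)
    (hg : g ∈ autGroup A) : Matrix.SpecialLinearGroup.map f g ∈ autGroup B := by
  obtain ⟨h1, h2⟩ := hg
  let m : Oct B →ₗ[B] Oct B := (toLin' (Matrix.SpecialLinearGroup.map f g) : Oct B →ₗ[B] Oct B)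
  constructor
  · have : (bilinₗ.compl₁₂ m m : Oct B →ₗ[B] Oct B →ₗ[B] B) = bilinₗ := by
      refine (Pi.basisFun B (Fin 8)).ext fun i => (Pi.basisFun B (Fin 8)).ext fun j => ?_
      simp only [Pi.basisFun_apply, LinearMap.compl₁₂_apply, bilinₗ_apply, m, LinearEquiv.coe_coe,
        mapVec_single f, mapVec_toLin', mapVec_bilin, h1]
    intro x y
    exact LinearMap.congr_fun₂ this x y
  · have : (paraMulₗ.compr₂ m : Oct B →ₗ[B] Oct B →ₗ[B] Oct B) = paraMulₗ.compl₁₂ m m := by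
      refine (Pi.basisFun B (Fin 8)).ext fun i => (Pi.basisFun B (Fin 8)).ext fun j => ?_
      simp only [Pi.basisFun_apply, LinearMap.compl₁₂_apply, LinearMap.compr₂_apply, paraMulₗ_apply, m, LinearEquiv.coe_coe,
        mapVec_single f, mapVec_toLin', mapVec_paraMul, h2]
    intro x y
    exact LinearMap.congr_fun₂ this x y

/-- Functoriality of `A ↦ Aut(Λ, ⋆)(A)`. -/
def autMap (f : A →+* B) : autGroup A →* autGroup B :=
  ((Matrix.SpecialLinearGroup.map f).comp (autGroup A).subtype).codRestrict (autGroup B)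
    fun g => map_mem_autGroup f g.1 g.2

/-- Automorphisms of `⋆` fix the para-unit. -/
theorem toLin'_paraUnit (g : autGroup A) : toLin' g.1 (paraUnit A) = paraUnit A := by
  obtain ⟨g, h1, h2⟩ := g
  have hsurj := (toLin' g).surjective
  set f := toLin' g (paraUnit A) with hf
  have hcomm : ∀ y, paraMul f y = paraMul y f := by
    intro y
    obtain ⟨x, rfl⟩ := hsurj y
    rw [hf, ← h2, ← h2]
    congr 1
    ext i; fin_cases i <;> simp [paraMul_eq, paraUnit, zorn]
  have hidem : paraMul f f = f := by
    rw [hf, ← h2]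
    congr 1
    ext i; fin_cases i <;> simp [paraMul_eq, paraUnit, zorn]
  have hinv : ∀ y, paraMul f (paraMul f y) = y := by
    intro y
    obtain ⟨x, rfl⟩ := hsurj y
    rw [hf, ← h2, ← h2]
    congr 1
    ext i; fin_cases i <;> simp [paraMul_eq, paraUnit, zorn]
  have a1 := hcomm (Pi.single 0 1)
  have a2 := hcomm (Pi.single 2 1)
  have a3 := hinv (Pi.single 0 1)
  simp only [paraMul_eq, funext_iff, Fin.forall_fin_succ] at a1 a2 a3 hidem
  simp at a1 a2 a3 hidem
  obtain ⟨b2, b3, b4, b5, b6, b7⟩ := a1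
  have c0 : f 0 = 1 := by
    have e1 := hidem.1
    have e2 := a3.1
    rw [b2, b3, b4, a2.2.1] at e1
    rw [a2.2.1] at e2
    simpa [e2] using e1.symm
  have c1 : f 1 = 1 := a2.2.1.trans c0
  ext i; fin_cases i <;> simp [paraUnit, zorn, b2, b3, b4, b5, b6, b7, c0, c1]

theorem autMap_id (g : autGroup A) : autMap (RingHom.id A) g = g := by
  ext i j
  rfl

theorem autMap_comp (f : A →+* B) (f' : B →+* C) (g : autGroup A) :
    autMap (f'.comp f) g = autMap f' (autMap f g) := by
  ext i j
  rfl

end Aut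


section Lattice

variable {O A O' A' : Type u} [CommRing O] [CommRing A] [Algebra O A]
  [CommRing O'] [CommRing A'] [Algebra O' A']

/-- An `O`-submodule `L` of `Λ ⊗ A` is a lattice if it is a finitely generated projective `O`-module
that spans `Λ ⊗ A` over `A`. (It is used for `O = R[[t]]` and `A = R((t)) = O[1/t]`.) -/
structure IsLattice (L : Submodule O (Oct A)) : Prop where
  finite : Module.Finite O L
  projective : Module.Projective O L
  span_eq_top : Submodule.span A (L : Set (Oct A)) = ⊤

/-- `L` is self-dual: `⟨ , ⟩` is `O`-valued on `L` and induces an isomorphism `L ≃ Hom_O(L, O)`. -/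
def IsSelfDual (L : Submodule O (Oct A)) : Prop :=
  ∃ ψ : L ≃ₗ[O] Module.Dual O L, ∀ x y : L, algebraMap O A (ψ x y) = bilin (x : Oct A) (y : Oct A)

/-- The order condition: `L` contains `e` and is closed under `⋆`. -/
structure IsOrder (L : Submodule O (Oct A)) : Prop where
  unit_mem : paraUnit A ∈ L
  mul_mem : ∀ x ∈ L, ∀ y ∈ L, paraMul x y ∈ L

/-- A self-dual lattice has a finite dual basis with respect to `⟨ , ⟩`. -/
theorem exists_dual_basis {L : Submodule O (Oct A)} (h1 : IsLattice L) (h2 : IsSelfDual L) :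
    ∃ (n : ℕ) (x y : Fin n → Oct A), (∀ i, x i ∈ L) ∧ (∀ i, y i ∈ L) ∧
      ∀ z ∈ L, z = ∑ i, bilin (y i) z • x i := by
  obtain ⟨ψ, hψ⟩ := h2
  have := h1.finite
  have := h1.projective
  obtain ⟨n, p, s, -, -, hps⟩ := Module.Finite.exists_comp_eq_id_of_projective O L
  refine ⟨n, fun i => p (Pi.single i 1),
    fun i => ψ.symm ((LinearMap.proj i : (Fin n → O) →ₗ[O] O).comp s),
    fun i => Subtype.property _, fun i => Subtype.property _, fun z hz => ?_⟩
  have h3 := LinearMap.congr_fun hps ⟨z, hz⟩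
  rw [LinearMap.comp_apply, LinearMap.id_apply, pi_eq_sum_univ' (s ⟨z, hz⟩), map_sum] at h3
  simp only [map_smul] at h3
  have h4 := congrArg (Subtype.val) h3
  refine h4.symm.trans ?_
  rw [AddSubmonoidClass.coe_finsetSum]
  refine Finset.sum_congr rfl fun i _ => ?_
  rw [← hψ _ ⟨z, hz⟩, LinearEquiv.apply_symm_apply, Submodule.coe_smul, algebraMap_smul]
  rfl

theorem of_dual_basis (hinj : Function.Injective (algebraMap O A)) {L : Submodule O (Oct A)}
    (hint : ∀ x ∈ L, ∀ y ∈ L, ∃ c, algebraMap O A c = bilin x y)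
    {n : ℕ} (x y : Fin n → Oct A) (hx : ∀ i, x i ∈ L) (hy : ∀ i, y i ∈ L)
    (h : ∀ z ∈ L, z = ∑ i, bilin (y i) z • x i) :
    Module.Finite O L ∧ Module.Projective O L ∧ IsSelfDual L := by
  choose c hc using fun x y : L => hint x x.2 y y.2
  have hadd : ∀ x y z : L, c x (y + z) = c x y + c x z := fun x y z => hinj <| by
    rw [map_add, hc, hc, hc]; exact map_add (bilinₗ x.1) _ _
  have hsmul : ∀ (x : L) (r : O) (y : L), c x (r • y) = r • c x y := fun x r y => hinj <| by
    rw [smul_eq_mul, map_mul, hc, hc, Submodule.coe_smul, ← algebraMap_smul A]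
    exact map_smul (bilinₗ x.1) _ _
  have hcomm : ∀ x y : L, c x y = c y x := fun x y => hinj <| by
    rw [hc, hc, bilin_eq, bilin_eq]; ring
  let ψ : L →ₗ[O] Module.Dual O L := LinearMap.mk₂ O c
    (fun x y z => by rw [hcomm, hadd, hcomm z, hcomm z]) (fun r x y => by rw [hcomm, hsmul, hcomm y])
    hadd (fun r x y => hsmul x r y)
  let X : Fin n → L := fun i => ⟨x i, hx i⟩
  let Y : Fin n → L := fun i => ⟨y i, hy i⟩
  have hz : ∀ z : L, z = ∑ i, c (Y i) z • X i := fun z => Subtype.ext <| by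
    rw [AddSubmonoidClass.coe_finsetSum]
    refine (h z z.2).trans (Finset.sum_congr rfl fun i _ => ?_)
    rw [Submodule.coe_smul, ← algebraMap_smul A (c _ _), hc]
  let p : (Fin n → O) →ₗ[O] L := Fintype.linearCombination O X
  let s : L →ₗ[O] (Fin n → O) := LinearMap.pi fun i => ψ (Y i)
  have hps : p.comp s = LinearMap.id := LinearMap.ext fun z => by
    rw [LinearMap.comp_apply, Fintype.linearCombination_apply]
    exact (hz z).symm
  have hp : Function.Surjective p := fun z => ⟨s z, LinearMap.congr_fun hps z⟩
  refine ⟨Module.Finite.of_surjective p hp, Module.Projective.of_split s p hps,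
    LinearEquiv.ofBijective ψ ⟨?_, ?_⟩, fun x y => hc x y⟩
  · rw [injective_iff_map_eq_zero]
    intro z h0
    rw [hz z]
    refine Finset.sum_eq_zero fun i _ => ?_
    have : c z (Y i) = 0 := LinearMap.congr_fun h0 (Y i)
    rw [hcomm, this, zero_smul]
  · intro l
    refine ⟨∑ i, l (X i) • Y i, LinearMap.ext fun z => ?_⟩
    rw [map_sum, LinearMap.sum_apply]
    conv_rhs => rw [hz z, map_sum]
    refine Finset.sum_congr rfl fun i _ => ?_
    rw [map_smul, map_smul, LinearMap.smul_apply, smul_eq_mul, smul_eq_mul, mul_comm]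
    rfl

theorem mapVec_add (f : A →+* A') (x y : Oct A) : mapVec f (x + y) = mapVec f x + mapVec f y :=
  funext fun _ => map_add f _ _

theorem mapVec_smul (f : A →+* A') (c : A) (x : Oct A) :
    mapVec f (c • x) = f c • mapVec f x :=
  funext fun _ => map_mul f _ _

theorem mapVec_sum (f : A →+* A') {n : ℕ} (x : Fin n → Oct A) :
    mapVec f (∑ i, x i) = ∑ i, mapVec f (x i) :=
  map_sum (AddMonoidHom.mk' (mapVec f) (mapVec_add f)) _ _

/-- The base change of `L ⊆ Λ ⊗ A` along compatible maps `O → O'`, `A → A'`: the image of `L ⊗ O'` in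
`Λ ⊗ A'`. -/
def baseChange (O' : Type u) [CommRing O'] [Algebra O' A'] (f : A →+* A') (L : Submodule O (Oct A)) :
    Submodule O' (Oct A') :=
  Submodule.span O' (mapVec f '' L)

theorem baseChange_id (L : Submodule O (Oct A)) : baseChange O (RingHom.id A) L = L := by
  have : mapVec (RingHom.id A) '' (L : Set (Oct A)) = L := Set.image_id _
  rw [baseChange, this, Submodule.span_eq]

theorem baseChange_comp {O'' A'' : Type u} [CommRing O''] [CommRing A''] [Algebra O'' A'']
    (f : A →+* A') (f' : A' →+* A'') (g' : O' →+* O'')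
    (hf' : ∀ c, f' (algebraMap O' A' c) = algebraMap O'' A'' (g' c))
    (L : Submodule O (Oct A)) :
    baseChange O'' (f'.comp f) L = baseChange O'' f' (baseChange O' f L) := by
  refine le_antisymm (Submodule.span_le.2 ?_) (Submodule.span_le.2 ?_)
  · rintro _ ⟨x, hx, rfl⟩
    exact Submodule.subset_span ⟨mapVec f x, Submodule.subset_span ⟨x, hx, rfl⟩, rfl⟩
  · rintro _ ⟨x, hx, rfl⟩
    refine Submodule.span_induction (p := fun x _ => mapVec f' x ∈ baseChange O'' (f'.comp f) L)
      ?_ ?_ ?_ ?_ hx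
    · rintro _ ⟨x, hx, rfl⟩
      exact Submodule.subset_span ⟨x, hx, rfl⟩
    · have : mapVec f' 0 = 0 := funext fun _ => map_zero f'
      rw [this]
      exact Submodule.zero_mem _
    · intro x y _ _ hx hy
      rw [mapVec_add]
      exact Submodule.add_mem _ hx hy
    · intro c x _ hx
      rw [← algebraMap_smul A', mapVec_smul, hf', algebraMap_smul]
      exact Submodule.smul_mem _ _ hx

theorem baseChange_mem (hinj : Function.Injective (algebraMap O' A'))
    (f : A →+* A') (g : O →+* O') (hfg : ∀ c, f (algebraMap O A c) = algebraMap O' A' (g c))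
    {L : Submodule O (Oct A)} (h1 : IsLattice L) (h2 : IsSelfDual L) (h3 : IsOrder L) :
    IsLattice (baseChange O' f L) ∧ IsSelfDual (baseChange O' f L) ∧
      IsOrder (baseChange O' f L) := by
  have hmem : ∀ x ∈ L, mapVec f x ∈ baseChange O' f L := fun x hx =>
    Submodule.subset_span ⟨x, hx, rfl⟩
  have hbil : ∀ (c : O') (x y : Oct A'), bilin x (c • y) = algebraMap O' A' c * bilin x y :=
    fun c x y => by rw [← algebraMap_smul A']; exact map_smul (bilinₗ x) _ _
  have hbil' : ∀ (c : O') (x y : Oct A'), bilin (c • x) y = algebraMap O' A' c * bilin x y :=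
    fun c x y => by rw [← algebraMap_smul A']; exact LinearMap.map_smul₂ bilinₗ _ _ _
  obtain ⟨n, x, y, hx, hy, hxy⟩ := exists_dual_basis h1 h2
  obtain ⟨ψ, hψ⟩ := h2
  have hint : ∀ v ∈ baseChange O' f L, ∀ w ∈ baseChange O' f L,
      ∃ c, algebraMap O' A' c = bilin v w := by
    intro v hv w hw
    refine Submodule.span_induction₂ (p := fun v w _ _ => ∃ c, algebraMap O' A' c = bilin v w)
      ?_ ?_ ?_ ?_ ?_ ?_ ?_ hv hw
    · rintro _ _ ⟨v, hv, rfl⟩ ⟨w, hw, rfl⟩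
      exact ⟨g (ψ ⟨v, hv⟩ ⟨w, hw⟩), by rw [← hfg, hψ, mapVec_bilin]⟩
    · exact fun w _ => ⟨0, by rw [map_zero]; exact (LinearMap.map_zero₂ bilinₗ w).symm⟩
    · exact fun v _ => ⟨0, by rw [map_zero]; exact (map_zero (bilinₗ v)).symm⟩
    · rintro a b w _ _ _ ⟨c, hc⟩ ⟨d, hd⟩
      exact ⟨c + d, by rw [map_add, hc, hd]; exact (LinearMap.map_add₂ bilinₗ _ _ _).symm⟩
    · rintro w a b _ _ _ ⟨c, hc⟩ ⟨d, hd⟩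
      exact ⟨c + d, by rw [map_add, hc, hd]; exact (map_add (bilinₗ w) _ _).symm⟩
    · rintro r a b _ _ ⟨c, hc⟩
      exact ⟨r * c, by rw [map_mul, hc, hbil']⟩
    · rintro r a b _ _ ⟨c, hc⟩
      exact ⟨r * c, by rw [map_mul, hc, hbil]⟩
  have hz : ∀ z ∈ baseChange O' f L, z = ∑ i, bilin (mapVec f (y i)) z • mapVec f (x i) := by
    intro z hz
    refine Submodule.span_induction
      (p := fun z _ => z = ∑ i, bilin (mapVec f (y i)) z • mapVec f (x i)) ?_ ?_ ?_ ?_ hz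
    · rintro _ ⟨z, hz, rfl⟩
      conv_lhs => rw [hxy z hz, mapVec_sum]
      simp only [mapVec_smul, mapVec_bilin]
    · refine (Finset.sum_eq_zero fun i _ => ?_).symm
      rw [← bilinₗ_apply, map_zero, zero_smul]
    · intro a b _ _ ha hb
      conv_lhs => rw [ha, hb]
      simp only [← bilinₗ_apply, map_add, add_smul, Finset.sum_add_distrib]
    · intro c a _ ha
      conv_lhs => rw [ha]
      rw [Finset.smul_sum]
      refine Finset.sum_congr rfl fun i _ => ?_
      rw [hbil, ← algebraMap_smul A', smul_smul]
  obtain ⟨k1, k2, k3⟩ := of_dual_basis hinj hint (fun i => mapVec f (x i)) (fun i => mapVec f (y i))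
    (fun i => hmem _ (hx i)) (fun i => hmem _ (hy i)) hz
  refine ⟨⟨k1, k2, ?_⟩, k3, ?_, ?_⟩
  · have key : ∀ v : Oct A, mapVec f v ∈ Submodule.span A' (baseChange O' f L : Set (Oct A')) := by
      intro v
      have hv : v ∈ Submodule.span A (L : Set (Oct A)) := h1.span_eq_top ▸ Submodule.mem_top
      refine Submodule.span_induction
        (p := fun v _ => mapVec f v ∈ Submodule.span A' (baseChange O' f L : Set (Oct A')))
        ?_ ?_ ?_ ?_ hv
      · exact fun v hv => Submodule.subset_span (hmem v hv)
      · have : mapVec f 0 = 0 := funext fun _ => map_zero f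
        rw [this]
        exact Submodule.zero_mem _
      · intro a b _ _ ha hb
        rw [mapVec_add]
        exact Submodule.add_mem _ ha hb
      · intro c a _ ha
        rw [mapVec_smul]
        exact Submodule.smul_mem _ _ ha
    rw [eq_top_iff, ← (Pi.basisFun A' (Fin 8)).span_eq, Submodule.span_le]
    rintro _ ⟨i, rfl⟩
    rw [Pi.basisFun_apply, mapVec_single f]
    exact key _
  · rw [← mapVec_paraUnit f]
    exact hmem _ h3.unit_mem
  · intro v hv w hw
    refine Submodule.span_induction₂ (p := fun v w _ _ => paraMul v w ∈ baseChange O' f L)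
      ?_ ?_ ?_ ?_ ?_ ?_ ?_ hv hw
    · rintro _ _ ⟨v, hv, rfl⟩ ⟨w, hw, rfl⟩
      rw [mapVec_paraMul]
      exact hmem _ (h3.mul_mem v hv w hw)
    · intro w _
      rw [← paraMulₗ_apply, LinearMap.map_zero₂]
      exact Submodule.zero_mem _
    · intro w _
      rw [← paraMulₗ_apply, map_zero]
      exact Submodule.zero_mem _
    · intro a b w _ _ _ ha hb
      rw [← paraMulₗ_apply, LinearMap.map_add₂]
      exact Submodule.add_mem _ ha hb
    · intro w a b _ _ _ ha hb
      rw [← paraMulₗ_apply, map_add]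
      exact Submodule.add_mem _ ha hb
    · intro r a b _ _ h
      rw [← paraMulₗ_apply, ← algebraMap_smul A', LinearMap.map_smul₂, algebraMap_smul]
      exact Submodule.smul_mem _ _ h
    · intro r a b _ _ h
      rw [← paraMulₗ_apply, ← algebraMap_smul A', map_smul, algebraMap_smul]
      exact Submodule.smul_mem _ _ h

variable (O A) in
/-- The standard lattice: the image of `Λ ⊗ O` in `Λ ⊗ A`, i.e. the `O`-span of the standard basis. -/
def standardLattice : Submodule O (Oct A) :=
  baseChange O (algebraMap O A) (⊤ : Submodule O (Oct O))

theorem standardLattice_mem (hinj : Function.Injective (algebraMap O A)) :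
    IsLattice (standardLattice O A) ∧ IsSelfDual (standardLattice O A) ∧
      IsOrder (standardLattice O A) := by
  have hz : ∀ z ∈ (⊤ : Submodule O (Oct O)),
      z = ∑ i, bilin (Pi.single (![1, 0, 5, 6, 7, 2, 3, 4] i) 1) z • Pi.single i 1 := by
    intro z _
    ext j
    rw [Finset.sum_apply]
    fin_cases j <;> simp [Fin.sum_univ_eight, bilin_eq]
  obtain ⟨h1, h2, h3⟩ := of_dual_basis (O := O) (A := O) (L := ⊤) (fun _ _ h => h)
    (fun x _ y _ => ⟨bilin x y, rfl⟩) (fun i => Pi.single i 1) _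
    (fun _ => trivial) (fun _ => trivial) hz
  exact baseChange_mem hinj (algebraMap O A) (RingHom.id O) (fun _ => rfl)
    ⟨h1, h2, by rw [Submodule.top_coe, Submodule.span_univ]⟩ h3
    ⟨trivial, fun _ _ _ _ => trivial⟩

/-- The translate `g(L)`. -/
def translate (g : autGroup A) (L : Submodule O (Oct A)) : Submodule O (Oct A) :=
  L.map ((toLin' g.1).toLinearMap.restrictScalars O)

theorem translate_mem (g : autGroup A) {L : Submodule O (Oct A)} (h1 : IsLattice L)
    (h2 : IsSelfDual L) (h3 : IsOrder L) :
    IsLattice (translate g L) ∧ IsSelfDual (translate g L) ∧ IsOrder (translate g L) := by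
  have := h1.finite
  have := h1.projective
  let e : L ≃ₗ[O] translate g L :=
    ((toLin' g.1).restrictScalars O).submoduleMap L
  have he : ∀ x : L, (e x : Oct A) = toLin' g.1 (x : Oct A) := fun x => rfl
  refine ⟨⟨Module.Finite.equiv e, Module.Projective.of_equiv e, ?_⟩, ?_, ?_, ?_⟩
  · have : (translate g L : Set (Oct A)) = (toLin' g.1).toLinearMap '' (L : Set (Oct A)) := rfl
    rw [this, Submodule.span_image, h1.span_eq_top, Submodule.map_top, LinearEquiv.range]
  · obtain ⟨ψ, hψ⟩ := h2
    refine ⟨e.symm.trans (ψ.trans e.symm.dualMap), fun x y => ?_⟩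
    obtain ⟨x, rfl⟩ := e.surjective x
    obtain ⟨y, rfl⟩ := e.surjective y
    simp only [LinearEquiv.trans_apply, LinearEquiv.symm_apply_apply, LinearEquiv.dualMap_apply]
    rw [hψ, he, he, g.2.1]
  · exact ⟨paraUnit A, h3.unit_mem, toLin'_paraUnit g⟩
  · rintro _ ⟨x, hx, rfl⟩ _ ⟨y, hy, rfl⟩
    exact ⟨paraMul x y, h3.mul_mem x hx y hy, g.2.2 x y⟩

theorem translate_one (L : Submodule O (Oct A)) : translate 1 L = L := by
  have : (toLin' (1 : autGroup A).1).toLinearMap.restrictScalars O = LinearMap.id := by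
    refine LinearMap.ext fun x => ?_
    change toLin' 1 x = x
    rw [map_one, LinearEquiv.coe_one, id]
  rw [translate, this, Submodule.map_id]

theorem translate_mul (g h : autGroup A) (L : Submodule O (Oct A)) :
    translate (g * h) L = translate g (translate h L) := by
  rw [translate, translate, translate, ← Submodule.map_comp]
  congr 1
  refine LinearMap.ext fun x => ?_
  change toLin' (g.1 * h.1) x = toLin' g.1 (toLin' h.1 x)
  rw [map_mul, LinearEquiv.mul_apply]

theorem baseChange_translate (f : A →+* A') (g : autGroup A) (L : Submodule O (Oct A)) :
    baseChange O' f (translate g L) = translate (autMap f g) (baseChange O' f L) := by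
  have h := (Submodule.map_span ((toLin' (autMap f g).1).toLinearMap.restrictScalars O')
    (mapVec f '' (L : Set (Oct A)))).symm
  refine Eq.trans (congrArg (Submodule.span O') ?_) h
  ext v
  constructor
  · rintro ⟨_, ⟨x, hx, rfl⟩, rfl⟩
    exact ⟨_, ⟨x, hx, rfl⟩, mapVec_toLin' f g.1 x⟩
  · rintro ⟨_, ⟨x, hx, rfl⟩, rfl⟩
    exact ⟨_, ⟨x, hx, rfl⟩, (mapVec_toLin' f g.1 x).symm⟩

theorem baseChange_standardLattice (f : A →+* A') (g : O →+* O')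
    (hfg : ∀ c, f (algebraMap O A c) = algebraMap O' A' (g c)) :
    baseChange O' f (standardLattice O A) = standardLattice O' A' := by
  rw [standardLattice, ← baseChange_comp (algebraMap O A) f g hfg,
    show f.comp (algebraMap O A) = (algebraMap O' A').comp g from RingHom.ext hfg,
    baseChange_comp g (algebraMap O' A') (RingHom.id O') (fun _ => rfl), standardLattice]
  congr 1
  rw [eq_top_iff, ← (Pi.basisFun O' (Fin 8)).span_eq, Submodule.span_le]
  rintro _ ⟨i, rfl⟩
  rw [Pi.basisFun_apply, mapVec_single g]
  exact Submodule.subset_span ⟨_, trivial, rfl⟩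

theorem mem_range_autMap_iff (hinj : Function.Injective (algebraMap O A)) (g : autGroup A) :
    g ∈ (autMap (algebraMap O A)).range ↔
      translate g (standardLattice O A) = standardLattice O A := by
  constructor
  · rintro ⟨h, rfl⟩
    have : translate h (⊤ : Submodule O (Oct O)) = ⊤ := by
      rw [translate, Submodule.map_top, LinearMap.range_eq_top]
      exact (toLin' h.1).surjective
    rw [standardLattice, ← baseChange_translate, this]
  · intro hg
    have hstd : ∀ v ∈ standardLattice O A, ∃ w : Oct O, mapVec (algebraMap O A) w = v := by
      intro v hv
      refine Submodule.span_induction (p := fun v _ => ∃ w, mapVec (algebraMap O A) w = v)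
        ?_ ?_ ?_ ?_ hv
      · rintro _ ⟨w, -, rfl⟩
        exact ⟨w, rfl⟩
      · exact ⟨0, funext fun _ => map_zero _⟩
      · rintro _ _ _ _ ⟨a, rfl⟩ ⟨b, rfl⟩
        exact ⟨a + b, mapVec_add _ _ _⟩
      · rintro c _ _ ⟨a, rfl⟩
        exact ⟨c • a, by rw [mapVec_smul, algebraMap_smul]⟩
    have hcol : ∀ j, ∃ w : Oct O, mapVec (algebraMap O A) w = toLin' g.1 (Pi.single j 1) := by
      intro j
      refine hstd _ (hg ▸ ⟨Pi.single j 1, ?_, rfl⟩)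
      rw [mapVec_single (algebraMap O A)]
      exact Submodule.subset_span ⟨_, trivial, rfl⟩
    choose w hw using hcol
    let m : Matrix (Fin 8) (Fin 8) O := fun i j => w j i
    have hm : m.map (algebraMap O A) = g.1.1 := by
      ext i j
      refine (congrFun (hw j) i).trans ?_
      simp [Matrix.SpecialLinearGroup.toLin'_apply, Matrix.toLin'_apply]
    have hdet : m.det = 1 := hinj <| by
      rw [RingHom.map_det, RingHom.mapMatrix_apply, hm, g.1.2, map_one]
    let h : Matrix.SpecialLinearGroup (Fin 8) O := ⟨m, hdet⟩
    have hh : Matrix.SpecialLinearGroup.map (algebraMap O A) h = g.1 := Subtype.ext hm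
    have hvec : ∀ x : Oct O, mapVec (algebraMap O A) (toLin' h x) =
        toLin' g.1 (mapVec (algebraMap O A) x) := fun x => by
      rw [← mapVec_toLin', hh]
    refine ⟨⟨h, fun x y => hinj ?_, fun x y => ?_⟩, Subtype.ext hh⟩
    · rw [← mapVec_bilin, hvec, hvec, g.2.1, mapVec_bilin]
    · refine funext fun i => hinj ?_
      refine congrFun (?_ : mapVec (algebraMap O A) _ = mapVec (algebraMap O A) _) i
      rw [hvec, ← mapVec_paraMul, g.2.2, ← mapVec_paraMul, hvec, hvec]

end Lattice


section Loop

open scoped PowerSeries LaurentSeries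

variable {R S T : Type u} [CommRing R] [CommRing S] [CommRing T]

/-- The map `R((t)) → S((t))` induced by `R → S`. -/
noncomputable def laurentMap (f : R →+* S) : R⸨X⸩ →+* S⸨X⸩ where
  toFun x := HahnSeries.map x f
  map_zero' := by ext; simp
  map_one' := HahnSeries.map_one f.toMonoidWithZeroHom
  map_add' x y := by ext; simp
  map_mul' x y := HahnSeries.map_mul f.toNonUnitalRingHom

theorem coeff_laurentMap (f : R →+* S) (x : R⸨X⸩) (n : ℤ) :
    (laurentMap f x).coeff n = f (x.coeff n) := rfl

theorem laurentMap_id : laurentMap (RingHom.id R) = RingHom.id R⸨X⸩ :=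
  RingHom.ext fun _ => HahnSeries.ext rfl

theorem laurentMap_comp (f : R →+* S) (g : S →+* T) :
    laurentMap (g.comp f) = (laurentMap g).comp (laurentMap f) :=
  RingHom.ext fun _ => HahnSeries.ext rfl

theorem laurentMap_algebraMap (f : R →+* S) (p : R⟦X⟧) :
    laurentMap f (algebraMap R⟦X⟧ R⸨X⸩ p) = algebraMap S⟦X⟧ S⸨X⸩ (PowerSeries.map f p) := by
  ext n
  rw [coeff_laurentMap, LaurentSeries.coe_algebraMap, LaurentSeries.coe_algebraMap,
    PowerSeries.coeff_coe, PowerSeries.coeff_coe]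
  split_ifs <;> simp

theorem algebraMap_laurent_injective : Function.Injective (algebraMap R⟦X⟧ R⸨X⸩) :=
  HahnSeries.ofPowerSeries_injective

/-- The loop group `LG(R) = G(R((t)))`. -/
abbrev LoopGroup (R : Type u) [CommRing R] : Type u := autGroup R⸨X⸩

/-- The positive loop group: the image of the `R[[t]]`-points of the hyperspecial parahoric group
scheme in `LG(R)`. -/
noncomputable def positiveLoopGroup (R : Type u) [CommRing R] : Subgroup (LoopGroup R) :=
  (autMap (algebraMap R⟦X⟧ R⸨X⸩)).range

/-- The map `LG(R) → LG(S)` induced by `R → S`. -/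
noncomputable def loopMap (f : R →+* S) : LoopGroup R →* LoopGroup S := autMap (laurentMap f)

theorem loopMap_mem (f : R →+* S) {g : LoopGroup R} (hg : g ∈ positiveLoopGroup R) :
    loopMap f g ∈ positiveLoopGroup S := by
  obtain ⟨h, rfl⟩ := hg
  refine ⟨autMap (PowerSeries.map f) h, ?_⟩
  rw [loopMap, ← autMap_comp, ← autMap_comp]
  exact congrArg (fun l => autMap l h) (RingHom.ext fun p => (laurentMap_algebraMap f p).symm)

/-- The map induced by `R → S` on the quotients of `LG` by the positive loop group. -/
noncomputable def quotientMap (f : R →+* S) :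
    LoopGroup R ⧸ positiveLoopGroup R → LoopGroup S ⧸ positiveLoopGroup S :=
  Quotient.map' (loopMap f) fun a b h => by
    rw [QuotientGroup.leftRel_apply] at h ⊢
    rw [← map_inv, ← map_mul]
    exact loopMap_mem f h

/-- The set of `R[[t]]`-lattices in `C_s ⊗ R((t))` that are self-dual and orders. -/
def SelfDualOrder (R : Type u) [CommRing R] : Type u :=
  {L : Submodule R⟦X⟧ (Oct R⸨X⸩) // IsLattice L ∧ IsSelfDual L ∧ IsOrder L}

/-- Base change of self-dual orders along `R → S`. -/
noncomputable def SelfDualOrder.map (f : R →+* S) (L : SelfDualOrder R) : SelfDualOrder S :=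
  ⟨baseChange S⟦X⟧ (laurentMap f) L.1, baseChange_mem algebraMap_laurent_injective (laurentMap f)
    (PowerSeries.map f) (laurentMap_algebraMap f) L.2.1 L.2.2.1 L.2.2.2⟩

/-- The standard lattice, as a self-dual order. -/
noncomputable def SelfDualOrder.standard (R : Type u) [CommRing R] : SelfDualOrder R :=
  ⟨standardLattice R⟦X⟧ R⸨X⸩, standardLattice_mem algebraMap_laurent_injective⟩

/-- `LG(R)` acts on self-dual orders by `L ↦ g(L)`. -/
noncomputable instance : MulAction (LoopGroup R) (SelfDualOrder R) where
  smul g L := ⟨translate g L.1, translate_mem g L.2.1 L.2.2.1 L.2.2.2⟩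
  one_smul L := Subtype.ext (translate_one L.1)
  mul_smul g h L := Subtype.ext (translate_mul g h L.1)

/-- The positive loop group is the stabilizer of the standard lattice. -/
theorem mem_positiveLoopGroup_iff (g : LoopGroup R) :
    g ∈ positiveLoopGroup R ↔ g • SelfDualOrder.standard R = SelfDualOrder.standard R :=
  (mem_range_autMap_iff algebraMap_laurent_injective g).trans
    ⟨fun h => Subtype.ext h, fun h => congrArg Subtype.val h⟩

theorem SelfDualOrder.map_smul (f : R →+* S) (g : LoopGroup R) (L : SelfDualOrder R) :
    (g • L).map f = loopMap f g • L.map f :=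
  Subtype.ext (baseChange_translate (laurentMap f) g L.1)

theorem SelfDualOrder.map_standard (f : R →+* S) :
    (standard R).map f = standard S :=
  Subtype.ext (baseChange_standardLattice (laurentMap f) (PowerSeries.map f)
    (laurentMap_algebraMap f))

end Loop

section Sheaf

/-- The category of affine `k`-schemes, as the opposite of the category of `k`-algebras. Presheaves on
it are functors on `k`-algebras. -/
abbrev AffineSchemes (k : Type u) [Field k] := (CommAlgCat.{u} k)ᵒᵖ

/-- A family of flat ring maps `R → S i` that is jointly surjective on spectra. -/
def IsFpqcFamily {R : Type u} [CommRing R] {ι : Type} (S : ι → Type u) [∀ i, CommRing (S i)]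
    (f : ∀ i, R →+* S i) : Prop :=
  (∀ i, (f i).Flat) ∧ ∀ p : PrimeSpectrum R, ∃ i, ∃ q : PrimeSpectrum (S i), (PrimeSpectrum.comap (f i)) q = p

open TensorProduct in
theorem exists_prime_tensor {R S T : Type u} [CommRing R] [CommRing S] [CommRing T] [Algebra R S]
    [Algebra R T] (p : PrimeSpectrum S) (q : PrimeSpectrum T)
    (h : PrimeSpectrum.comap (algebraMap R S) p = PrimeSpectrum.comap (algebraMap R T) q) :
    ∃ r : PrimeSpectrum (S ⊗[R] T), PrimeSpectrum.comap (algebraMap S (S ⊗[R] T)) r = p := by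
  change p ∈ Set.range _
  rw [← PrimeSpectrum.nontrivial_iff_mem_rangeComap]
  let P : Ideal R := p.asIdeal.comap (algebraMap R S)
  let _ : Algebra P.ResidueField p.asIdeal.ResidueField :=
    (Ideal.ResidueField.map P p.asIdeal (algebraMap R S) rfl).toAlgebra
  have : IsScalarTower R P.ResidueField p.asIdeal.ResidueField :=
    IsScalarTower.of_algebraMap_eq fun a => by
      simp [RingHom.algebraMap_toAlgebra, IsScalarTower.algebraMap_apply R S p.asIdeal.ResidueField]
  let e : p.asIdeal.ResidueField ⊗[P.ResidueField] (P.ResidueField ⊗[R] T) ≃ₗ[P.ResidueField]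
      p.asIdeal.ResidueField ⊗[R] T :=
    (AlgebraTensorModule.cancelBaseChange R P.ResidueField P.ResidueField p.asIdeal.ResidueField T)
  let e' := (AlgebraTensorModule.cancelBaseChange R S S p.asIdeal.ResidueField T)
  have h1 : Nontrivial (P.ResidueField ⊗[R] T) := by
    have := (PrimeSpectrum.nontrivial_iff_mem_rangeComap (S := T) (PrimeSpectrum.comap (algebraMap R T) q)).2 ⟨q, rfl⟩
    rw [← h] at this
    exact this
  have h2 : Nontrivial (p.asIdeal.ResidueField ⊗[R] T) := e.symm.toEquiv.nontrivial
  exact e'.toEquiv.nontrivial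

/-- The fpqc topology on affine `k`-schemes: a sieve is covering if it contains a finite, jointly
surjective family of flat maps. -/
def fpqcTopology (k : Type u) [Field k] : GrothendieckTopology (AffineSchemes k) where
  sieves X := {S | ∃ (ι : Type) (_ : Finite ι) (A : ι → CommAlgCat.{u} k) (f : ∀ i, X.unop ⟶ A i),
    (∀ i, S.arrows (f i).op) ∧ IsFpqcFamily (fun i => A i) (fun i => (f i).hom.toRingHom)}
  top_mem' X := ⟨Unit, inferInstance, fun _ => X.unop, fun _ => 𝟙 _, fun _ => trivial,
    fun _ => RingHom.Flat.id _, fun p => ⟨(), p, rfl⟩⟩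
  pullback_stable' := by
    rintro X Y S g ⟨ι, hι, A, f, hS, hf, hs⟩
    let _ : Algebra X.unop Y.unop := g.unop.hom.toRingHom.toAlgebra
    let _ : ∀ i, Algebra X.unop (A i) := fun i => (f i).hom.toRingHom.toAlgebra
    have : IsScalarTower k X.unop Y.unop :=
      IsScalarTower.of_algebraMap_eq fun a => (g.unop.hom.commutes a).symm
    have : ∀ i, IsScalarTower k X.unop (A i) := fun i =>
      IsScalarTower.of_algebraMap_eq fun a => ((f i).hom.commutes a).symm
    let inl : ∀ i, Y.unop ⟶ CommAlgCat.of k (TensorProduct X.unop Y.unop (A i)) := fun i =>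
      CommAlgCat.ofHom { Algebra.TensorProduct.includeLeftRingHom with commutes' := fun _ => rfl }
    let inr : ∀ i, A i ⟶ CommAlgCat.of k (TensorProduct X.unop Y.unop (A i)) := fun i =>
      CommAlgCat.ofHom
        { (Algebra.TensorProduct.includeRight :
            A i →ₐ[X.unop] TensorProduct X.unop Y.unop (A i)).toRingHom with
          commutes' := fun a => by
            have h := (Algebra.TensorProduct.includeRight :
              A i →ₐ[X.unop] TensorProduct X.unop Y.unop (A i)).commutes (algebraMap k X.unop a)
            rw [← IsScalarTower.algebraMap_apply k X.unop (A i)] at h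
            refine h.trans ?_
            rw [Algebra.TensorProduct.algebraMap_apply, Algebra.TensorProduct.algebraMap_apply,
              ← IsScalarTower.algebraMap_apply k X.unop Y.unop] }
    refine ⟨ι, hι, fun i => CommAlgCat.of k (TensorProduct X.unop Y.unop (A i)), inl, ?_, ?_, ?_⟩
    · intro i
      have : (inl i).op ≫ g = (inr i).op ≫ (f i).op := by
        apply Quiver.Hom.unop_inj
        ext x
        exact (Algebra.TensorProduct.tmul_one_eq_one_tmul (A := Y.unop) (B := A i) x)
      show S.arrows _
      rw [this]
      exact S.downward_closed (hS i) _
    · intro i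
      have : Module.Flat X.unop (A i) := hf i
      exact (RingHom.flat_algebraMap_iff (R := Y.unop)
        (S := TensorProduct X.unop Y.unop (A i))).2 inferInstance
    · intro p
      obtain ⟨i, q, hq⟩ := hs (PrimeSpectrum.comap g.unop.hom.toRingHom p)
      exact ⟨i, exists_prime_tensor (R := X.unop) p q hq.symm⟩
  transitive' := by
    rintro X S ⟨ι, hι, A, f, hS, hf, hs⟩ T hT
    choose κ hκ B h hB hflat hsurj using fun i => hT (hS i)
    refine ⟨Σ i, κ i, inferInstance, fun j => B j.1 j.2, fun j => f j.1 ≫ h j.1 j.2,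
      fun j => hB j.1 j.2, fun j => (hf j.1).comp (hflat j.1 j.2), fun p => ?_⟩
    obtain ⟨i, q, rfl⟩ := hs p
    obtain ⟨j, r, rfl⟩ := hsurj i q
    exact ⟨⟨i, j⟩, r, rfl⟩

variable (k : Type u) [Field k]

/-- The functor `R ↦ LG(R)`. -/
noncomputable def loopFunctor : (AffineSchemes k)ᵒᵖ ⥤ Type u where
  obj X := LoopGroup X.unop.unop
  map f := TypeCat.ofHom (loopMap f.unop.unop.hom.toRingHom)
  map_id X := by
    ext g : 3
    change autMap (laurentMap (RingHom.id _)) g = g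
    rw [laurentMap_id, autMap_id]
  map_comp f f' := by
    ext g : 3
    change autMap (laurentMap (RingHom.comp _ _)) g = _
    rw [laurentMap_comp, autMap_comp]
    rfl

/-- The functor `R ↦ LG(R) / L⁺G(R)` (before sheafification). -/
noncomputable def quotientFunctor : (AffineSchemes k)ᵒᵖ ⥤ Type u where
  obj X := LoopGroup X.unop.unop ⧸ positiveLoopGroup X.unop.unop
  map f := TypeCat.ofHom (quotientMap f.unop.unop.hom.toRingHom)
  map_id X := by
    ext x
    induction x using QuotientGroup.induction_on with | H g => ?_
    exact congrArg (QuotientGroup.mk (s := positiveLoopGroup X.unop.unop))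
      (ConcreteCategory.congr_hom ((loopFunctor k).map_id X) g)
  map_comp {X Y Z} f f' := by
    ext x
    induction x using QuotientGroup.induction_on with | H g => ?_
    exact congrArg (QuotientGroup.mk (s := positiveLoopGroup Z.unop.unop))
      (ConcreteCategory.congr_hom ((loopFunctor k).map_comp f f') g)

/-- The functor sending `R` to the set of self-dual orders in `C_s ⊗ R((t))`. -/
noncomputable def latticeFunctor : (AffineSchemes k)ᵒᵖ ⥤ Type u where
  obj X := SelfDualOrder X.unop.unop
  map f := TypeCat.ofHom fun L => L.map f.unop.unop.hom.toRingHom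
  map_id X := by
    ext L
    refine Subtype.ext ?_
    change baseChange _ (laurentMap (RingHom.id _)) _ = _
    rw [laurentMap_id]
    exact baseChange_id _
  map_comp f f' := by
    ext L
    refine Subtype.ext ?_
    change baseChange _ (laurentMap (RingHom.comp _ _)) _ = _
    rw [laurentMap_comp]
    exact baseChange_comp _ _ _ (laurentMap_algebraMap _) _

/-- `LG` as a presheaf with values in large sets (the fpqc site is large). -/
noncomputable abbrev loopPresheaf : (AffineSchemes k)ᵒᵖ ⥤ Type (u + 1) :=
  loopFunctor k ⋙ uliftFunctor.{u + 1}

/-- `R ↦ LG(R) / L⁺G(R)` as a presheaf with values in large sets. -/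
noncomputable abbrev quotientPresheaf : (AffineSchemes k)ᵒᵖ ⥤ Type (u + 1) :=
  quotientFunctor k ⋙ uliftFunctor.{u + 1}

/-- The functor of self-dual orders as a presheaf with values in large sets. -/
noncomputable abbrev latticePresheaf : (AffineSchemes k)ᵒᵖ ⥤ Type (u + 1) :=
  latticeFunctor k ⋙ uliftFunctor.{u + 1}

/-- Left translation on a coset space. -/
def leftTranslate {G : Type u} [Group G] (H : Subgroup G) (g : G) (x : G ⧸ H) : G ⧸ H := g • x

/-- The action of `LG` on the presheaf quotient by left translation. -/
noncomputable def quotientAction : loopPresheaf k ⊗ quotientPresheaf k ⟶ quotientPresheaf k where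
  app X := TypeCat.ofHom fun p =>
    let g : LoopGroup X.unop.unop := p.1.down
    let x : LoopGroup X.unop.unop ⧸ positiveLoopGroup X.unop.unop := p.2.down
    ULift.up (leftTranslate (positiveLoopGroup X.unop.unop) g x)
  naturality X Y f := by
    ext ⟨⟨g⟩, ⟨x⟩⟩
    induction x using QuotientGroup.induction_on with | H h => ?_
    exact (congrArg (fun h => ULift.up (QuotientGroup.mk (s := positiveLoopGroup Y.unop.unop) h))
      (map_mul (loopMap f.unop.unop.hom.toRingHom) (show LoopGroup X.unop.unop from g) h)).symm

/-- The action `(g, L) ↦ g(L)` of `LG` on self-dual orders. -/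
noncomputable def latticeAction : loopPresheaf k ⊗ latticePresheaf k ⟶ latticePresheaf k where
  app X := TypeCat.ofHom fun p =>
    let g : LoopGroup X.unop.unop := p.1.down
    let L : SelfDualOrder X.unop.unop := p.2.down
    ULift.up (g • L)
  naturality X Y f := by
    ext ⟨⟨g⟩, ⟨L⟩⟩
    exact congrArg ULift.up (SelfDualOrder.map_smul f.unop.unop.hom.toRingHom g L).symm

/-- The projection of `LG` onto the presheaf quotient. -/
noncomputable def quotientProjection : loopPresheaf k ⟶ quotientPresheaf k where
  app X := TypeCat.ofHom fun g => ULift.up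
    (QuotientGroup.mk (s := positiveLoopGroup X.unop.unop) g.down)

/-- The orbit map `g ↦ g(Λ ⊗ R[[t]])` of the standard lattice. -/
noncomputable def orbitMap : loopPresheaf k ⟶ latticePresheaf k where
  app X := TypeCat.ofHom fun p =>
    let g : LoopGroup X.unop.unop := p.down
    ULift.up (g • SelfDualOrder.standard X.unop.unop)
  naturality X Y f := by
    ext ⟨g⟩
    exact congrArg ULift.up ((SelfDualOrder.map_smul f.unop.unop.hom.toRingHom g _).trans
      (congrArg (fun L => loopMap f.unop.unop.hom.toRingHom g • L)
        (SelfDualOrder.map_standard f.unop.unop.hom.toRingHom))).symm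

/-- The affine Grassmannian: the fpqc quotient of the loop group by the positive loop group, i.e. the
fpqc sheafification of `R ↦ LG(R) / L⁺G(R)`. -/
noncomputable def affineGrassmannian : Sheaf (fpqcTopology k) (Type (u + 1)) :=
  (presheafToSheaf (fpqcTopology k) (Type (u + 1))).obj (quotientPresheaf k)

/-- The canonical map from the presheaf quotient to the affine Grassmannian. -/
noncomputable def toGrassmannian : quotientPresheaf k ⟶ (affineGrassmannian k).obj :=
  toSheafify (fpqcTopology k) (quotientPresheaf k)

/-- The action of `LG` on the affine Grassmannian: the unique morphism extending the action by left
translation on the presheaf quotient. It exists and is unique because `LG × -` preserves morphisms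
that become isomorphisms after sheafification. -/
noncomputable def grassmannianAction :
    loopPresheaf k ⊗ (affineGrassmannian k).obj ⟶ (affineGrassmannian k).obj :=
  (Equiv.ofBijective _ ((((fpqcTopology k).W_toSheafify (quotientPresheaf k)).whiskerLeft
    (loopPresheaf k)) _ (affineGrassmannian k).property)).symm
      (quotientAction k ≫ toGrassmannian k)

theorem grassmannianAction_spec :
    loopPresheaf k ◁ toGrassmannian k ≫ grassmannianAction k =
      quotientAction k ≫ toGrassmannian k :=
  (Equiv.ofBijective _ ((((fpqcTopology k).W_toSheafify (quotientPresheaf k)).whiskerLeft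
    (loopPresheaf k)) _ (affineGrassmannian k).property)).apply_symm_apply _

end Sheaf

end ParaOctonion

/-!
The orbit map identifies `LG(R) / L⁺G(R)` with a subset of the set of self-dual orders, because
`L⁺G(R)` is the stabilizer of the standard lattice. So the theorem amounts to two facts: every
self-dual order is, locally for the fpqc topology, a translate of the standard one, and self-dual
orders form an fpqc sheaf. Given these, the orbit map becomes an isomorphism after sheafification
(`W_cosetOrbitMap`), and equivariance passes to the sheafification by its universal property.

*Local triviality* (`trivialSieve_mem`). The octonion algebra is rebuilt inside a self-dual order `L`
by the Cayley-Dickson process. Three imaginary vectors `i`, `j`, `l` of norm `-1`, each orthogonal to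
the subalgebra generated by the preceding ones, determine an endomorphism of the octonions that maps
a standard triple to them (`frameMap`). It respects the conjugation and the product, hence the form.
If `i`, `j`, `l` lie in `L`, it maps the standard lattice into `L`, and onto `L` since both lattices
are self-dual (`translate_frameAut_standardLattice`).

The vectors are found one after the other. If `L` is self-dual and `n` consists of fewer than eight
orthogonal vectors of norm `±1`, then by Nakayama's lemma the norms of the vectors in `L` orthogonal
to `n` are not all contained in a given prime ideal (`exists_normForm_notMem`). So Zariski locally on `R`
there is such a vector whose norm has an invertible constant term; a square root of minus
this term is adjoined by a flat extension, minus the norm is then a square by Hensel's lemma, and the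
vector can be scaled to have norm `-1`. Here, and for coordinates in a Cayley-Dickson basis, `2` has to be invertible.

*Determinant one* (`det_frameMap`). The isometry above has to be shown to have determinant `1` over an
arbitrary ring in which `2` is invertible. The product of the seven left multiplications by an orthogonal basis of the imaginary
octonions is a scalar for the standard basis, so it is unchanged by an automorphism; expanding it in
the standard basis, the trace of the product is also multiplied by the determinant, since traces of
products of anticommuting operators are alternating (`trace_prod_sum`).

*Descent* (`SelfDualOrder.exists_glue`). The power series ring `S[[t]]` is in general not the base
change of `R[[t]]`, so flat descent cannot be applied to the modules over the power series rings.
But a lattice lies between `t ^ N R[[t]] ^ 8` and `t ^ (-M) R[[t]] ^ 8`, and lattices between these two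
are determined by submodules of the free `R`-module of coefficient vectors in degrees `-M, …, N - 1`,
for which flat descent holds (`mem_of_forall_mem_span`, `mem_span_of_compatible`). The glued lattice is
again projective and self-dual because it contains a finite dual basis: the Casimir element
`∑ xᵢ ⊗ yᵢ` of the form does not depend on the dual basis and lies in the image of `L ⊗ L` locally,
hence globally.
-/

namespace ParaOctonion

/-! ### Octonion identities and Cayley-Dickson triples -/

section Octonion

variable {A : Type u} [CommRing A]

theorem octMul_eq (x y : Oct A) : octMul x y =
    ![x 0 * y 0 - (x 2 * y 5 + x 3 * y 6 + x 4 * y 7),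
      x 1 * y 1 - (x 5 * y 2 + x 6 * y 3 + x 7 * y 4),
      x 0 * y 2 + y 1 * x 2 + (x 6 * y 7 - x 7 * y 6),
      x 0 * y 3 + y 1 * x 3 + (x 7 * y 5 - x 5 * y 7),
      x 0 * y 4 + y 1 * x 4 + (x 5 * y 6 - x 6 * y 5),
      y 0 * x 5 + x 1 * y 5 + (x 3 * y 4 - x 4 * y 3),
      y 0 * x 6 + x 1 * y 6 + (x 4 * y 2 - x 2 * y 4),
      y 0 * x 7 + x 1 * y 7 + (x 2 * y 3 - x 3 * y 2)] := by
  ext i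
  fin_cases i <;> simp [octMul, zorn, wPart, vPart, cross_apply] <;> ring

theorem conj_eq (x : Oct A) : conj x = ![x 1, x 0, -x 2, -x 3, -x 4, -x 5, -x 6, -x 7] := by
  ext i
  fin_cases i <;> simp [conj, bilin_eq, paraUnit, zorn]

/-- The octonion product as a bilinear map. -/
def octMulₗ : Oct A →ₗ[A] Oct A →ₗ[A] Oct A :=
  LinearMap.mk₂ A octMul
    (fun x y z => by ext i; fin_cases i <;> simp [octMul_eq] <;> ring)
    (fun c x y => by ext i; fin_cases i <;> simp [octMul_eq] <;> ring)
    (fun x y z => by ext i; fin_cases i <;> simp [octMul_eq] <;> ring)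
    (fun c x y => by ext i; fin_cases i <;> simp [octMul_eq] <;> ring)

theorem octMulₗ_apply (x y : Oct A) : octMulₗ x y = octMul x y := rfl

/-- Conjugation as a linear map. -/
def conjₗ : Oct A →ₗ[A] Oct A where
  toFun := conj
  map_add' x y := by ext i; fin_cases i <;> simp [conj_eq] <;> ring
  map_smul' c x := by ext i; fin_cases i <;> simp [conj_eq]

theorem conjₗ_apply (x : Oct A) : conjₗ x = conj x := rfl

theorem conj_conj (x : Oct A) : conj (conj x) = x := by
  ext i; fin_cases i <;> simp [conj_eq]

theorem conj_paraUnit : conj (paraUnit A) = paraUnit A := by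
  ext i; fin_cases i <;> simp [conj_eq, paraUnit, zorn]

theorem octMul_paraUnit (x : Oct A) : octMul x (paraUnit A) = x := by
  ext i; fin_cases i <;> simp [octMul_eq, paraUnit, zorn]

theorem paraUnit_octMul (x : Oct A) : octMul (paraUnit A) x = x := by
  ext i; fin_cases i <;> simp [octMul_eq, paraUnit, zorn]

theorem octMul_eq_paraMul (x y : Oct A) : octMul x y = paraMul (conj x) (conj y) := by
  rw [paraMul, conj_conj, conj_conj]

theorem bilin_comm (x y : Oct A) : bilin x y = bilin y x := by
  rw [bilin_eq, bilin_eq]; ring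

theorem bilin_self (x : Oct A) : bilin x x = 2 * normForm x := by
  rw [bilin_eq]; simp [normForm, wPart, vPart]; ring

/-- The left alternative law for conjugate elements, linearized. -/
theorem octMul_conj_octMul_add (x y z : Oct A) :
    octMul x (octMul (conj y) z) + octMul y (octMul (conj x) z) = bilin x y • z := by
  ext i; fin_cases i <;> simp [conj_eq, octMul_eq, bilin_eq] <;> ring

theorem octMul_conj_octMul (x z : Oct A) :
    octMul x (octMul (conj x) z) = normForm x • z := by
  ext i; fin_cases i <;> simp [conj_eq, octMul_eq, normForm, wPart, vPart] <;> ring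

theorem bilin_octMul_left (x y z : Oct A) :
    bilin (octMul x y) z = bilin y (octMul (conj x) z) := by
  simp [conj_eq, octMul_eq, bilin_eq]; ring

theorem octMul_add_conj (x y : Oct A) :
    octMul x y + conj (octMul x y) = bilin (conj x) y • paraUnit A := by
  ext i; fin_cases i <;> simp [conj_eq, octMul_eq, bilin_eq, paraUnit, zorn] <;> ring

theorem normForm_smul (c : A) (x : Oct A) : normForm (c • x) = c ^ 2 * normForm x := by
  simp [normForm, wPart, vPart]; ring

/-- An octonion is imaginary if it is orthogonal to the unit. -/
def IsImaginary (x : Oct A) : Prop := bilin x (paraUnit A) = 0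

theorem IsImaginary.conj {x : Oct A} (h : IsImaginary x) : conj x = -x := by
  rw [ParaOctonion.conj, h, zero_smul, zero_sub]

theorem neg_octMul (x y : Oct A) : octMul (-x) y = -octMul x y := by
  simp only [← octMulₗ_apply, map_neg, LinearMap.neg_apply]

theorem octMul_neg (x y : Oct A) : octMul x (-y) = -octMul x y := by
  simp only [← octMulₗ_apply, map_neg]

theorem octMul_octMul_self {x : Oct A} (hx : IsImaginary x) (z : Oct A) :
    octMul x (octMul x z) = -(normForm x • z) := by
  rw [← octMul_conj_octMul x z, hx.conj, neg_octMul, octMul_neg, neg_neg]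

theorem octMul_octMul_anticomm {x y : Oct A} (hx : IsImaginary x) (hy : IsImaginary y)
    (hxy : bilin x y = 0) (z : Oct A) :
    octMul x (octMul y z) = -octMul y (octMul x z) := by
  have h := octMul_conj_octMul_add x y z
  rw [hx.conj, hy.conj, hxy, zero_smul] at h
  simp only [neg_octMul, octMul_neg] at h
  rw [← neg_add, neg_eq_zero] at h
  exact eq_neg_of_add_eq_zero_left h

theorem octMul_anticomm {x y : Oct A} (hx : IsImaginary x) (hy : IsImaginary y)
    (hxy : bilin x y = 0) : octMul x y = -octMul y x := by
  simpa only [octMul_paraUnit] using octMul_octMul_anticomm hx hy hxy (paraUnit A)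

theorem IsImaginary.octMul {x y : Oct A} (hx : IsImaginary x) (hxy : bilin x y = 0) :
    IsImaginary (octMul x y) := by
  rw [IsImaginary, bilin_octMul_left, octMul_paraUnit, hx.conj, ← bilinₗ_apply, map_neg,
    bilinₗ_apply, bilin_comm, hxy, neg_zero]

/-- A basic triple: three imaginary octonions of norm `-1` which generate the octonion algebra by
the Cayley-Dickson process, that is, each is orthogonal to the subalgebra generated by the
preceding ones. The common norm `-1` makes the algebra split. -/
structure IsBasicTriple (i j l : Oct A) : Prop where
  imag_i : IsImaginary i
  imag_j : IsImaginary j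
  imag_l : IsImaginary l
  norm_i : normForm i = -1
  norm_j : normForm j = -1
  norm_l : normForm l = -1
  orth_ij : bilin i j = 0
  orth_il : bilin i l = 0
  orth_jl : bilin j l = 0
  orth_ijl : bilin (octMul i j) l = 0

/-- The eight Cayley-Dickson products of three octonions. -/
def cdFamily (i j l : Oct A) : Fin 8 → Oct A :=
  ![paraUnit A, i, j, octMul i j, l, octMul i l, octMul j l, octMul (octMul i j) l]

namespace IsBasicTriple

variable {i j l : Oct A} (h : IsBasicTriple i j l)
include h

theorem imag_cdFamily (p : Fin 7) : IsImaginary (cdFamily i j l p.succ) := by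
  fin_cases p
  · exact h.imag_i
  · exact h.imag_j
  · exact h.imag_i.octMul h.orth_ij
  · exact h.imag_l
  · exact h.imag_i.octMul h.orth_il
  · exact h.imag_j.octMul h.orth_jl
  · exact (h.imag_i.octMul h.orth_ij).octMul h.orth_ijl

theorem octMul_i_cdFamily (p : Fin 8) : octMul i (cdFamily i j l p) =
    ![1, 1, 1, 1, 1, 1, -1, -1] p • cdFamily i j l (![1, 0, 3, 2, 5, 4, 7, 6] p) := by
  have hs : ∀ z, octMul i (octMul i z) = z := fun z => by
    rw [octMul_octMul_self h.imag_i, h.norm_i, neg_smul, one_smul, neg_neg]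
  have h6 : octMul i (octMul j l) = -octMul (octMul i j) l := by
    rw [octMul_anticomm h.imag_j h.imag_l h.orth_jl, octMul_neg,
      octMul_octMul_anticomm h.imag_i h.imag_l h.orth_il, neg_neg,
      octMul_anticomm h.imag_l (h.imag_i.octMul h.orth_ij) (by rw [bilin_comm, h.orth_ijl])]
  have h7 := hs (octMul j l)
  rw [h6, octMul_neg] at h7
  fin_cases p <;> simp [cdFamily, hs, h6, octMul_paraUnit]
  · simpa [octMul_paraUnit] using hs (paraUnit A)
  · rw [← h7, neg_neg]

theorem octMul_j_cdFamily (p : Fin 8) : octMul j (cdFamily i j l p) =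
    ![1, -1, 1, -1, 1, 1, 1, 1] p • cdFamily i j l (![2, 3, 0, 1, 6, 7, 4, 5] p) := by
  have hs : ∀ z, octMul j (octMul j z) = z := fun z => by
    rw [octMul_octMul_self h.imag_j, h.norm_j, neg_smul, one_smul, neg_neg]
  have hc : ∀ z, octMul j (octMul i z) = -octMul i (octMul j z) :=
    octMul_octMul_anticomm h.imag_j h.imag_i (by rw [bilin_comm, h.orth_ij])
  have hjj : octMul j j = paraUnit A := by simpa [octMul_paraUnit] using hs (paraUnit A)
  have h6 := h.octMul_i_cdFamily 6
  have hji := hc (paraUnit A)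
  simp [cdFamily] at h6
  simp only [octMul_paraUnit] at hji
  have h5 : octMul j (octMul i l) = octMul (octMul i j) l := by
    rw [hc, h6, neg_neg]
  fin_cases p <;> simp [cdFamily, hs, octMul_paraUnit, hjj, hji, hc, h6]
  rw [← h5, hs]

theorem octMul_l_cdFamily (p : Fin 8) : octMul l (cdFamily i j l p) =
    ![1, -1, -1, -1, 1, -1, -1, -1] p • cdFamily i j l (![4, 5, 6, 7, 0, 1, 2, 3] p) := by
  have hs : ∀ z, octMul l (octMul l z) = z := fun z => by
    rw [octMul_octMul_self h.imag_l, h.norm_l, neg_smul, one_smul, neg_neg]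
  have hll : octMul l l = paraUnit A := by simpa [octMul_paraUnit] using hs (paraUnit A)
  have key : ∀ x : Oct A, IsImaginary x → bilin x l = 0 →
      octMul l x = -octMul x l ∧ octMul l (octMul x l) = -x := by
    intro x hx hxl
    have h1 : octMul l x = -octMul x l :=
      octMul_anticomm h.imag_l hx (by rw [bilin_comm, hxl])
    refine ⟨h1, ?_⟩
    have h2 := hs x
    rw [h1, octMul_neg] at h2
    rw [← h2, neg_neg]
    simp [h2]
  obtain ⟨a1, a2⟩ := key i h.imag_i h.orth_il
  obtain ⟨b1, b2⟩ := key j h.imag_j h.orth_jl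
  obtain ⟨c1, c2⟩ := key _ (h.imag_i.octMul h.orth_ij) h.orth_ijl
  fin_cases p <;> simp [cdFamily, octMul_paraUnit, hll, a1, a2, b1, b2, c1, c2]

end IsBasicTriple

end Octonion

/-! ### Traces of products of anticommuting elements -/

section Anticommuting

variable {A E : Type*} [CommRing A] [Ring E] [Algebra A E]

theorem mul_prod_of_anticomm (y : E) (l : List E) (hl : ∀ x ∈ l, y * x = -(x * y)) :
    y * l.prod = (-1 : ℤ) ^ l.length • (l.prod * y) := by
  induction l with
  | nil => simp
  | cons x l ih =>
    rw [List.prod_cons, ← mul_assoc, hl x (by simp), neg_mul, mul_assoc,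
      ih fun z hz => hl z (by simp [hz]), List.length_cons, pow_succ, mul_smul_comm, ← mul_assoc]
    simp

variable {τ : E →ₗ[A] A} (hτ : ∀ x y, τ (x * y) = τ (y * x)) {b : Fin 7 → E}
  (hb : ∀ p q, p ≠ q → b p * b q = -(b q * b p))

include hτ hb in
/-- A trace of an odd product of anticommuting units vanishes as soon as one of the seven units
does not occur in it, since conjugation by that unit changes the sign of the product. -/
theorem trace_prod_eq_zero (h2 : IsUnit (2 : A)) (hu : ∀ p, IsUnit (b p)) (s : Fin 7 → Fin 7)
    (hs : ¬ Function.Surjective s) : τ (List.ofFn (b ∘ s)).prod = 0 := by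
  rw [Function.Surjective, not_forall] at hs
  obtain ⟨q, hq⟩ := hs
  push Not at hq
  obtain ⟨y, hy⟩ := hu q
  have h1 := mul_prod_of_anticomm (b q) (List.ofFn (b ∘ s)) (by
    simp only [List.mem_ofFn, Function.comp_apply]
    rintro _ ⟨k, rfl⟩
    exact hb _ _ (hq k).symm)
  set P := (List.ofFn (b ∘ s)).prod
  rw [List.length_ofFn, ← hy] at h1
  have h3 : P * (y : E) = -((y : E) * P) := by rw [h1]; norm_num
  have h4 : τ P = -τ P := by
    conv_lhs => rw [← mul_one P, ← y.mul_inv, ← mul_assoc, hτ, h3, mul_neg, ← mul_assoc,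
      y.inv_mul, one_mul, map_neg]
  rw [← h2.mul_right_eq_zero, two_mul]
  nth_rw 2 [h4]
  exact add_neg_cancel _

include hb in
/-- Products of anticommuting elements are alternating. -/
theorem prod_comp_perm (σ : Equiv.Perm (Fin 7)) :
    (List.ofFn (b ∘ σ)).prod = Equiv.Perm.sign σ • (List.ofFn b).prod := by
  have h : σ ∈ Submonoid.closure (Set.range fun i : Fin 6 => Equiv.swap i.castSucc i.succ) := by
    rw [Equiv.Perm.mclosure_swap_castSucc_succ]; trivial
  induction h using Submonoid.closure_induction_right with
  | one => simp
  | mul_right σ _ x hx ih =>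
    obtain ⟨i, rfl⟩ := hx
    rw [Equiv.Perm.sign_mul, Equiv.Perm.sign_swap i.castSucc_lt_succ.ne, mul_neg, mul_one,
      Units.neg_smul, ← ih]
    have hc : ∀ p q, p ≠ q → b (σ p) * b (σ q) = -(b (σ q) * b (σ p)) := fun p q hpq =>
      hb _ _ (σ.injective.ne hpq)
    have hc' : ∀ p q, p ≠ q → ∀ z, b (σ p) * (b (σ q) * z) = -(b (σ q) * (b (σ p) * z)) :=
      fun p q hpq z => by rw [← mul_assoc, hc p q hpq, neg_mul, mul_assoc]
    -- Each adjacent transposition is one application of the anticommutation relation.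
    fin_cases i <;> simp [List.ofFn_succ, Equiv.swap_apply_def]
    · rw [hc' 1 0 (by decide)]
    · rw [hc' 2 1 (by decide), mul_neg]
    · rw [hc' 3 2 (by decide)]; simp only [mul_neg]
    · rw [hc' 4 3 (by decide)]; simp only [mul_neg]
    · rw [hc' 5 4 (by decide)]; simp only [mul_neg]
    · rw [hc 6 5 (by decide)]; simp only [mul_neg]

include hτ hb in
/-- The trace of the product of seven linear combinations of anticommuting units is alternating in
the coefficient vectors: the terms with a repeated factor have trace zero. -/
theorem trace_prod_sum (h2 : IsUnit (2 : A)) (hu : ∀ p, IsUnit (b p))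
    (m : Matrix (Fin 7) (Fin 7) A) :
    τ (List.ofFn fun k => ∑ q, m q k • b q).prod = m.det * τ (List.ofFn b).prod := by
  have h := (MultilinearMap.mkPiAlgebraFin A 7 E).map_sum (fun k q => m q k • b q)
  simp only [MultilinearMap.mkPiAlgebraFin_apply] at h
  rw [h, map_sum, Matrix.det_apply, Finset.sum_mul]
  have h' : ∀ s : Fin 7 → Fin 7, (List.ofFn fun k => m (s k) k • b (s k)).prod =
      (∏ k, m (s k) k) • (List.ofFn (b ∘ s)).prod := fun s =>
    (MultilinearMap.mkPiAlgebraFin A 7 E).map_smul_univ (fun k => m (s k) k) (b ∘ s)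
  simp only [h', map_smul]
  symm
  refine Finset.sum_of_injOn (fun σ : Equiv.Perm (Fin 7) => (σ : Fin 7 → Fin 7))
    DFunLike.coe_injective.injOn (fun _ _ => Finset.mem_coe.2 (Finset.mem_univ _)) ?_ ?_
  · intro s _ hs
    rw [trace_prod_eq_zero hτ hb h2 hu, smul_zero]
    intro hsurj
    exact hs ⟨Equiv.ofBijective s hsurj.bijective_of_finite, by simp, rfl⟩
  · intro σ _
    rw [prod_comp_perm hb, Units.smul_def, Units.smul_def, map_zsmul]
    simp only [smul_eq_mul, zsmul_eq_mul]
    ring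

end Anticommuting

/-! ### The automorphism defined by a basic triple -/

theorem det_eq_det_submatrix_succ {A : Type*} [CommRing A] {n : ℕ}
    (N : Matrix (Fin (n + 1)) (Fin (n + 1)) A)
    (hN : ∀ q, N q 0 = (Pi.single 0 1 : Fin (n + 1) → A) q) :
    N.det = (N.submatrix Fin.succ Fin.succ).det := by
  rw [Matrix.det_succ_column_zero, Fin.sum_univ_succ, Finset.sum_eq_zero]
  · simp [hN]
  · intro q _
    rw [hN, Pi.single_eq_of_ne (Fin.succ_ne_zero q), mul_zero, zero_mul]

section Frame

variable {A : Type u} [CommRing A]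

/-- Left multiplication by `x` is intertwined by `g` with left multiplication by `g x`. -/
def LeftCompatible (g : Oct A →ₗ[A] Oct A) (x : Oct A) : Prop :=
  ∀ y, g (octMul x y) = octMul (g x) (g y)

/-- Left multiplication by a product expressed by the left multiplications by its factors and the
conjugation. -/
theorem octMul_octMul_eq (x y w : Oct A) :
    octMul (octMul x y) w = bilin (conj y) w • x - conj (octMul y (conj (octMul x (conj w)))) := by
  ext i; fin_cases i <;> simp [conj_eq, octMul_eq, bilin_eq] <;> ring

/-- If `g` commutes with conjugation and left multiplication by `x` and by `y` is compatible with
`g`, then so is left multiplication by `x · y`, in spite of the lack of associativity. -/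
theorem LeftCompatible.octMul {g : Oct A →ₗ[A] Oct A} (hc : ∀ x, g (conj x) = conj (g x))
    (he : g (paraUnit A) = paraUnit A) {x y : Oct A} (hx : LeftCompatible g x)
    (hy : LeftCompatible g y) : LeftCompatible g (octMul x y) := by
  intro w
  have hb : bilin (conj y) w = bilin (conj (g y)) (g w) := by
    have h := congrArg g (octMul_add_conj y w)
    rw [map_add, hc, hy, octMul_add_conj, map_smul, he] at h
    have := congrFun h 0
    simpa [paraUnit, zorn] using this.symm
  rw [octMul_octMul_eq, map_sub, map_smul, hc, hy, hc, hx, hc, hb, hx y, octMul_octMul_eq]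

/-- The coordinates of an octonion in the Cayley-Dickson family of the standard basic triple
`e₁ - e₂`, `u₁ - v₁`, `u₂ - v₂`, where `c` is the inverse of `2`. -/
def stdCoord (c : A) : Oct A →ₗ[A] (Fin 8 → A) where
  toFun x := c • ![x 0 + x 1, x 0 - x 1, x 2 - x 5, x 2 + x 5, x 3 - x 6, x 3 + x 6, x 4 + x 7,
    x 7 - x 4]
  map_add' x y := by ext i; fin_cases i <;> simp <;> ring
  map_smul' r x := by ext i; fin_cases i <;> simp <;> ring

variable (A) in
/-- The Cayley-Dickson family of the standard basic triple. -/
def stdFamily : Fin 8 → Oct A :=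
  cdFamily ![1, -1, 0, 0, 0, 0, 0, 0] ![0, 0, 1, 0, 0, -1, 0, 0] ![0, 0, 0, 1, 0, 0, -1, 0]

theorem cdFamily_zero (i j l : Oct A) : cdFamily i j l 0 = paraUnit A := rfl

theorem stdFamily_zero : stdFamily A 0 = paraUnit A := rfl

theorem stdFamily_eq : stdFamily A = ![![1, 1, 0, 0, 0, 0, 0, 0], ![1, -1, 0, 0, 0, 0, 0, 0],
    ![0, 0, 1, 0, 0, -1, 0, 0], ![0, 0, 1, 0, 0, 1, 0, 0], ![0, 0, 0, 1, 0, 0, -1, 0],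
    ![0, 0, 0, 1, 0, 0, 1, 0], ![0, 0, 0, 0, 1, 0, 0, 1], ![0, 0, 0, 0, -1, 0, 0, 1]] := by
  ext p i
  fin_cases p <;> fin_cases i <;> simp [stdFamily, cdFamily, octMul_eq, paraUnit, zorn]

theorem isBasicTriple_std : IsBasicTriple (A := A) ![1, -1, 0, 0, 0, 0, 0, 0]
    ![0, 0, 1, 0, 0, -1, 0, 0] ![0, 0, 0, 1, 0, 0, -1, 0] := by
  constructor <;>
    simp [IsImaginary, bilin_eq, octMul_eq, normForm, paraUnit, zorn, wPart, vPart]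

theorem sum_stdCoord {c : A} (hc : 2 * c = 1) (x : Oct A) :
    ∑ p, stdCoord c x p • stdFamily A p = x := by
  ext i
  fin_cases i <;> simp [Fin.sum_univ_eight, stdCoord, stdFamily_eq] <;> first
    | linear_combination x 0 * hc | linear_combination x 1 * hc | linear_combination x 2 * hc
    | linear_combination x 3 * hc | linear_combination x 4 * hc | linear_combination x 5 * hc
    | linear_combination x 6 * hc | linear_combination x 7 * hc

theorem stdCoord_stdFamily {c : A} (hc : 2 * c = 1) (p : Fin 8) :
    stdCoord c (stdFamily A p) = Pi.single p 1 := by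
  ext i
  fin_cases p <;> fin_cases i <;> simp [stdCoord, stdFamily_eq] <;> linear_combination hc

/-- The volume element: the product of the seven left multiplications by the imaginary members of
the standard Cayley-Dickson family is a scalar. -/
theorem prod_octMulₗ_stdFamily : (List.ofFn fun p : Fin 7 =>
    (octMulₗ (stdFamily A p.succ) : Module.End A (Oct A))).prod = -1 := by
  have h1 (z : Oct A) : octMul (stdFamily A 1) z =
      ![z 0, -z 1, z 2, z 3, z 4, -z 5, -z 6, -z 7] := by
    ext p; fin_cases p <;> simp [stdFamily_eq, octMul_eq]
  have h2 (z : Oct A) : octMul (stdFamily A 2) z =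
      ![-z 5, z 2, z 1, z 7, -z 6, -z 0, -z 4, z 3] := by
    ext p; fin_cases p <;> simp [stdFamily_eq, octMul_eq]
  have h3 (z : Oct A) : octMul (stdFamily A 3) z =
      ![-z 5, -z 2, z 1, -z 7, z 6, z 0, -z 4, z 3] := by
    ext p; fin_cases p <;> simp [stdFamily_eq, octMul_eq]
  have h4 (z : Oct A) : octMul (stdFamily A 4) z =
      ![-z 6, z 3, -z 7, z 1, z 5, z 4, -z 0, -z 2] := by
    ext p; fin_cases p <;> simp [stdFamily_eq, octMul_eq]
  have h5 (z : Oct A) : octMul (stdFamily A 5) z =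
      ![-z 6, -z 3, z 7, z 1, -z 5, z 4, z 0, -z 2] := by
    ext p; fin_cases p <;> simp [stdFamily_eq, octMul_eq]
  have h6 (z : Oct A) : octMul (stdFamily A 6) z =
      ![-z 7, -z 4, -z 6, z 5, z 1, -z 3, z 2, z 0] := by
    ext p; fin_cases p <;> simp [stdFamily_eq, octMul_eq]
  have h7 (z : Oct A) : octMul (stdFamily A 7) z =
      ![z 7, -z 4, -z 6, z 5, -z 1, z 3, -z 2, z 0] := by
    ext p; fin_cases p <;> simp [stdFamily_eq, octMul_eq]
  refine LinearMap.ext fun z => ?_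
  have h : octMul (stdFamily A 1) (octMul (stdFamily A 2) (octMul (stdFamily A 3)
      (octMul (stdFamily A 4) (octMul (stdFamily A 5) (octMul (stdFamily A 6)
      (octMul (stdFamily A 7) z)))))) = -z := by
    simp only [h7, h6, h5, h4, h3, h2, h1]
    ext p; fin_cases p <;> simp
  rw [← sub_eq_zero] at h ⊢
  rw [← h]
  simp only [List.ofFn_succ, List.ofFn_zero, List.prod_cons, List.prod_nil, mul_one,
    Module.End.mul_apply, octMulₗ_apply, LinearMap.neg_apply, Module.End.one_apply]
  rfl

/-- The coordinates in the standard Cayley-Dickson family as a linear equivalence. -/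
def stdCoordEquiv {c : A} (hc : 2 * c = 1) : Oct A ≃ₗ[A] (Fin 8 → A) :=
  LinearEquiv.ofLinearMap (stdCoord c) (Fintype.linearCombination A (stdFamily A))
    (by
      refine (Pi.basisFun A (Fin 8)).ext fun p => ?_
      rw [LinearMap.comp_apply, Pi.basisFun_apply, Fintype.linearCombination_apply_single,
        one_smul, stdCoord_stdFamily hc, LinearMap.id_apply])
    (LinearMap.ext fun x => sum_stdCoord hc x)

theorem toMatrix'_conj_stdCoordEquiv {c : A} (hc : 2 * c = 1) (g : Oct A →ₗ[A] Oct A)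
    (q p : Fin 8) :
    LinearMap.toMatrix' ((stdCoordEquiv hc).toLinearMap ∘ₗ g ∘ₗ (stdCoordEquiv hc).symm) q p =
      stdCoord c (g (stdFamily A p)) q := by
  have h : (stdCoordEquiv hc).symm (Pi.single p 1) = stdFamily A p := by
    rw [LinearEquiv.symm_apply_eq]
    exact (stdCoord_stdFamily hc p).symm
  rw [LinearMap.toMatrix'_apply]
  exact congrArg (fun z => stdCoord c (g z) q) h

/-- The linear map that sends the standard Cayley-Dickson family to a given one. -/
def frameMap (c : A) (i j l : Oct A) : Oct A →ₗ[A] Oct A :=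
  (Fintype.linearCombination A (cdFamily i j l)).comp (stdCoord c)

theorem frameMap_stdFamily {c : A} (hc : 2 * c = 1) (i j l : Oct A) (p : Fin 8) :
    frameMap c i j l (stdFamily A p) = cdFamily i j l p := by
  rw [frameMap, LinearMap.comp_apply, stdCoord_stdFamily hc,
    Fintype.linearCombination_apply_single, one_smul]

theorem ext_stdFamily {c : A} (hc : 2 * c = 1) {M : Type*} [AddCommGroup M] [Module A M]
    {f g : Oct A →ₗ[A] M} (h : ∀ p, f (stdFamily A p) = g (stdFamily A p)) : f = g := by
  refine LinearMap.ext fun x => ?_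
  rw [← sum_stdCoord hc x, map_sum, map_sum]
  exact Finset.sum_congr rfl fun p _ => by rw [map_smul, map_smul, h]

variable {c : A} (hc : 2 * c = 1) {i j l : Oct A} (h : IsBasicTriple i j l)
include hc h

theorem frameMap_conj (x : Oct A) :
    frameMap c i j l (conj x) = conj (frameMap c i j l x) := by
  refine LinearMap.congr_fun (f := (frameMap c i j l).comp conjₗ)
    (g := conjₗ.comp (frameMap c i j l)) (ext_stdFamily hc fun p => ?_) x
  simp only [LinearMap.comp_apply, conjₗ_apply, frameMap_stdFamily hc]
  cases p using Fin.cases with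
  | zero =>
    change frameMap c i j l (conj (paraUnit A)) = conj (paraUnit A)
    rw [conj_paraUnit]
    exact frameMap_stdFamily hc i j l 0
  | succ p =>
    rw [(h.imag_cdFamily p).conj, stdFamily, (isBasicTriple_std.imag_cdFamily p).conj, map_neg]
    exact congrArg _ (frameMap_stdFamily hc i j l p.succ)

theorem frameMap_octMul (x y : Oct A) :
    frameMap c i j l (octMul x y) = octMul (frameMap c i j l x) (frameMap c i j l y) := by
  have hcd := frameMap_stdFamily hc i j l
  have hconj := frameMap_conj hc h
  set g := frameMap c i j l with hg
  have he : g (paraUnit A) = paraUnit A := hcd 0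
  have hmk : ∀ p : Fin 8, (∀ q, g (octMul (stdFamily A p) (stdFamily A q)) =
      octMul (g (stdFamily A p)) (g (stdFamily A q))) → LeftCompatible g (stdFamily A p) := by
    intro p hp y
    exact LinearMap.congr_fun (f := g.comp (octMulₗ (stdFamily A p)))
      (g := (octMulₗ (g (stdFamily A p))).comp g) (ext_stdFamily hc hp) y
  have h1 : LeftCompatible g (stdFamily A 1) := hmk 1 fun q => by
    rw [hcd, hcd]
    exact (congrArg g (isBasicTriple_std.octMul_i_cdFamily q)).trans
      (by rw [map_zsmul]; exact (congrArg _ (hcd _)).trans (h.octMul_i_cdFamily q).symm)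
  have h2 : LeftCompatible g (stdFamily A 2) := hmk 2 fun q => by
    rw [hcd, hcd]
    exact (congrArg g (isBasicTriple_std.octMul_j_cdFamily q)).trans
      (by rw [map_zsmul]; exact (congrArg _ (hcd _)).trans (h.octMul_j_cdFamily q).symm)
  have h4 : LeftCompatible g (stdFamily A 4) := hmk 4 fun q => by
    rw [hcd, hcd]
    exact (congrArg g (isBasicTriple_std.octMul_l_cdFamily q)).trans
      (by rw [map_zsmul]; exact (congrArg _ (hcd _)).trans (h.octMul_l_cdFamily q).symm)
  have h0 : LeftCompatible g (stdFamily A 0) := fun y => by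
    change g (octMul (paraUnit A) y) = octMul (g (paraUnit A)) (g y)
    rw [he, paraUnit_octMul, paraUnit_octMul]
  have h3 : LeftCompatible g (stdFamily A 3) := h1.octMul hconj he h2
  have hall : ∀ p, LeftCompatible g (stdFamily A p) := by
    intro p
    fin_cases p
    exacts [h0, h1, h2, h3, h4, h1.octMul hconj he h4, h2.octMul hconj he h4,
      h3.octMul hconj he h4]
  refine LinearMap.congr_fun₂ (f := octMulₗ.compr₂ g) (g := octMulₗ.compl₁₂ g g) ?_ x y
  exact ext_stdFamily hc fun p => LinearMap.ext fun y => hall p y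

theorem frameMap_bilin (x y : Oct A) :
    bilin (frameMap c i j l x) (frameMap c i j l y) = bilin x y := by
  have h1 := congrArg (frameMap c i j l) (octMul_add_conj (conj x) y)
  have he : frameMap c i j l (paraUnit A) = paraUnit A := frameMap_stdFamily hc i j l 0
  rw [map_add, frameMap_conj hc h, frameMap_octMul hc h, frameMap_conj hc h, octMul_add_conj,
    map_smul, he, conj_conj, conj_conj] at h1
  simpa [paraUnit, zorn] using congrFun h1 0

/-- A linear isometry of the form has the left inverse given by its adjoint. -/
theorem isUnit_frameMap : IsUnit (frameMap c i j l) := by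
  let b : Oct A →ₗ[A] Oct A := LinearMap.pi fun p =>
    (bilinₗ (frameMap c i j l (Pi.single (![1, 0, 5, 6, 7, 2, 3, 4] p) 1)))
  have h1 : b * frameMap c i j l = 1 := by
    refine LinearMap.ext fun x => funext fun p => ?_
    change bilin _ _ = _
    rw [frameMap_bilin hc h]
    fin_cases p <;> simp [bilin_eq]
  exact IsUnit.of_mul_eq_one_right _ h1

/-- The determinant on imaginary octonions is read off from the volume element, which is a scalar
and hence invariant under `g`, while it is multiplied by the determinant of `g` as an alternating
form. -/
theorem det_imaginary_frameMap : Matrix.det (Matrix.of fun q k : Fin 7 =>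
    stdCoord c (frameMap c i j l (stdFamily A k.succ)) q.succ) = 1 := by
  nontriviality A
  have h2 : IsUnit (2 : A) := IsUnit.of_mul_eq_one _ hc
  set g := frameMap c i j l with hg
  let b : Fin 7 → Module.End A (Oct A) := fun p => octMulₗ (stdFamily A p.succ)
  have him : ∀ p : Fin 7, IsImaginary (stdFamily A p.succ) := isBasicTriple_std.imag_cdFamily
  have hb : ∀ p q, p ≠ q → b p * b q = -(b q * b p) := by
    intro p q hpq
    refine LinearMap.ext fun z => octMul_octMul_anticomm (him p) (him q) ?_ z
    revert hpq
    fin_cases p <;> fin_cases q <;> simp [stdFamily_eq, bilin_eq]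
  have hu : ∀ p, IsUnit (b p) := by
    intro p
    refine IsUnit.of_mul_eq_one (-normForm (stdFamily A p.succ) • b p) ?_
    refine LinearMap.ext fun z => ?_
    rw [mul_smul_comm, LinearMap.smul_apply]
    change _ • octMul _ (octMul _ _) = _
    rw [octMul_octMul_self (him p), neg_smul, smul_neg, neg_neg, smul_smul]
    fin_cases p <;> simp [stdFamily_eq, normForm, wPart, vPart]
  have hP : (List.ofFn b).prod = -1 := prod_octMulₗ_stdFamily
  -- Conjugation by `g` turns the product of the `b p` into the product of their images.
  have hconj : ∀ xs : List (Oct A), (xs.map fun x => octMulₗ (g x)).prod * g =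
      g * (xs.map octMulₗ).prod := by
    intro xs
    induction xs with
    | nil => simp
    | cons x xs ih =>
      rw [List.map_cons, List.map_cons, List.prod_cons, List.prod_cons, mul_assoc, ih, ← mul_assoc,
        ← mul_assoc]
      congr 1
      exact LinearMap.ext fun y => (frameMap_octMul hc h x y).symm
  have hP' : (List.ofFn fun k : Fin 7 => octMulₗ (g (stdFamily A k.succ))).prod = -1 := by
    have h1 := hconj (List.ofFn fun k : Fin 7 => stdFamily A k.succ)
    rw [List.map_ofFn, List.map_ofFn] at h1
    refine (isUnit_frameMap hc h).mul_right_cancel (h1.trans ?_)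
    change g * (List.ofFn b).prod = _
    exact (congrArg (g * ·) hP).trans ((mul_neg_one g).trans (neg_one_mul g).symm)
  let m : Matrix (Fin 7) (Fin 7) A := Matrix.of fun q k => stdCoord c (g (stdFamily A k.succ)) q.succ
  have h0 : ∀ k : Fin 7, stdCoord c (g (stdFamily A k.succ)) 0 = 0 := by
    intro k
    have := h.imag_cdFamily k
    rw [← frameMap_stdFamily hc, IsImaginary] at this
    simp [bilin_eq, paraUnit, zorn] at this
    simp [stdCoord, this, hg]
  have hsum : ∀ k : Fin 7, (octMulₗ (g (stdFamily A k.succ)) : Module.End A (Oct A)) =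
      ∑ q, m q k • b q := by
    intro k
    conv_lhs => rw [← sum_stdCoord hc (g (stdFamily A k.succ)), Fin.sum_univ_succ, h0, zero_smul,
      zero_add, map_sum]
    simp only [map_smul, m, b, Matrix.of_apply]
  have h1 := trace_prod_sum (τ := LinearMap.trace A (Oct A)) (LinearMap.trace_mul_comm A) hb h2
    hu m
  simp only [← hsum, hP, hP'] at h1
  rw [map_neg, LinearMap.trace_one, Module.finrank_fin_fun] at h1
  have h8 : IsUnit (-((8 : ℕ) : A)) := by
    have : -((8 : ℕ) : A) = -(2 ^ 3) := by norm_num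
    rw [this]
    exact (h2.pow 3).neg
  exact (h8.mul_left_inj.1 (h1.symm.trans (one_mul _).symm))

/-- Since `g` fixes the unit and preserves imaginary octonions, its determinant is that of its
restriction to the imaginary octonions. -/
theorem det_frameMap : LinearMap.det (frameMap c i j l) = 1 := by
  have h1 := LinearMap.det_conj (frameMap c i j l) (stdCoordEquiv hc)
  rw [← h1, ← LinearMap.det_toMatrix', det_eq_det_submatrix_succ]
  · refine Eq.trans (congrArg Matrix.det ?_) (det_imaginary_frameMap hc h)
    ext q k
    rw [Matrix.submatrix_apply, Matrix.of_apply, toMatrix'_conj_stdCoordEquiv]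
  · intro q
    rw [toMatrix'_conj_stdCoordEquiv, frameMap_stdFamily hc, ← stdCoord_stdFamily hc 0,
      cdFamily_zero, stdFamily_zero]

end Frame

/-! ### Self-dual orders containing a basic triple -/

section Unimodular

open Matrix.SpecialLinearGroup (toLin')

variable {O A : Type u} [CommRing O] [CommRing A] [Algebra O A]

theorem eq_zero_of_bilin_eq_zero {x : Oct A} (h : ∀ y, bilin x y = 0) : x = 0 := by
  ext p
  have := h (Pi.single (![1, 0, 5, 6, 7, 2, 3, 4] p) 1)
  fin_cases p <;> simpa [bilin_eq] using this

/-- A self-dual lattice is maximal among the lattices on which the form is integral. -/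
theorem eq_of_le_of_isSelfDual {N L : Submodule O (Oct A)} (hN : IsLattice N)
    (hN' : IsSelfDual N) (hL : IsSelfDual L) (hNL : N ≤ L) : N = L := by
  refine le_antisymm hNL fun x hx => ?_
  obtain ⟨ψ, hψ⟩ := hN'
  obtain ⟨χ, hχ⟩ := hL
  obtain ⟨n, hn⟩ := ψ.surjective ((χ ⟨x, hx⟩).comp (Submodule.inclusion hNL))
  have h : ∀ y, bilin ((n : Oct A) - x) y = 0 := by
    intro y
    have hy : y ∈ Submodule.span A (N : Set (Oct A)) := hN.span_eq_top ▸ Submodule.mem_top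
    have hle : Submodule.span A (N : Set (Oct A)) ≤ LinearMap.ker (bilinₗ ((n : Oct A) - x)) := by
      refine Submodule.span_le.2 fun y hy => ?_
      have h1 := LinearMap.congr_fun hn ⟨y, hy⟩
      have h2 := congrArg (algebraMap O A) h1
      rw [hψ] at h2
      rw [SetLike.mem_coe, LinearMap.mem_ker, map_sub, LinearMap.sub_apply, sub_eq_zero]
      exact h2.trans (hχ ⟨x, hx⟩ ⟨y, hNL hy⟩)
    exact hle hy
  rw [← sub_eq_zero.1 (eq_zero_of_bilin_eq_zero h)]
  exact n.2

/-- `frameMap` as an element of the special linear group. -/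
def frameSL {c : A} (hc : 2 * c = 1) {i j l : Oct A} (h : IsBasicTriple i j l) :
    Matrix.SpecialLinearGroup (Fin 8) A :=
  ⟨LinearMap.toMatrix' (frameMap c i j l), by rw [LinearMap.det_toMatrix', det_frameMap hc h]⟩

theorem toLin'_frameSL {c : A} (hc : 2 * c = 1) {i j l : Oct A} (h : IsBasicTriple i j l)
    (x : Oct A) : toLin' (frameSL hc h) x = frameMap c i j l x := by
  rw [Matrix.SpecialLinearGroup.toLin'_apply]
  exact LinearMap.congr_fun (Matrix.toLin'_toMatrix' (frameMap c i j l)) x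

/-- The automorphism of the split octonions that sends the standard basic triple to a given one. -/
def frameAut {c : A} (hc : 2 * c = 1) {i j l : Oct A} (h : IsBasicTriple i j l) : autGroup A :=
  ⟨frameSL hc h, fun x y => by
    rw [toLin'_frameSL, toLin'_frameSL, frameMap_bilin hc h], fun x y => by
    rw [toLin'_frameSL, toLin'_frameSL, toLin'_frameSL, paraMul, paraMul, frameMap_octMul hc h,
      frameMap_conj hc h, frameMap_conj hc h]⟩

theorem IsOrder.conj_mem {L : Submodule O (Oct A)} (h : IsOrder L) {x : Oct A}
    (hx : x ∈ L) : conj x ∈ L := by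
  have h1 := h.mul_mem _ hx _ h.unit_mem
  have h2 : paraMul x (paraUnit A) = conj x := by
    rw [paraMul, conj_paraUnit, octMul_paraUnit]
  rwa [h2] at h1

theorem IsOrder.octMul_mem {L : Submodule O (Oct A)} (h : IsOrder L) {x y : Oct A}
    (hx : x ∈ L) (hy : y ∈ L) : octMul x y ∈ L := by
  rw [octMul_eq_paraMul]
  exact h.mul_mem _ (h.conj_mem hx) _ (h.conj_mem hy)

theorem IsOrder.cdFamily_mem {L : Submodule O (Oct A)} (h : IsOrder L) {i j l : Oct A}
    (hi : i ∈ L) (hj : j ∈ L) (hl : l ∈ L) (p : Fin 8) : cdFamily i j l p ∈ L := by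
  have hij := h.octMul_mem hi hj
  fin_cases p
  exacts [h.unit_mem, hi, hj, hij, hl, h.octMul_mem hi hl, h.octMul_mem hj hl, h.octMul_mem hij hl]

/-- A self-dual order that contains a basic triple is a translate of the standard lattice. -/
theorem translate_frameAut_standardLattice (hinj : Function.Injective (algebraMap O A)) {c : O}
    (hc : 2 * algebraMap O A c = 1) {i j l : Oct A} (h : IsBasicTriple i j l)
    {L : Submodule O (Oct A)} (hL : IsSelfDual L) (hL' : IsOrder L)
    (hi : i ∈ L) (hj : j ∈ L) (hl : l ∈ L) :
    translate (frameAut hc h) (standardLattice O A) = L := by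
  obtain ⟨s1, s2, s3⟩ := standardLattice_mem (O := O) (A := A) hinj
  obtain ⟨t1, t2, -⟩ := translate_mem (frameAut hc h) s1 s2 s3
  refine eq_of_le_of_isSelfDual t1 t2 hL ?_
  rw [translate, Submodule.map_le_iff_le_comap, standardLattice, baseChange, Submodule.span_le]
  rintro _ ⟨w, -, rfl⟩
  change toLin' (frameAut hc h).1 _ ∈ L
  rw [frameAut, toLin'_frameSL, frameMap, LinearMap.comp_apply, Fintype.linearCombination_apply]
  refine Submodule.sum_mem _ fun p _ => ?_
  have h1 : stdCoord (algebraMap O A c) (mapVec (algebraMap O A) w) p =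
      algebraMap O A (stdCoord c w p) := by
    fin_cases p <;> simp [stdCoord, mapVec, Algebra.smul_def]
  rw [h1, algebraMap_smul]
  exact L.smul_mem _ (hL'.cdFamily_mem hi hj hl p)

end Unimodular

/-! ### Vectors of invertible norm -/

section Nakayama

variable {O A : Type u} [CommRing O] [CommRing A] [Algebra O A]

/-- Let `L` be a self-dual lattice and `n` a family of pairwise orthogonal vectors of `L` of norm
`±1` (the zero vector serves as padding), of which one is zero. Then the norms of the vectors of
`L` orthogonal to `n` are not all contained in a given prime ideal. Otherwise, by Nakayama's lemma,
after inverting a single element the rank `8` module `L` would be spanned by `n`. -/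
theorem exists_normForm_notMem (hinj : Function.Injective (algebraMap O A)) {c : O}
    (hc : 2 * c = 1) {L : Submodule O (Oct A)} (h1 : IsLattice L) (h2 : IsSelfDual L)
    (n : Fin 8 → Oct A) (hn : ∀ k, n k ∈ L) (h7 : n 7 = 0)
    (horth : ∀ k m, k ≠ m → bilin (n k) (n m) = 0)
    (hnorm : ∀ k, n k = 0 ∨ normForm (n k) = 1 ∨ normForm (n k) = -1)
    (P : Ideal O) [P.IsPrime] :
    ∃ x ∈ L, (∀ k, bilin x (n k) = 0) ∧ ∃ a : O, algebraMap O A a = normForm x ∧ a ∉ P := by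
  obtain ⟨N, X, Y, hX, hY, hXY⟩ := exists_dual_basis h1 h2
  obtain ⟨ψ, hψ⟩ := h2
  have hc' : 2 * algebraMap O A c = 1 := by
    rw [← map_ofNat (algebraMap O A) 2, ← map_mul, hc, map_one]
  have hint : ∀ x ∈ L, ∃ a : O, algebraMap O A a = normForm x := fun x hx =>
    ⟨c * ψ ⟨x, hx⟩ ⟨x, hx⟩, by
      rw [map_mul, hψ, bilin_self]; linear_combination (normForm x) * hc'⟩
  by_contra! hcon
  -- The orthogonal projection onto the complement of `n`.
  let d : Fin 8 → A := fun k => algebraMap O A c * normForm (n k)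
  let π : Oct A →ₗ[A] Oct A := LinearMap.id - ∑ k, (d k • bilinₗ (n k)).smulRight (n k)
  have hπ : ∀ x, π x = x - ∑ k, (d k * bilin (n k) x) • n k := fun x => by
    simp [π, bilinₗ_apply]
  have hπ0 : ∀ x m, bilin (π x) (n m) = 0 := by
    intro x m
    rw [hπ, bilin_comm, ← bilinₗ_apply, map_sub, map_sum, Finset.sum_eq_single m]
    · rw [map_smul, bilinₗ_apply, bilinₗ_apply, bilin_self, smul_eq_mul]
      obtain h | h | h := hnorm m
      · simp [h, ← bilinₗ_apply]
      · simp only [d, h]; linear_combination (-bilin (n m) x) * hc'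
      · simp only [d, h]; linear_combination (-bilin (n m) x) * hc'
    · intro k _ hk
      rw [map_smul, bilinₗ_apply, horth _ _ hk.symm, smul_zero]
    · simp
  have hπL : ∀ x ∈ L, π x ∈ L := by
    intro x hx
    rw [hπ]
    refine L.sub_mem hx (L.sum_mem fun k _ => ?_)
    obtain ⟨a, ha⟩ := hint _ (hn k)
    have : d k * bilin (n k) x = algebraMap O A (c * a * ψ ⟨_, hn k⟩ ⟨x, hx⟩) := by
      rw [map_mul, map_mul, hψ, ha]
    rw [this, algebraMap_smul]
    exact L.smul_mem _ (hn k)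
  have hπfix : ∀ z, (∀ k, bilin z (n k) = 0) → π z = z := by
    intro z hz
    rw [hπ, Finset.sum_eq_zero, sub_zero]
    intro k _
    rw [bilin_comm, hz, mul_zero, zero_smul]
  let L' : Submodule O (Oct A) := Submodule.span O (Set.range fun i => π (X i))
  have hL' : ∀ z ∈ L, (∀ k, bilin z (n k) = 0) → z ∈ P • L' := by
    intro z hz hzn
    have h3 : z = ∑ i, bilin (π (Y i)) z • π (X i) := by
      have h4 : ∀ i, bilin (π (Y i)) z = bilin (Y i) z := by
        intro i
        rw [hπ, ← bilinₗ_apply, map_sub, LinearMap.sub_apply, map_sum, LinearMap.sum_apply,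
          Finset.sum_eq_zero, sub_zero, bilinₗ_apply]
        intro k _
        rw [map_smul, LinearMap.smul_apply, bilinₗ_apply, bilin_comm (n k) z, hzn, smul_zero]
      conv_lhs => rw [← hπfix z hzn, hXY z hz, map_sum]
      simp only [h4, map_smul]
    rw [h3]
    refine Submodule.sum_mem _ fun i _ => ?_
    obtain ⟨a, ha, ha'⟩ : ∃ a ∈ P, algebraMap O A a = bilin (π (Y i)) z := by
      have hy := hπL _ (hY i)
      obtain ⟨a, ha⟩ := hint _ (L.add_mem hy hz)
      obtain ⟨a1, ha1⟩ := hint _ hy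
      obtain ⟨a2, ha2⟩ := hint _ hz
      refine ⟨a - a1 - a2, P.sub_mem (P.sub_mem (hcon _ (L.add_mem hy hz) (fun k => ?_) _ ha)
        (hcon _ hy (hπ0 _) _ ha1)) (hcon _ hz hzn _ ha2), ?_⟩
      · rw [← bilinₗ_apply, map_add, LinearMap.add_apply, bilinₗ_apply, bilinₗ_apply, hπ0, hzn,
          add_zero]
      · rw [map_sub, map_sub, ha, ha1, ha2, bilin]
    rw [← ha', algebraMap_smul]
    exact Submodule.smul_mem_smul ha (Submodule.subset_span ⟨i, rfl⟩)
  -- The complement of `n` in `L` equals its multiple by `P`, so that some `r ∈ 1 + P` kills it.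
  obtain ⟨r, hr, hr'⟩ := Submodule.exists_sub_one_mem_and_smul_eq_zero_of_fg_of_le_smul P L'
    (Submodule.fg_span (Set.finite_range _))
    (Submodule.span_le.2 (by rintro _ ⟨i, rfl⟩; exact hL' _ (hπL _ (hX i)) (hπ0 _)))
  have hker : ∀ x, algebraMap O A r • π x = 0 := by
    intro x
    have hx : x ∈ Submodule.span A (L : Set (Oct A)) := h1.span_eq_top ▸ Submodule.mem_top
    have hle : Submodule.span A (L : Set (Oct A)) ≤
        LinearMap.ker (algebraMap O A r • π) := by
      refine Submodule.span_le.2 fun x hx => ?_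
      rw [SetLike.mem_coe, LinearMap.mem_ker, LinearMap.smul_apply, algebraMap_smul]
      exact hr' _ (Submodule.smul_le_right (hL' _ (hπL _ hx) (hπ0 _)))
    have := hle hx
    rwa [LinearMap.mem_ker, LinearMap.smul_apply] at this
  -- Multiplication by `r` factors through the span of `n`, so that its determinant vanishes.
  have hmat : algebraMap O A r • (1 : Matrix (Fin 8) (Fin 8) A) =
      Matrix.of (fun p k => n k p) *
        Matrix.of (fun k q => algebraMap O A r * (d k * bilin (n k) (Pi.single q 1))) := by
    ext p q
    have h := hker (Pi.single q 1)
    rw [hπ, smul_sub, sub_eq_zero] at h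
    have := congrFun h p
    simp only [Pi.smul_apply, Finset.sum_apply, smul_eq_mul, Finset.mul_sum] at this
    rw [Matrix.smul_apply, Matrix.one_apply, Matrix.mul_apply, smul_eq_mul, ← Pi.single_apply, this]
    refine Finset.sum_congr rfl fun k _ => ?_
    simp only [Matrix.of_apply]
    ring
  have hdet := congrArg Matrix.det hmat
  rw [Matrix.det_smul, Matrix.det_one, mul_one, Matrix.det_mul,
    Matrix.det_eq_zero_of_column_eq_zero 7 (fun p => by simp [h7]), zero_mul, ← map_pow,
    map_eq_zero_iff _ hinj] at hdet
  have hrP : r ∈ P := ‹P.IsPrime›.mem_of_pow_mem _ (hdet ▸ P.zero_mem)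
  refine ‹P.IsPrime›.ne_top ((Ideal.eq_top_iff_one P).2 ?_)
  have := P.sub_mem hrP hr
  rwa [sub_sub_cancel] at this

end Nakayama

/-! ### Local triviality -/

section Sqrt

open scoped PowerSeries

/-- A power series whose constant coefficient is the square of a unit is a square, if `2` is
invertible. -/
theorem exists_powerSeries_sq {S : Type*} [CommRing S] (h2 : IsUnit (2 : S)) (h : S⟦X⟧) {s : S}
    (hs : IsUnit s) (hh : PowerSeries.constantCoeff h = s ^ 2) :
    ∃ r : S⟦X⟧, IsUnit r ∧ r ^ 2 = h := by
  have hens : HenselianRing S⟦X⟧ (Ideal.span {PowerSeries.X}) := inferInstance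
  have hmon : (Polynomial.X ^ 2 - Polynomial.C h : Polynomial S⟦X⟧).Monic :=
    Polynomial.monic_X_pow_sub_C h two_ne_zero
  obtain ⟨r, hr, hr'⟩ := hens.is_henselian _ hmon (PowerSeries.C s) (by
      rw [Ideal.mem_span_singleton, PowerSeries.X_dvd_iff]
      simp [hh]) (by
      refine IsUnit.map _ ?_
      have : (Polynomial.X ^ 2 - Polynomial.C h : Polynomial S⟦X⟧).derivative.eval
          (PowerSeries.C s) = PowerSeries.C (2 * s) := by
        simp [one_add_one_eq_two, map_ofNat PowerSeries.C 2]
      rw [this]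
      exact (h2.mul hs).map PowerSeries.C)
  refine ⟨r, ?_, ?_⟩
  · rw [PowerSeries.isUnit_iff_constantCoeff]
    rw [Ideal.mem_span_singleton, PowerSeries.X_dvd_iff, map_sub, sub_eq_zero] at hr'
    simpa [hr'] using hs
  · simpa [Polynomial.IsRoot, sub_eq_zero] using hr

end Sqrt

section LocalTriviality

open scoped PowerSeries LaurentSeries

/-- A square root of `-f` exists, and is a unit, over a flat extension of `R` whose spectrum maps
onto the locus where `f` is invertible. -/
theorem exists_flat_sqrt {R : Type u} [CommRing R] (f : R) :
    ∃ (S : Type u) (_ : CommRing S) (φ : R →+* S) (y : S), φ.Flat ∧ IsUnit y ∧ y ^ 2 = -φ f ∧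
      ∀ p : PrimeSpectrum R, f ∉ p.asIdeal → ∃ q, PrimeSpectrum.comap φ q = p := by
  let R' := Localization.Away f
  let g : Polynomial R' := Polynomial.X ^ 2 + Polynomial.C (algebraMap R R' f)
  have hg : g.Monic := Polynomial.monic_X_pow_add_C _ two_ne_zero
  have hfree : Module.Free R' (AdjoinRoot g) := hg.free_adjoinRoot
  have hy : AdjoinRoot.root g ^ 2 = -algebraMap R' (AdjoinRoot g) (algebraMap R R' f) := by
    have h := AdjoinRoot.eval₂_root g
    simp only [g, Polynomial.eval₂_add, Polynomial.eval₂_pow, Polynomial.eval₂_X,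
      Polynomial.eval₂_C] at h
    exact eq_neg_of_add_eq_zero_left h
  have hu : IsUnit (algebraMap R R' f) := IsLocalization.Away.algebraMap_isUnit f
  refine ⟨AdjoinRoot g, inferInstance, (algebraMap R' (AdjoinRoot g)).comp (algebraMap R R'),
    AdjoinRoot.root g, RingHom.Flat.comp ?_ ?_, ?_, hy, fun p hp => ?_⟩
  · exact RingHom.flat_algebraMap_iff.2 (IsLocalization.flat R' (Submonoid.powers f))
  · exact RingHom.flat_algebraMap_iff.2 inferInstance
  · refine (isUnit_pow_iff two_ne_zero).1 ?_
    rw [hy]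
    exact (hu.map _).neg
  · have hp' : p ∈ Set.range (PrimeSpectrum.comap (algebraMap R R')) := by
      rw [PrimeSpectrum.localization_away_comap_range R' f]
      exact hp
    obtain ⟨q, rfl⟩ := hp'
    have hnt : Nontrivial R' := q.nontrivial
    have : Nontrivial (AdjoinRoot g) := by
      refine ⟨⟨AdjoinRoot.mk g 1, 0, AdjoinRoot.mk_ne_zero_of_natDegree_lt hg one_ne_zero ?_⟩⟩
      simp only [g, Polynomial.natDegree_one, Polynomial.natDegree_X_pow_add_C, zero_lt_two]
    obtain ⟨r, rfl⟩ := PrimeSpectrum.comap_surjective_of_faithfullyFlat (A := R')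
      (B := AdjoinRoot g) q
    exact ⟨r, rfl⟩

theorem SelfDualOrder.mapVec_mem {R S : Type u} [CommRing R] [CommRing S] (f : R →+* S)
    (L : SelfDualOrder R) {x : Oct R⸨X⸩} (hx : x ∈ L.1) :
    mapVec (laurentMap f) x ∈ (L.map f).1 :=
  Submodule.subset_span ⟨x, hx, rfl⟩

theorem mapVec_normForm {A B : Type u} [CommRing A] [CommRing B] (f : A →+* B) (x : Oct A) :
    normForm (mapVec f x) = f (normForm x) := by
  simp [normForm, mapVec, wPart, vPart]

theorem mapVec_octMul {A B : Type u} [CommRing A] [CommRing B] (f : A →+* B) (x y : Oct A) :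
    octMul (mapVec f x) (mapVec f y) = mapVec f (octMul x y) := by
  ext i
  fin_cases i <;> simp [octMul_eq, mapVec]

/-- Locally for the fpqc topology, fewer than eight orthogonal vectors of norm `±1` in a self-dual
order can be supplemented by a vector of norm `-1`. -/
theorem SelfDualOrder.exists_orthogonal {R : Type u} [CommRing R] (h2 : IsUnit (2 : R))
    (L : SelfDualOrder R) (n : Fin 8 → Oct R⸨X⸩) (hn : ∀ k, n k ∈ L.1) (h7 : n 7 = 0)
    (horth : ∀ k m, k ≠ m → bilin (n k) (n m) = 0)
    (hnorm : ∀ k, n k = 0 ∨ normForm (n k) = 1 ∨ normForm (n k) = -1) :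
    ∃ (N : ℕ) (S : Fin N → Type u) (_ : ∀ a, CommRing (S a)) (f : ∀ a, R →+* S a),
      IsFpqcFamily S f ∧ ∀ a, ∃ x ∈ (L.map (f a)).1,
        (∀ k, bilin x (mapVec (laurentMap (f a)) (n k)) = 0) ∧ normForm x = -1 := by
  obtain ⟨c, hc⟩ := h2.exists_right_inv
  let s : Set R := {f | ∃ x ∈ L.1, (∀ k, bilin x (n k) = 0) ∧
    ∃ a : R⟦X⟧, algebraMap R⟦X⟧ R⸨X⸩ a = normForm x ∧ PowerSeries.constantCoeff a = f}
  have hs : Ideal.span s = ⊤ := by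
    by_contra hne
    obtain ⟨m, hm, hle⟩ := Ideal.exists_le_maximal _ hne
    have hmp : m.IsPrime := hm.isPrime
    have : (m.comap (PowerSeries.constantCoeff (R := R))).IsPrime := inferInstance
    obtain ⟨x, hx, hxn, a, ha, ham⟩ := exists_normForm_notMem algebraMap_laurent_injective
      (c := PowerSeries.C c) (by rw [← map_ofNat PowerSeries.C 2, ← map_mul, hc, map_one])
      L.2.1 L.2.2.1 n hn h7 horth hnorm (m.comap (PowerSeries.constantCoeff (R := R)))
    exact ham (hle (Ideal.subset_span ⟨x, hx, hxn, a, ha, rfl⟩))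
  obtain ⟨s', hs', hspan⟩ := (Ideal.span_eq_top_iff_finite _).1 hs
  choose S hS φ y hflat hyu hy hspec using fun f : R => exists_flat_sqrt f
  refine ⟨s'.card, fun a => S (s'.equivFin.symm a).1, fun a => hS _, fun a => φ _,
    ⟨fun a => hflat _, fun p => ?_⟩, fun a => ?_⟩
  · have : ∃ f ∈ s', f ∉ p.asIdeal := by
      by_contra! hcon
      refine p.2.ne_top (top_le_iff.1 (hspan ▸ Ideal.span_le.2 hcon))
    obtain ⟨f, hf, hfp⟩ := this
    refine ⟨s'.equivFin ⟨f, hf⟩, ?_⟩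
    have h := hspec ((s'.equivFin.symm (s'.equivFin ⟨f, hf⟩)).1) p
      (by rwa [Equiv.symm_apply_apply])
    exact h
  · change ∃ x ∈ (L.map (φ (s'.equivFin.symm a).1)).1,
      (∀ k, bilin x (mapVec (laurentMap (φ (s'.equivFin.symm a).1)) (n k)) = 0) ∧ normForm x = -1
    obtain ⟨f, hf⟩ := s'.equivFin.symm a
    change ∃ x ∈ (L.map (φ f)).1,
      (∀ k, bilin x (mapVec (laurentMap (φ f)) (n k)) = 0) ∧ normForm x = -1
    obtain ⟨x, hx, hxn, b, hb, hbf⟩ := hs' hf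
    have h2' : IsUnit (2 : S f) := by
      rw [← map_ofNat (φ f) 2]
      exact h2.map (φ f)
    obtain ⟨r, hr, hr2⟩ := exists_powerSeries_sq h2' (-(PowerSeries.map (φ f) b)) (hyu f) (by
      rw [hy, map_neg, ← PowerSeries.coeff_zero_eq_constantCoeff_apply, PowerSeries.coeff_map,
        PowerSeries.coeff_zero_eq_constantCoeff_apply, hbf])
    obtain ⟨t, ht⟩ := hr.exists_right_inv
    refine ⟨t • mapVec (laurentMap (φ f)) x, Submodule.smul_mem _ _ (L.mapVec_mem (φ f) hx),
      fun k => ?_, ?_⟩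
    · rw [← algebraMap_smul (S f)⸨X⸩, ← bilinₗ_apply, _root_.map_smul, LinearMap.smul_apply,
        bilinₗ_apply, mapVec_bilin, hxn, map_zero, smul_zero]
    · rw [← algebraMap_smul (S f)⸨X⸩, normForm_smul, mapVec_normForm, ← hb, laurentMap_algebraMap,
        ← map_pow, ← map_mul, ← neg_neg (PowerSeries.map (φ f) b), ← hr2, mul_neg, ← mul_pow,
        mul_comm t, ht, one_pow, map_neg, map_one]

theorem SelfDualOrder.map_map {R S T : Type u} [CommRing R] [CommRing S] [CommRing T]
    (f : R →+* S) (g : S →+* T) (L : SelfDualOrder R) : L.map (g.comp f) = (L.map f).map g :=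
  Subtype.ext <| by
    change baseChange _ (laurentMap (g.comp f)) _ = _
    rw [laurentMap_comp]
    exact baseChange_comp _ _ _ (laurentMap_algebraMap _) _

variable {k : Type u} [Field k]

/-- A sieve is covering if its pullbacks to the members of an fpqc family are covering. The property
`Q` of ring maps serves to forget the `k`-algebra structures on the members of the family. -/
theorem mem_fpqcTopology_of_isFpqcFamily {X : AffineSchemes k} (T : Sieve X) {N : ℕ}
    (S : Fin N → Type u) [∀ a, CommRing (S a)] (f : ∀ a, X.unop →+* S a)
    (hf : IsFpqcFamily S f) (Q : ∀ (S : Type u) [CommRing S], (X.unop →+* S) → Prop)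
    (hQ : ∀ a, Q (S a) (f a))
    (hT : ∀ (Y : AffineSchemes k) (g : Y ⟶ X), Q Y.unop g.unop.hom.toRingHom →
      T.pullback g ∈ fpqcTopology k Y) :
    T ∈ fpqcTopology k X := by
  let T' : Sieve X :=
    { arrows := fun Y g => T.pullback g ∈ fpqcTopology k Y
      downward_closed := fun {Y Z g} hg h => by
        rw [Sieve.pullback_comp]
        exact (fpqcTopology k).pullback_stable h hg }
  have hT' : T' ∈ fpqcTopology k X := by
    let _ (a : Fin N) : Algebra k (S a) := ((f a).comp (algebraMap k X.unop)).toAlgebra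
    let g (a : Fin N) : X.unop ⟶ CommAlgCat.of k (S a) :=
      CommAlgCat.ofHom { f a with commutes' := fun _ => rfl }
    exact ⟨Fin N, inferInstance, fun a => CommAlgCat.of k (S a), g,
      fun a => hT _ (g a).op (hQ a), hf⟩
  exact (fpqcTopology k).transitive hT' T fun Y g hg => hg

/-- The sieve of those maps along which a self-dual order becomes a translate of the standard
lattice. -/
def trivialSieve {X : AffineSchemes k} (L : SelfDualOrder X.unop) : Sieve X where
  arrows Y f := ∃ g : LoopGroup Y.unop,
    g • SelfDualOrder.standard Y.unop = L.map f.unop.hom.toRingHom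
  downward_closed := by
    rintro Y Z f ⟨g, hg⟩ h
    refine ⟨loopMap h.unop.hom.toRingHom g, ?_⟩
    refine Eq.trans ?_ (SelfDualOrder.map_map f.unop.hom.toRingHom h.unop.hom.toRingHom L).symm
    rw [← hg, SelfDualOrder.map_smul, SelfDualOrder.map_standard]

theorem trivialSieve_pullback {X Y : AffineSchemes k} (L : SelfDualOrder X.unop) (f : Y ⟶ X) :
    (trivialSieve L).pullback f = trivialSieve (L.map f.unop.hom.toRingHom) := by
  ext Z h
  exact exists_congr fun g => Eq.congr_right
    (SelfDualOrder.map_map f.unop.hom.toRingHom h.unop.hom.toRingHom L)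

theorem isUnit_two (hk : (2 : k) ≠ 0) (R : Type u) [CommRing R] [Algebra k R] :
    IsUnit (2 : R) := by
  rw [← map_ofNat (algebraMap k R) 2]
  exact (isUnit_iff_ne_zero.2 hk).map _

theorem IsImaginary.mapVec {A B : Type u} [CommRing A] [CommRing B] {f : A →+* B} {x : Oct A}
    (h : IsImaginary x) : IsImaginary (mapVec f x) := by
  rw [IsImaginary, ← mapVec_paraUnit f, mapVec_bilin, h, map_zero]

theorem SelfDualOrder.exists_smul_standard {R : Type u} [CommRing R] (h2 : IsUnit (2 : R))
    (L : SelfDualOrder R) {i j l : Oct R⸨X⸩} (h : IsBasicTriple i j l) (hi : i ∈ L.1)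
    (hj : j ∈ L.1) (hl : l ∈ L.1) : ∃ g : LoopGroup R, g • SelfDualOrder.standard R = L := by
  obtain ⟨c, hc⟩ := h2.exists_right_inv
  have hc' : 2 * algebraMap R⟦X⟧ R⸨X⸩ (PowerSeries.C c) = 1 := by
    rw [← map_ofNat (algebraMap R⟦X⟧ R⸨X⸩) 2, ← map_ofNat PowerSeries.C 2, ← map_mul, ← map_mul,
      hc, map_one, map_one]
  exact ⟨frameAut hc' h, Subtype.ext (translate_frameAut_standardLattice
    algebraMap_laurent_injective hc' h L.2.2.1 L.2.2.2 hi hj hl)⟩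

theorem bilin_zero {A : Type u} [CommRing A] (x : Oct A) : bilin x 0 = 0 := by
  rw [← bilinₗ_apply, map_zero]

theorem bilin_octMul_self_left {A : Type u} [CommRing A] (x y : Oct A) :
    bilin (octMul x y) x = normForm x * bilin y (paraUnit A) := by
  simp [octMul_eq, bilin_eq, normForm, paraUnit, zorn, wPart, vPart]; ring

theorem bilin_octMul_self_right {A : Type u} [CommRing A] (x y : Oct A) :
    bilin (octMul x y) y = normForm y * bilin x (paraUnit A) := by
  simp [octMul_eq, bilin_eq, normForm, paraUnit, zorn, wPart, vPart]; ring

/-- Pairwise orthogonality of four vectors padded by zeros to a family of eight. -/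
theorem bilin_padded_eq_zero {A : Type u} [CommRing A] {x y z w : Oct A} (hxy : bilin x y = 0)
    (hxz : bilin x z = 0) (hxw : bilin x w = 0) (hyz : bilin y z = 0) (hyw : bilin y w = 0)
    (hzw : bilin z w = 0) (p q : Fin 8) (hpq : p ≠ q) :
    bilin (![x, y, z, w, 0, 0, 0, 0] p) (![x, y, z, w, 0, 0, 0, 0] q) = 0 := by
  wlog h : p < q generalizing p q
  · rw [bilin_comm]
    exact this q p hpq.symm (lt_of_le_of_ne (not_lt.1 h) hpq.symm)
  fin_cases p <;> fin_cases q <;> first | simp at h; done | assumption | exact bilin_zero _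

/-- If `i` and `j` are already found in `L`, a third vector orthogonal to `e`, `i`, `j` and `i · j`
completes them locally to a basic triple. -/
theorem trivialSieve_mem_of_pair (hk : (2 : k) ≠ 0) {X : AffineSchemes k}
    (L : SelfDualOrder X.unop) {i j : Oct (X.unop : Type u)⸨X⸩} (hi : i ∈ L.1) (hj : j ∈ L.1)
    (imi : IsImaginary i) (imj : IsImaginary j) (ni : normForm i = -1) (nj : normForm j = -1)
    (hij : bilin i j = 0) : trivialSieve L ∈ fpqcTopology k X := by
  have hu := L.2.2.2.unit_mem
  obtain ⟨N, S, _, f, hf, hx⟩ := L.exists_orthogonal (isUnit_two hk X.unop)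
    ![paraUnit _, i, j, octMul i j, 0, 0, 0, 0] (fun p => by
      have := L.2.2.2.octMul_mem hi hj
      fin_cases p <;> first | assumption | exact L.1.zero_mem) rfl (by
      rw [IsImaginary, bilin_comm] at imi imj
      refine bilin_padded_eq_zero imi imj ?_ hij ?_ ?_
      · rw [bilin_comm]
        exact IsImaginary.octMul (by rwa [IsImaginary, bilin_comm]) hij
      · rw [bilin_comm, bilin_octMul_self_left, bilin_comm, imj, mul_zero]
      · rw [bilin_comm, bilin_octMul_self_right, bilin_comm, imi, mul_zero]) (by
      have : normForm (octMul i j) = 1 := by rw [normForm_octMul, ni, nj]; norm_num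
      have he : normForm (paraUnit (X.unop : Type u)⸨X⸩) = 1 := by
        simp [normForm, paraUnit, zorn, wPart, vPart]
      intro p
      fin_cases p <;> simp [*])
  refine mem_fpqcTopology_of_isFpqcFamily _ S f hf (fun S _ f => ∃ x ∈ (L.map f).1,
    (∀ p, bilin x (mapVec (laurentMap f) (![paraUnit _, i, j, octMul i j, 0, 0, 0, 0] p)) = 0) ∧
      normForm x = -1) hx ?_
  rintro Y g ⟨l, hl, hl', nl⟩
  set φ := g.unop.hom.toRingHom
  rw [trivialSieve_pullback]
  have ht : IsBasicTriple (mapVec (laurentMap φ) i) (mapVec (laurentMap φ) j) l :=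
    { imag_i := imi.mapVec
      imag_j := imj.mapVec
      imag_l := by
        have := hl' 0
        rw [IsImaginary]
        simpa [mapVec_paraUnit] using this
      norm_i := by rw [mapVec_normForm, ni, map_neg, map_one]
      norm_j := by rw [mapVec_normForm, nj, map_neg, map_one]
      norm_l := nl
      orth_ij := by rw [mapVec_bilin, hij, map_zero]
      orth_il := by rw [bilin_comm]; exact hl' 1
      orth_jl := by rw [bilin_comm]; exact hl' 2
      orth_ijl := by rw [bilin_comm, mapVec_octMul]; exact hl' 3 }
  convert (fpqcTopology k).top_mem Y
  rw [← Sieve.id_mem_iff_eq_top]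
  obtain ⟨a, ha⟩ := (L.map φ).exists_smul_standard (isUnit_two hk Y.unop) ht
    (L.mapVec_mem φ hi) (L.mapVec_mem φ hj) hl
  refine ⟨a, ha.trans ?_⟩
  exact (ConcreteCategory.congr_hom ((latticeFunctor k).map_id (Opposite.op Y)) (L.map φ)).symm

theorem trivialSieve_mem_of_single (hk : (2 : k) ≠ 0) {X : AffineSchemes k}
    (L : SelfDualOrder X.unop) {i : Oct (X.unop : Type u)⸨X⸩} (hi : i ∈ L.1)
    (imi : IsImaginary i) (ni : normForm i = -1) : trivialSieve L ∈ fpqcTopology k X := by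
  have hu := L.2.2.2.unit_mem
  obtain ⟨N, S, _, f, hf, hx⟩ := L.exists_orthogonal (isUnit_two hk X.unop)
    ![paraUnit _, i, 0, 0, 0, 0, 0, 0] (fun p => by
      fin_cases p <;> first | assumption | exact L.1.zero_mem) rfl
    (bilin_padded_eq_zero (by rw [bilin_comm, imi]) (bilin_zero _) (bilin_zero _) (bilin_zero _)
      (bilin_zero _) (bilin_zero _)) (by
      have he : normForm (paraUnit (X.unop : Type u)⸨X⸩) = 1 := by
        simp [normForm, paraUnit, zorn, wPart, vPart]
      intro p
      fin_cases p <;> simp [*])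
  refine mem_fpqcTopology_of_isFpqcFamily _ S f hf (fun S _ f => ∃ x ∈ (L.map f).1,
    (∀ p, bilin x (mapVec (laurentMap f) (![paraUnit _, i, 0, 0, 0, 0, 0, 0] p)) = 0) ∧
      normForm x = -1) hx ?_
  rintro Y g ⟨j, hj, hj', nj⟩
  rw [trivialSieve_pullback]
  refine trivialSieve_mem_of_pair hk _ (L.mapVec_mem _ hi) hj imi.mapVec ?_ ?_ nj ?_
  · rw [IsImaginary]; simpa [mapVec_paraUnit] using hj' 0
  · rw [mapVec_normForm, ni, map_neg, map_one]
  · rw [bilin_comm]; exact hj' 1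

/-- Every self-dual order is fpqc-locally a translate of the standard lattice. -/
theorem trivialSieve_mem (hk : (2 : k) ≠ 0) {X : AffineSchemes k} (L : SelfDualOrder X.unop) :
    trivialSieve L ∈ fpqcTopology k X := by
  have hu := L.2.2.2.unit_mem
  obtain ⟨N, S, _, f, hf, hx⟩ := L.exists_orthogonal (isUnit_two hk X.unop)
    ![paraUnit _, 0, 0, 0, 0, 0, 0, 0] (fun p => by
      fin_cases p <;> first | assumption | exact L.1.zero_mem) rfl
    (bilin_padded_eq_zero (bilin_zero _) (bilin_zero _) (bilin_zero _) (bilin_zero _)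
      (bilin_zero _) (bilin_zero _)) (by
      have he : normForm (paraUnit (X.unop : Type u)⸨X⸩) = 1 := by
        simp [normForm, paraUnit, zorn, wPart, vPart]
      intro p
      fin_cases p <;> simp [*])
  refine mem_fpqcTopology_of_isFpqcFamily _ S f hf (fun S _ f => ∃ x ∈ (L.map f).1,
    (∀ p, bilin x (mapVec (laurentMap f) (![paraUnit _, 0, 0, 0, 0, 0, 0, 0] p)) = 0) ∧
      normForm x = -1) hx ?_
  rintro Y g ⟨i, hi, hi', ni⟩
  rw [trivialSieve_pullback]
  refine trivialSieve_mem_of_single hk _ hi ?_ ni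
  rw [IsImaginary]
  simpa [mapVec_paraUnit] using hi' 0

end LocalTriviality

/-! ### Flat descent in free modules -/

section FlatDescent

open TensorProduct

variable {R : Type u} [CommRing R] {κ : Type*} [Fintype κ]

/-- If the extension of `W` to a flat algebra contains `v`, then the ideal of all `r` with
`r • v ∈ W` generates the unit ideal of that algebra. -/
theorem map_colon_eq_top_of_flat {S : Type u} [CommRing S] [Algebra R S] [Module.Flat R S]
    (W : Submodule R (κ → R)) (v : κ → R)
    (hv : (fun k => algebraMap R S (v k)) ∈
      Submodule.span S ((fun w k => algebraMap R S (w k)) '' (W : Set (κ → R)))) :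
    Ideal.map (algebraMap R S) (LinearMap.ker (LinearMap.toSpanSingleton R _ (W.mkQ v))) = ⊤ := by
  classical
  let θ : (κ → S) →ₗ[S] S ⊗[R] ((κ → R) ⧸ W) :=
    ∑ k, (LinearMap.toSpanSingleton S _ ((1 : S) ⊗ₜ[R] W.mkQ (Pi.single k 1))) ∘ₗ LinearMap.proj k
  have hθ : ∀ w : κ → R, θ (fun k => algebraMap R S (w k)) = 1 ⊗ₜ W.mkQ w := by
    intro w
    conv_rhs => rw [pi_eq_sum_univ' w, map_sum, TensorProduct.tmul_sum]
    simp only [θ, LinearMap.sum_apply, LinearMap.comp_apply, LinearMap.proj_apply,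
      LinearMap.toSpanSingleton_apply, algebraMap_smul, map_smul, TensorProduct.tmul_smul]
  have h1 : (1 : S) ⊗ₜ[R] W.mkQ v = 0 := by
    rw [← hθ]
    have hle : Submodule.span S ((fun w k => algebraMap R S (w k)) '' (W : Set (κ → R))) ≤
        LinearMap.ker θ := by
      refine Submodule.span_le.2 ?_
      rintro _ ⟨w, hw, rfl⟩
      change θ _ = 0
      rw [hθ, Submodule.mkQ_apply, (Submodule.Quotient.mk_eq_zero W).2 hw, TensorProduct.tmul_zero]
    exact hle hv
  set g := LinearMap.toSpanSingleton R _ (W.mkQ v) with hg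
  have h2 : (1 : S) ⊗ₜ[R] (1 : R) ∈ LinearMap.ker (LinearMap.lTensor S g) := by
    rw [LinearMap.mem_ker, LinearMap.lTensor_tmul, hg, LinearMap.toSpanSingleton_apply, one_smul, h1]
  have h3 := (Module.Flat.lTensor_exact S (LinearMap.exact_subtype_ker_map g)) _ |>.1 h2
  obtain ⟨y, hy⟩ := h3
  have h4 : ∀ y, TensorProduct.rid R S (LinearMap.lTensor S (LinearMap.ker g).subtype y) ∈
      Ideal.map (algebraMap R S) (LinearMap.ker g) := by
    intro y
    induction y with
    | zero => simp
    | add y z hy hz => rw [map_add, map_add]; exact Ideal.add_mem _ hy hz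
    | tmul s r =>
      rw [LinearMap.lTensor_tmul, TensorProduct.rid_tmul, Algebra.smul_def]
      exact Ideal.mul_mem_right _ _ (Ideal.mem_map_of_mem _ r.2)
  have h5 := h4 y
  rw [hy, TensorProduct.rid_tmul, one_smul] at h5
  exact (Ideal.eq_top_iff_one _).2 h5

variable {ι : Type} (S : ι → Type u) [∀ i, CommRing (S i)] [∀ i, Algebra R (S i)]

/-- Membership in a submodule of a free module can be tested on an fpqc family. -/
theorem mem_of_forall_mem_span (hS : IsFpqcFamily S fun i => algebraMap R (S i))
    (W : Submodule R (κ → R)) (v : κ → R)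
    (hv : ∀ i, (fun k => algebraMap R (S i) (v k)) ∈
      Submodule.span (S i) ((fun w k => algebraMap R (S i) (w k)) '' (W : Set (κ → R)))) :
    v ∈ W := by
  let I : Ideal R := LinearMap.ker (LinearMap.toSpanSingleton R _ (W.mkQ v))
  have hI : I = ⊤ := by
    by_contra hne
    obtain ⟨m, hm, hle⟩ := Ideal.exists_le_maximal _ hne
    obtain ⟨i, q, hq⟩ := hS.2 ⟨m, hm.isPrime⟩
    have hfl : Module.Flat R (S i) := RingHom.flat_algebraMap_iff.1 (hS.1 i)
    have h := map_colon_eq_top_of_flat W v (hv i)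
    refine q.2.ne_top (top_le_iff.1 (h ▸ Ideal.map_le_iff_le_comap.2 (hle.trans ?_)))
    exact (congrArg PrimeSpectrum.asIdeal hq).ge
  have h1 : (1 : R) ∈ I := hI ▸ Submodule.mem_top
  rw [LinearMap.mem_ker, LinearMap.toSpanSingleton_apply, one_smul] at h1
  exact (Submodule.Quotient.mk_eq_zero W).1 h1

/-- Descent of submodules of a free module along a finite family of flat algebras: a compatible
family of submodules is generated by the vectors over the base that are contained in all of
them. -/
theorem mem_span_of_compatible [Finite ι] [∀ i, Module.Flat R (S i)]
    (W : ∀ i, Submodule (S i) (κ → S i))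
    (hW : ∀ i j, ∀ x ∈ W j, (fun k => x k ⊗ₜ[R] (1 : S i)) ∈
      Submodule.span (S j ⊗[R] S i) ((fun w k => (1 : S j) ⊗ₜ[R] w k) '' (W i : Set (κ → S i))))
    (j : ι) (x : κ → S j) (hx : x ∈ W j) :
    x ∈ Submodule.span (S j)
      ((fun w k => algebraMap R (S j) (w k)) ''
        {w : κ → R | ∀ i, (fun k => algebraMap R (S i) (w k)) ∈ W i}) := by
  classical
  have := Fintype.ofFinite ι
  let α (i : ι) : (κ → R) →ₗ[R] (κ → S i) := LinearMap.pi fun k =>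
    (Algebra.linearMap R (S i)) ∘ₗ LinearMap.proj k
  let φ (i : ι) : (κ → R) →ₗ[R] (κ → S i) ⧸ W i := ((W i).mkQ.restrictScalars R) ∘ₗ α i
  let Φ : (κ → R) →ₗ[R] ∀ i, (κ → S i) ⧸ W i := LinearMap.pi φ
  have hφ : ∀ i w, φ i w = 0 ↔ (fun k => algebraMap R (S i) (w k)) ∈ W i := fun i w =>
    Submodule.Quotient.mk_eq_zero (W i)
  -- The vectors of `κ → R` lying in every `W i` form the kernel of `Φ`. Flatness of `S j` identifies
  -- the extension of this kernel with the kernel of the extension of `Φ`; it contains `x`, viewed as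
  -- the element `ξ` of `S j ⊗ (κ → R)`.
  let ξ : S j ⊗[R] (κ → R) := ∑ k, x k ⊗ₜ Pi.single k 1
  have hξ : ∀ i, LinearMap.lTensor (S j) (φ i) ξ = 0 := by
    intro i
    let ψ (k : κ) : S i →ₗ[R] (κ → S i) ⧸ W i :=
      ((W i).mkQ.restrictScalars R) ∘ₗ (LinearMap.single R (fun _ => S i) k)
    let Ψ (y : κ → S j ⊗[R] S i) : S j ⊗[R] ((κ → S i) ⧸ W i) :=
      ∑ k, LinearMap.lTensor (S j) (ψ k) (y k)
    have h0 : ∀ y ∈ Submodule.span (S j ⊗[R] S i)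
        ((fun w k => (1 : S j) ⊗ₜ[R] w k) '' (W i : Set (κ → S i))), Ψ y = 0 := by
      intro y hy
      induction hy using Submodule.closure_induction with
      | zero => simp [Ψ]
      | add y z _ _ hy hz =>
        have : Ψ (y + z) = Ψ y + Ψ z := by simp [Ψ, Finset.sum_add_distrib]
        rw [this, hy, hz, add_zero]
      | smul_mem t y hy =>
        obtain ⟨w, hw, rfl⟩ := hy
        induction t with
        | zero => simp [Ψ]
        | add s t hs ht =>
          have : ∀ y, Ψ ((s + t) • y) = Ψ (s • y) + Ψ (t • y) := by
            intro y
            simp [Ψ, Finset.sum_add_distrib, add_mul]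
          rw [this, hs, ht, add_zero]
        | tmul s t =>
          have h1 : Ψ ((s ⊗ₜ[R] t) • fun k => (1 : S j) ⊗ₜ[R] w k) = s ⊗ₜ[R] (W i).mkQ (t • w) := by
            conv_rhs => rw [← Finset.univ_sum_single (t • w), map_sum, TensorProduct.tmul_sum]
            simp [Ψ, ψ]
          rw [h1, Submodule.mkQ_apply, (Submodule.Quotient.mk_eq_zero _).2 ((W i).smul_mem t hw),
            TensorProduct.tmul_zero]
    refine Eq.trans ?_ (h0 _ (hW i j x hx))
    rw [map_sum]
    refine Finset.sum_congr rfl fun k _ => ?_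
    rw [LinearMap.lTensor_tmul, LinearMap.lTensor_tmul]
    have h2 : α i (Pi.single k 1) = (Pi.single k 1 : κ → S i) := by
      funext k'
      by_cases h : k' = k
      · subst h; simp [α]
      · simp [α, h]
    exact congrArg (fun z => x k ⊗ₜ[R] (W i).mkQ z) h2
  have hξ' : LinearMap.lTensor (S j) Φ ξ = 0 := by
    refine (TensorProduct.piRight R R (S j) fun i => (κ → S i) ⧸ W i).injective ?_
    rw [map_zero]
    funext i
    rw [Pi.zero_apply, ← hξ i]
    simp only [ξ, map_sum, LinearMap.lTensor_tmul, Finset.sum_apply]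
    rfl
  obtain ⟨y, hy⟩ := (Module.Flat.lTensor_exact (S j) (LinearMap.exact_subtype_ker_map Φ)) _ |>.1 hξ'
  let β : S j ⊗[R] (κ → R) →ₗ[R] (κ → S j) := TensorProduct.lift
    (LinearMap.mk₂ R (fun s w k => s * algebraMap R (S j) (w k))
      (fun s s' w => funext fun k => by simp [add_mul])
      (fun r s w => funext fun k => by simp)
      (fun s w w' => funext fun k => by simp [mul_add])
      (fun r s w => funext fun k => by simp [Algebra.smul_def]; ring))
  have hβ : β ξ = x := by
    funext k
    simp [β, ξ, Pi.single_apply]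
  rw [← hβ, ← hy]
  clear hy hβ hξ hξ'
  induction y with
  | zero => simp
  | add y z hy hz => rw [map_add, map_add]; exact Submodule.add_mem _ hy hz
  | tmul s w =>
    rw [LinearMap.lTensor_tmul]
    refine Submodule.smul_mem _ s (Submodule.subset_span ⟨w.1, fun i => ?_, rfl⟩)
    rw [← hφ]
    exact congrFun (LinearMap.mem_ker.1 w.2) i

end FlatDescent

/-! ### Lattices of Laurent series and their coefficients -/

section Window

open scoped PowerSeries LaurentSeries

variable {R S : Type u} [CommRing R] [CommRing S]

/-- A Laurent series whose coefficients vanish below degree `z` is a multiple of `t ^ z`. -/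
theorem exists_eq_single_mul_iff (z : ℤ) (y : R⸨X⸩) :
    (∃ q : R⟦X⟧, y = HahnSeries.single z 1 * algebraMap R⟦X⟧ R⸨X⸩ q) ↔ ∀ m < z, y.coeff m = 0 := by
  constructor
  · rintro ⟨q, rfl⟩ m hm
    rw [HahnSeries.coeff_single_mul, LaurentSeries.coe_algebraMap, PowerSeries.coeff_coe,
      if_pos (by lia), mul_zero]
  · intro h
    refine ⟨PowerSeries.mk fun n => y.coeff (n + z), HahnSeries.ext (funext fun m => ?_)⟩
    rw [HahnSeries.coeff_single_mul, LaurentSeries.coe_algebraMap, PowerSeries.coeff_coe, one_mul]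
    split_ifs with hm
    · exact h m (by lia)
    · rw [PowerSeries.coeff_mk]
      congr 1
      lia

theorem exists_algebraMap_eq_iff (y : R⸨X⸩) :
    (∃ q : R⟦X⟧, algebraMap R⟦X⟧ R⸨X⸩ q = y) ↔ ∀ m < 0, y.coeff m = 0 := by
  rw [← exists_eq_single_mul_iff]
  refine exists_congr fun q => ?_
  change _ ↔ y = 1 * _
  rw [one_mul, eq_comm]

variable (R) (ι : Type*)

/-- The `R[[t]]`-lattice `t ^ z R[[t]] ^ ι` in `R((t)) ^ ι`. -/
def vanishing (z : ℤ) : Submodule R⟦X⟧ (ι → R⸨X⸩) where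
  carrier := {x | ∀ i, ∀ m < z, (x i).coeff m = 0}
  add_mem' {x y} hx hy i m hm := by
    rw [Pi.add_apply, HahnSeries.coeff_add, hx i m hm, hy i m hm, add_zero]
  zero_mem' i m _ := by simp
  smul_mem' p x hx i := by
    obtain ⟨q, hq⟩ := (exists_eq_single_mul_iff z (x i)).2 (hx i)
    refine (exists_eq_single_mul_iff z _).1 ⟨p * q, ?_⟩
    rw [Pi.smul_apply, hq, Algebra.smul_def, map_mul]
    ring

variable {R ι}

theorem vanishing_antitone {z z' : ℤ} (h : z ≤ z') : vanishing R ι z' ≤ vanishing R ι z :=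
  fun _ hx i m hm => hx i m (hm.trans_le h)

theorem X_pow_smul_mem_vanishing {z : ℤ} (n : ℕ) {x : ι → R⸨X⸩} (hx : x ∈ vanishing R ι z) :
    (PowerSeries.X ^ n : R⟦X⟧) • x ∈ vanishing R ι (n + z) := by
  intro i m hm
  rw [Pi.smul_apply, Algebra.smul_def, LaurentSeries.coe_algebraMap,
    HahnSeries.ofPowerSeries_X_pow, HahnSeries.coeff_single_mul, hx i _ (by lia), mul_zero]

/-- The map `R((t)) ^ ι → S((t)) ^ ι` induced by `R → S`. -/
noncomputable def mapPi (f : R →+* S) (x : ι → R⸨X⸩) : ι → S⸨X⸩ := fun i => laurentMap f (x i)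

theorem mapPi_smul (f : R →+* S) (p : R⟦X⟧) (x : ι → R⸨X⸩) :
    mapPi f (p • x) = PowerSeries.map f p • mapPi f x := by
  funext i
  rw [mapPi, Pi.smul_apply, Pi.smul_apply, Algebra.smul_def, Algebra.smul_def, map_mul,
    laurentMap_algebraMap, mapPi]

theorem mapPi_add (f : R →+* S) (x y : ι → R⸨X⸩) : mapPi f (x + y) = mapPi f x + mapPi f y :=
  funext fun _ => map_add _ _ _

theorem mapPi_mem_vanishing (f : R →+* S) {z : ℤ} {x : ι → R⸨X⸩} (hx : x ∈ vanishing R ι z) :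
    mapPi f x ∈ vanishing S ι z := fun i m hm => by
  rw [mapPi, coeff_laurentMap, hx i m hm, map_zero]

/-- The coefficients of degrees `-M, …, n - M - 1` of a vector of Laurent series. -/
def window (M n : ℕ) (x : ι → R⸨X⸩) : ι × Fin n → R := fun k => (x k.1).coeff (k.2 - M : ℤ)

/-- The vector of Laurent polynomials with given coefficients in degrees `-M, …, n - M - 1`. -/
noncomputable def ofWindow (M n : ℕ) : (ι × Fin n → R) →ₗ[R] (ι → R⸨X⸩) :=
  LinearMap.pi fun i => ∑ m : Fin n,
    HahnSeries.single.linearMap (m - M : ℤ) ∘ₗ LinearMap.proj (i, m)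

theorem window_add (M n : ℕ) (x y : ι → R⸨X⸩) :
    window M n (x + y) = window M n x + window M n y := funext fun _ => HahnSeries.coeff_add ..

theorem window_mapPi (f : R →+* S) (M n : ℕ) (x : ι → R⸨X⸩) :
    window M n (mapPi f x) = fun k => f (window M n x k) := rfl

theorem window_C_smul (M n : ℕ) (r : R) (x : ι → R⸨X⸩) :
    window M n ((PowerSeries.C r : R⟦X⟧) • x) = r • window M n x := by
  funext k
  rw [window, Pi.smul_apply, Algebra.smul_def, LaurentSeries.coe_algebraMap,
    HahnSeries.ofPowerSeries_C, HahnSeries.C_mul_eq_smul]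
  rfl

theorem window_eq_zero {M n : ℕ} {x : ι → R⸨X⸩} (hx : x ∈ vanishing R ι (n - M)) :
    window M n x = 0 := funext fun k => hx k.1 _ (by have := k.2.2; lia)

theorem coeff_ofWindow (M n : ℕ) (c : ι × Fin n → R) (i : ι) (m : ℤ) :
    (ofWindow M n c i).coeff m = ∑ k : Fin n, if m = k - M then c (i, k) else 0 := by
  rw [ofWindow, LinearMap.pi_apply, LinearMap.sum_apply, HahnSeries.coeff_sum]
  refine Finset.sum_congr rfl fun k _ => ?_
  rw [LinearMap.comp_apply, LinearMap.proj_apply]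
  refine HahnSeries.coeff_single.trans ?_
  split_ifs <;> rfl

theorem window_ofWindow (M n : ℕ) (c : ι × Fin n → R) : window M n (ofWindow M n c) = c := by
  funext ⟨i, k⟩
  rw [window, coeff_ofWindow, Finset.sum_eq_single k]
  · rw [if_pos rfl]
  · intro k' _ hk
    rw [if_neg]
    intro h
    exact hk (Fin.ext (by lia))
  · simp

theorem mapPi_ofWindow (f : R →+* S) (M n : ℕ) (c : ι × Fin n → R) :
    mapPi f (ofWindow M n c) = ofWindow M n (fun k => f (c k)) := by
  funext i
  ext m
  rw [mapPi, coeff_laurentMap, coeff_ofWindow, coeff_ofWindow, map_sum]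
  exact Finset.sum_congr rfl fun k _ => by split_ifs <;> simp

theorem sub_ofWindow_mem_vanishing {M n : ℕ} {x : ι → R⸨X⸩} (hx : x ∈ vanishing R ι (-M)) :
    x - ofWindow M n (window M n x) ∈ vanishing R ι (n - M) := by
  intro i m hm
  rw [Pi.sub_apply, HahnSeries.coeff_sub, coeff_ofWindow, sub_eq_zero]
  by_cases h : m < -M
  · rw [hx i m h]
    exact (Finset.sum_eq_zero fun k _ => if_neg (by lia)).symm
  · rw [Finset.sum_eq_single ⟨(m + M).toNat, by lia⟩]
    · rw [if_pos (by simp; lia), window]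
      congr 1
      simp
      lia
    · intro k _ hk
      rw [if_neg]
      intro hm
      exact hk (Fin.ext (by simp; lia))
    · simp

theorem C_smul_ofWindow (M n : ℕ) (r : R) (c : ι × Fin n → R) :
    (PowerSeries.C r : R⟦X⟧) • ofWindow M n c = ofWindow M n (r • c) := by
  rw [map_smul]
  funext i
  rw [Pi.smul_apply, Algebra.smul_def, LaurentSeries.coe_algebraMap, HahnSeries.ofPowerSeries_C,
    HahnSeries.C_mul_eq_smul]
  rfl

/-- The coefficient vectors, in a fixed range of degrees, of the Laurent polynomial vectors in
`D`. -/
noncomputable def windowSubmodule (M n : ℕ) (D : Submodule R⟦X⟧ (ι → R⸨X⸩)) :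
    Submodule R (ι × Fin n → R) where
  carrier := {c | ofWindow M n c ∈ D}
  add_mem' {c d} hc hd := by
    rw [Set.mem_ofPred_eq, map_add]
    exact D.add_mem hc hd
  zero_mem' := by
    rw [Set.mem_ofPred_eq, map_zero]
    exact D.zero_mem
  smul_mem' r c hc := by
    rw [Set.mem_ofPred_eq, ← C_smul_ofWindow]
    exact D.smul_mem _ hc

theorem window_mem_windowSubmodule {M n : ℕ} {D : Submodule R⟦X⟧ (ι → R⸨X⸩)}
    (hD : vanishing R ι (n - M) ≤ D) {x : ι → R⸨X⸩} (hx : x ∈ vanishing R ι (-M)) :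
    window M n x ∈ windowSubmodule M n D ↔ x ∈ D := by
  change ofWindow M n (window M n x) ∈ D ↔ x ∈ D
  have h := hD (sub_ofWindow_mem_vanishing (n := n) hx)
  conv_rhs => rw [← sub_add_cancel x (ofWindow M n (window M n x))]
  exact (Submodule.add_mem_iff_right D h).symm

/-- Modulo `t ^ n`, the power series `p` is a polynomial, so that the window of a multiple of a vector
of `D` is a combination of the windows of vectors of `D`. -/
theorem window_smul_mem (f : R →+* S) {M n : ℕ} {D : Submodule R⟦X⟧ (ι → R⸨X⸩)}
    (hD : vanishing R ι (n - M) ≤ D) (hD' : D ≤ vanishing R ι (-M)) (p : S⟦X⟧)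
    {x : ι → R⸨X⸩} (hx : x ∈ D) :
    window M n (p • mapPi f x) ∈
      Submodule.span S ((fun w k => f (w k)) '' (windowSubmodule M n D : Set (ι × Fin n → R))) := by
  let p₀ : S⟦X⟧ := ∑ m ∈ Finset.range n, PowerSeries.C (PowerSeries.coeff m p) * PowerSeries.X ^ m
  have hp : PowerSeries.X ^ n ∣ p - p₀ := by
    rw [PowerSeries.X_pow_dvd_iff]
    intro m hm
    rw [map_sub, map_sum, Finset.sum_eq_single m]
    · rw [PowerSeries.coeff_C_mul, PowerSeries.coeff_X_pow_self, mul_one, sub_self]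
    · intro m' _ hm'
      rw [PowerSeries.coeff_C_mul, PowerSeries.coeff_X_pow, if_neg hm'.symm, mul_zero]
    · intro h
      exact absurd (Finset.mem_range.2 hm) h
  obtain ⟨q, hq⟩ := hp
  have hx' := mapPi_mem_vanishing f (hD' hx)
  have h1 : window M n (p • mapPi f x) = window M n (p₀ • mapPi f x) := by
    rw [← sub_add_cancel p p₀, add_smul, window_add, hq, mul_smul, window_eq_zero, zero_add]
    have := X_pow_smul_mem_vanishing n (Submodule.smul_mem _ q hx')
    rwa [← sub_eq_add_neg] at this
  have h2 : ∀ s : Finset ℕ, window M n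
      ((∑ m ∈ s, PowerSeries.C (PowerSeries.coeff m p) * PowerSeries.X ^ m) • mapPi f x) ∈
      Submodule.span S ((fun w k => f (w k)) '' (windowSubmodule M n D : Set (ι × Fin n → R))) := by
    intro s
    induction s using Finset.cons_induction with
    | empty =>
      rw [Finset.sum_empty, zero_smul]
      rw [window_eq_zero (Submodule.zero_mem _)]
      exact Submodule.zero_mem _
    | cons m s _ ih =>
      rw [Finset.sum_cons, add_smul, window_add, mul_smul, window_C_smul]
      refine Submodule.add_mem _ (Submodule.smul_mem _ _ (Submodule.subset_span ?_)) ih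
      have hxm : (PowerSeries.X ^ m : R⟦X⟧) • x ∈ D := D.smul_mem _ hx
      refine ⟨window M n ((PowerSeries.X ^ m : R⟦X⟧) • x),
        (window_mem_windowSubmodule hD (hD' hxm)).2 hxm, ?_⟩
      refine (window_mapPi f M n _).symm.trans ?_
      rw [mapPi_smul, map_pow, PowerSeries.map_X]
  rw [h1]
  exact h2 _

/-- The window of the extension of `D` along `f` lies in the extension of the window of `D`. -/
theorem window_mem_span (f : R →+* S) {M n : ℕ} {D : Submodule R⟦X⟧ (ι → R⸨X⸩)}
    (hD : vanishing R ι (n - M) ≤ D) (hD' : D ≤ vanishing R ι (-M)) {y : ι → S⸨X⸩}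
    (hy : y ∈ Submodule.span S⟦X⟧ (mapPi f '' (D : Set (ι → R⸨X⸩)))) :
    window M n y ∈
      Submodule.span S ((fun w k => f (w k)) '' (windowSubmodule M n D : Set (ι × Fin n → R))) := by
  induction hy using Submodule.closure_induction with
  | zero =>
    rw [window_eq_zero (Submodule.zero_mem _)]
    exact Submodule.zero_mem _
  | add y z _ _ hy hz => rw [window_add]; exact Submodule.add_mem _ hy hz
  | smul_mem p y hy =>
    obtain ⟨x, hx, rfl⟩ := hy
    exact window_smul_mem f hD hD' p hx

end Window

/-! ### Descent of lattices -/

section LaurentDescent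

open TensorProduct
open scoped PowerSeries LaurentSeries

variable {R : Type u} [CommRing R] {J : Type} (S : J → Type u) [∀ j, CommRing (S j)]
  [∀ j, Algebra R (S j)] {ι : Type*}

theorem eq_zero_of_forall_algebraMap_eq_zero (hS : IsFpqcFamily S fun j => algebraMap R (S j))
    (r : R) (hr : ∀ j, algebraMap R (S j) r = 0) : r = 0 := by
  have h := mem_of_forall_mem_span S hS (⊥ : Submodule R (Unit → R)) (fun _ => r) fun j => by
    simp only [hr]
    exact Submodule.zero_mem _
  exact congrFun ((Submodule.mem_bot R).1 h) ()

theorem mem_vanishing_of_forall (hS : IsFpqcFamily S fun j => algebraMap R (S j)) {z : ℤ}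
    {x : ι → R⸨X⸩} (hx : ∀ j, mapPi (algebraMap R (S j)) x ∈ vanishing (S j) ι z) :
    x ∈ vanishing R ι z := fun i m hm =>
  eq_zero_of_forall_algebraMap_eq_zero S hS _ fun j => hx j i m hm

theorem span_mapPi_le_vanishing {R S : Type u} [CommRing R] [CommRing S] (f : R →+* S) {z : ℤ}
    {D : Submodule R⟦X⟧ (ι → R⸨X⸩)} (hD : D ≤ vanishing R ι z) :
    Submodule.span S⟦X⟧ (mapPi f '' (D : Set (ι → R⸨X⸩))) ≤ vanishing S ι z :=
  Submodule.span_le.2 (by rintro _ ⟨x, hx, rfl⟩; exact mapPi_mem_vanishing f (hD hx))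

variable (R) in
/-- The vector `t ^ N e_i`. -/
noncomputable def singlePow [DecidableEq ι] (N : ℕ) (i : ι) : ι → R⸨X⸩ :=
  Pi.single i (HahnSeries.single (N : ℤ) 1)

theorem singlePow_mem_vanishing [DecidableEq ι] (N : ℕ) (i : ι) :
    singlePow R N i ∈ vanishing R ι N := by
  intro i' m hm
  rw [singlePow]
  by_cases h : i' = i
  · subst h
    rw [Pi.single_eq_same, HahnSeries.coeff_single, if_neg hm.ne]
  · rw [Pi.single_eq_of_ne h, HahnSeries.coeff_zero]

theorem mapPi_singlePow [DecidableEq ι] {R S : Type u} [CommRing R] [CommRing S] (f : R →+* S) (N : ℕ)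
    (i : ι) : mapPi f (singlePow R N i) = singlePow S N i := by
  funext i'
  rw [singlePow, singlePow]
  by_cases h : i' = i
  · subst h
    ext m
    rw [mapPi, coeff_laurentMap, Pi.single_eq_same, Pi.single_eq_same, HahnSeries.coeff_single,
      HahnSeries.coeff_single]
    split_ifs <;> simp
  · rw [mapPi, Pi.single_eq_of_ne h, Pi.single_eq_of_ne h, map_zero]

theorem vanishing_le_of_singlePow_mem [DecidableEq ι] [Fintype ι] {N : ℕ}
    {D : Submodule R⟦X⟧ (ι → R⸨X⸩)}
    (h : ∀ i, singlePow R N i ∈ D) : vanishing R ι N ≤ D := by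
  intro x hx
  choose q hq using fun i => (exists_eq_single_mul_iff (N : ℤ) (x i)).2 (hx i)
  have : x = ∑ i, q i • singlePow R N i := by
    conv_lhs => rw [← Finset.univ_sum_single x]
    refine Finset.sum_congr rfl fun i _ => ?_
    rw [singlePow, ← Pi.single_smul, hq i, Algebra.smul_def, mul_comm]
  rw [this]
  exact D.sum_mem fun i _ => D.smul_mem _ (h i)

variable [Fintype ι]

/-- Membership in a lattice can be tested on an fpqc family. -/
theorem mem_of_forall_mapPi_mem_span (hS : IsFpqcFamily S fun j => algebraMap R (S j))
    {N M : ℕ} {D : Submodule R⟦X⟧ (ι → R⸨X⸩)} (hD : vanishing R ι N ≤ D)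
    (hD' : D ≤ vanishing R ι (-M)) {v : ι → R⸨X⸩}
    (hv : ∀ j, mapPi (algebraMap R (S j)) v ∈ Submodule.span (S j)⟦X⟧
      (mapPi (algebraMap R (S j)) '' (D : Set (ι → R⸨X⸩)))) : v ∈ D := by
  -- The window consists of the `N + M` degrees from `-M` up to `N - 1`.
  have hn : ((N + M : ℕ) : ℤ) - M = N := by push_cast; ring
  have hD₁ : vanishing R ι ((N + M : ℕ) - M) ≤ D := by rwa [hn]
  have hv' : v ∈ vanishing R ι (-M) := mem_vanishing_of_forall S hS fun j =>
    span_mapPi_le_vanishing _ hD' (hv j)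
  rw [← window_mem_windowSubmodule hD₁ hv']
  exact mem_of_forall_mem_span S hS _ _ fun j => window_mem_span _ hD₁ hD' (hv j)

/-- Descent of lattices along a finite family of flat algebras: a compatible family of lattices is
generated by the vectors over the base that are contained in all of them. -/
theorem le_span_of_compatible [Finite J] [∀ j, Module.Flat R (S j)] {N M : ℕ}
    (L : ∀ j, Submodule (S j)⟦X⟧ (ι → (S j)⸨X⸩)) (hL : ∀ j, vanishing (S j) ι N ≤ L j)
    (hL' : ∀ j, L j ≤ vanishing (S j) ι (-M))
    (hcompat : ∀ i j, ∀ x ∈ L j,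
      mapPi (Algebra.TensorProduct.includeLeftRingHom : S j →+* S j ⊗[R] S i) x ∈
        Submodule.span (S j ⊗[R] S i)⟦X⟧
          (mapPi (Algebra.TensorProduct.includeRight : S i →ₐ[R] S j ⊗[R] S i).toRingHom ''
            (L i : Set (ι → (S i)⸨X⸩)))) (j : J) :
    L j ≤ Submodule.span (S j)⟦X⟧ (mapPi (algebraMap R (S j)) ''
      {x : ι → R⸨X⸩ | ∀ i, mapPi (algebraMap R (S i)) x ∈ L i}) := by
  classical
  have hn : ((N + M : ℕ) : ℤ) - M = N := by push_cast; ring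
  have hL₁ : ∀ j, vanishing (S j) ι ((N + M : ℕ) - M) ≤ L j := fun j => by rw [hn]; exact hL j
  set D := Submodule.span (S j)⟦X⟧ (mapPi (algebraMap R (S j)) ''
      {x : ι → R⸨X⸩ | ∀ i, mapPi (algebraMap R (S i)) x ∈ L i}) with hDdef
  have hD : vanishing (S j) ι ((N + M : ℕ) - M) ≤ D := by
    rw [hn]
    refine vanishing_le_of_singlePow_mem fun i => Submodule.subset_span
      ⟨singlePow R N i, fun j' => ?_, mapPi_singlePow _ N i⟩
    rw [mapPi_singlePow]
    exact hL j' (singlePow_mem_vanishing N i)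
  have hcompat' : ∀ i j, ∀ c ∈ windowSubmodule M (N + M) (L j),
      (fun k => c k ⊗ₜ[R] (1 : S i)) ∈ Submodule.span (S j ⊗[R] S i)
        ((fun w k => (1 : S j) ⊗ₜ[R] w k) ''
          (windowSubmodule M (N + M) (L i) : Set (ι × Fin (N + M) → S i))) := by
    intro i j c hc
    have h := window_mem_span _ (hL₁ i) (hL' i) (hcompat i j _ hc)
    rw [window_mapPi, window_ofWindow] at h
    exact h
  intro x hx
  rw [← window_mem_windowSubmodule hD (hL' j hx)]
  have h := mem_span_of_compatible S (fun j => windowSubmodule M (N + M) (L j)) hcompat' j _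
    ((window_mem_windowSubmodule (hL₁ j) (hL' j hx)).2 hx)
  refine (Submodule.span_le.2 ?_ : _ ≤ windowSubmodule M (N + M) D) h
  rintro _ ⟨w, hw, rfl⟩
  change ofWindow _ _ _ ∈ D
  rw [← mapPi_ofWindow]
  refine Submodule.subset_span ⟨_, fun i => ?_, rfl⟩
  rw [mapPi_ofWindow]
  exact hw i

end LaurentDescent

/-! ### Bounds on lattices -/

section Bounds

open scoped PowerSeries LaurentSeries

variable {R : Type u} [CommRing R]

theorem exists_mem_vanishing {ι : Type*} [Finite ι] (x : ι → R⸨X⸩) :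
    ∃ M : ℕ, x ∈ vanishing R ι (-M) := by
  obtain ⟨M, hM⟩ := Finite.exists_le fun i => (-(x i).order).toNat
  refine ⟨M, fun i m hm => HahnSeries.coeff_eq_zero_of_lt_order ?_⟩
  have := hM i
  lia

theorem IsLattice.exists_le_vanishing {L : Submodule R⟦X⟧ (Oct R⸨X⸩)} (hL : IsLattice L) :
    ∃ M : ℕ, L ≤ vanishing R (Fin 8) (-M) := by
  obtain ⟨s, hs⟩ := (Module.Finite.iff_fg.1 hL.finite)
  choose M hM using fun x : Oct R⸨X⸩ => exists_mem_vanishing x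
  refine ⟨s.sup M, ?_⟩
  rw [← hs, Submodule.span_le]
  intro x hx
  refine vanishing_antitone ?_ (hM x)
  have : M x ≤ s.sup M := Finset.le_sup hx
  lia

/-- Every vector is moved into a lattice by all large powers of `t`. -/
theorem IsLattice.exists_X_pow_smul_mem {L : Submodule R⟦X⟧ (Oct R⸨X⸩)} (hL : IsLattice L)
    (v : Oct R⸨X⸩) : ∃ N : ℕ, ∀ n ≥ N, (PowerSeries.X ^ n : R⟦X⟧) • v ∈ L := by
  have hv : v ∈ Submodule.span R⸨X⸩ (L : Set (Oct R⸨X⸩)) := hL.span_eq_top ▸ Submodule.mem_top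
  induction hv using Submodule.closure_induction with
  | zero => exact ⟨0, fun n _ => by rw [smul_zero]; exact L.zero_mem⟩
  | add x y _ _ hx hy =>
    obtain ⟨N, hN⟩ := hx
    obtain ⟨N', hN'⟩ := hy
    refine ⟨max N N', fun n hn => ?_⟩
    rw [smul_add]
    exact L.add_mem (hN n (by lia)) (hN' n (by lia))
  | smul_mem a x hx =>
    obtain ⟨M, hM⟩ := exists_mem_vanishing fun _ : Unit => a
    obtain ⟨q, hq⟩ := (exists_eq_single_mul_iff _ _).2 (hM ())
    refine ⟨M, fun n hn => ?_⟩
    have : (PowerSeries.X ^ n : R⟦X⟧) • a • x =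
        ((PowerSeries.X ^ (n - M) : R⟦X⟧) * q) • x := by
      rw [← algebraMap_smul R⸨X⸩ (PowerSeries.X ^ n : R⟦X⟧), ← algebraMap_smul R⸨X⸩ (_ * q),
        smul_smul, map_mul]
      simp only at hq
      rw [hq, ← mul_assoc]
      congr 2
      rw [LaurentSeries.coe_algebraMap, HahnSeries.ofPowerSeries_X_pow,
        HahnSeries.ofPowerSeries_X_pow, HahnSeries.single_mul_single, mul_one]
      congr 1
      lia
    rw [this]
    exact L.smul_mem _ hx

theorem IsLattice.exists_vanishing_le {L : Submodule R⟦X⟧ (Oct R⸨X⸩)} (hL : IsLattice L) :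
    ∃ N : ℕ, vanishing R (Fin 8) N ≤ L := by
  choose N hN using fun i : Fin 8 => hL.exists_X_pow_smul_mem (Pi.single i 1)
  obtain ⟨N', hN'⟩ := Finite.exists_le N
  refine ⟨N', vanishing_le_of_singlePow_mem fun i => ?_⟩
  have h := hN i N' (hN' i)
  rwa [← Pi.single_smul, Algebra.smul_def, mul_one, LaurentSeries.coe_algebraMap,
    HahnSeries.ofPowerSeries_X_pow] at h

end Bounds

/-! ### The Casimir element -/

section Casimir

variable {A : Type u} [CommRing A]

/-- The coordinates of `x ⊗ y`. -/
def outer (x y : Oct A) : Fin 8 × Fin 8 → A := fun k => x k.1 * y k.2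

/-- The index of the standard basis vector dual to a given one with respect to `⟨ , ⟩`. -/
def dualIndex : Fin 8 → Fin 8 := ![1, 0, 5, 6, 7, 2, 3, 4]

variable (A) in
/-- The coordinates of the Casimir element of `⟨ , ⟩`, i.e. of `∑ xᵢ ⊗ yᵢ` for dual bases. -/
def casimir : Fin 8 × Fin 8 → A := fun k => if k.1 = dualIndex k.2 then 1 else 0

theorem bilin_eq_sum (y z : Oct A) : bilin y z = ∑ q, y q * z (dualIndex q) := by
  simp [bilin_eq, dualIndex, Fin.sum_univ_eight]
  ring

theorem bilin_single_dualIndex (y : Oct A) (q : Fin 8) :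
    bilin y (Pi.single (dualIndex q) 1) = y q := by
  rw [bilin_eq_sum, Finset.sum_eq_single q]
  · rw [Pi.single_eq_same, mul_one]
  · intro q' _ h
    rw [Pi.single_eq_of_ne, mul_zero]
    revert q q'
    decide
  · simp

theorem dualIndex_dualIndex (q : Fin 8) : dualIndex (dualIndex q) = q := by
  revert q
  decide

/-- Families `x`, `y` are dual bases if and only if `∑ xᵢ ⊗ yᵢ` is the Casimir element. -/
theorem sum_outer_eq_casimir_iff {n : ℕ} (x y : Fin n → Oct A) :
    ∑ i, outer (x i) (y i) = casimir A ↔ ∀ z, z = ∑ i, bilin (y i) z • x i := by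
  constructor
  · intro h z
    funext p
    have h' : ∀ q, ∑ i, x i p * y i q = if p = dualIndex q then 1 else 0 := fun q => by
      have := congrFun h (p, q)
      rwa [Finset.sum_apply] at this
    rw [Finset.sum_apply]
    simp only [Pi.smul_apply, smul_eq_mul, bilin_eq_sum, Finset.sum_mul]
    rw [Finset.sum_comm, Finset.sum_eq_single (dualIndex p)]
    · rw [dualIndex_dualIndex]
      calc z p = z p * ∑ i, x i p * y i (dualIndex p) := by
            rw [h', if_pos (dualIndex_dualIndex p).symm, mul_one]
        _ = _ := by
            rw [Finset.mul_sum]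
            exact Finset.sum_congr rfl fun i _ => by ring
    · intro q _ hq
      calc _ = z (dualIndex q) * ∑ i, x i p * y i q := by
            rw [Finset.mul_sum]
            exact Finset.sum_congr rfl fun i _ => by ring
        _ = 0 := by
            rw [h', if_neg, mul_zero]
            rintro rfl
            exact hq (dualIndex_dualIndex q).symm
    · simp
  · intro h
    funext ⟨p, q⟩
    have := congrFun (h (Pi.single (dualIndex q) 1)) p
    simp only [bilin_single_dualIndex, Finset.sum_apply, Pi.smul_apply, smul_eq_mul,
      Pi.single_apply] at this
    rw [Finset.sum_apply, casimir, this]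
    exact Finset.sum_congr rfl fun i _ => mul_comm _ _

/-- `x ⊗ y` as a bilinear map. -/
def outerₗ : Oct A →ₗ[A] Oct A →ₗ[A] (Fin 8 × Fin 8 → A) :=
  LinearMap.mk₂ A outer (fun _ _ _ => funext fun _ => add_mul _ _ _)
    (fun _ _ _ => funext fun _ => mul_assoc _ _ _) (fun _ _ _ => funext fun _ => mul_add _ _ _)
    (fun _ _ _ => funext fun _ => mul_left_comm _ _ _)

theorem outerₗ_apply (x y : Oct A) : outerₗ x y = outer x y := rfl

variable {O : Type u} [CommRing O] [Algebra O A]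

/-- The image of `L ⊗ L` in `(Λ ⊗ Λ) ⊗ A`. -/
def outerSpan (L : Submodule O (Oct A)) : Submodule O (Fin 8 × Fin 8 → A) :=
  Submodule.span O (Set.image2 outer L L)

theorem outer_mem_of_mem_span {s : Set (Oct A)} {D : Submodule O (Fin 8 × Fin 8 → A)}
    (h : ∀ x ∈ s, ∀ y ∈ s, outer x y ∈ D) {x y : Oct A} (hx : x ∈ Submodule.span O s)
    (hy : y ∈ Submodule.span O s) : outer x y ∈ D := by
  induction hx, hy using Submodule.span_induction₂ with
  | mem_mem x y hx hy => exact h x hx y hy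
  | zero_left y _ => rw [← outerₗ_apply, LinearMap.map_zero₂]; exact D.zero_mem
  | zero_right x _ => rw [← outerₗ_apply, map_zero]; exact D.zero_mem
  | add_left x y z _ _ _ h h' => rw [← outerₗ_apply, LinearMap.map_add₂]; exact D.add_mem h h'
  | add_right x y z _ _ _ h h' => rw [← outerₗ_apply, map_add]; exact D.add_mem h h'
  | smul_left r x y _ _ h =>
    rw [← outerₗ_apply, ← algebraMap_smul A, LinearMap.map_smul₂, algebraMap_smul]
    exact D.smul_mem _ h
  | smul_right r x y _ _ h =>
    rw [← outerₗ_apply, ← algebraMap_smul A, map_smul, algebraMap_smul]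
    exact D.smul_mem _ h

theorem casimir_mem_outerSpan {L : Submodule O (Oct A)} (h1 : IsLattice L) (h2 : IsSelfDual L) :
    casimir A ∈ outerSpan L := by
  obtain ⟨n, x, y, hx, hy, h⟩ := exists_dual_basis h1 h2
  have h' : ∀ z, z = ∑ i, bilin (y i) z • x i := by
    intro z
    have hz : z ∈ Submodule.span A (L : Set (Oct A)) := h1.span_eq_top ▸ Submodule.mem_top
    induction hz using Submodule.span_induction with
    | mem z hz => exact h z hz
    | zero => simp only [← bilinₗ_apply, map_zero, zero_smul, Finset.sum_const_zero]
    | add a b _ _ ha hb =>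
      simp only [← bilinₗ_apply, map_add, add_smul, Finset.sum_add_distrib]
      exact congrArg₂ _ ha hb
    | smul c a _ ha =>
      simp only [← bilinₗ_apply, map_smul, smul_assoc, ← Finset.smul_sum]
      exact congrArg (c • ·) ha
  rw [← (sum_outer_eq_casimir_iff x y).2 h']
  exact Submodule.sum_mem _ fun i _ => Submodule.subset_span ⟨_, hx i, _, hy i, rfl⟩

theorem exists_dual_basis_of_casimir_mem {L : Submodule O (Oct A)} (h : casimir A ∈ outerSpan L) :
    ∃ (n : ℕ) (x y : Fin n → Oct A), (∀ i, x i ∈ L) ∧ (∀ i, y i ∈ L) ∧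
      ∀ z, z = ∑ i, bilin (y i) z • x i := by
  obtain ⟨n, c, v, hv⟩ := Submodule.mem_span_set'.1 h
  choose x hx y hy hxy using fun i => (v i).2
  refine ⟨n, fun i => c i • x i, y, fun i => L.smul_mem _ (hx i), hy, ?_⟩
  rw [← sum_outer_eq_casimir_iff, ← hv]
  refine Finset.sum_congr rfl fun i _ => ?_
  rw [← hxy, ← outerₗ_apply, ← outerₗ_apply, ← algebraMap_smul A, LinearMap.map_smul₂,
    algebraMap_smul]

end Casimir

/-! ### Gluing of self-dual orders -/

section Gluing

open TensorProduct
open scoped PowerSeries LaurentSeries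

theorem vanishing_le_outerSpan {R : Type u} [CommRing R] {N : ℕ}
    {L : Submodule R⟦X⟧ (Oct R⸨X⸩)} (h : vanishing R (Fin 8) N ≤ L) :
    vanishing R (Fin 8 × Fin 8) (N + N : ℕ) ≤ outerSpan L := by
  refine vanishing_le_of_singlePow_mem fun ⟨p, q⟩ => Submodule.subset_span
    ⟨_, h (singlePow_mem_vanishing N p), _, h (singlePow_mem_vanishing N q), ?_⟩
  funext ⟨p', q'⟩
  simp only [outer, singlePow, Pi.single_apply, Prod.mk.injEq]
  by_cases hp : p' = p <;> by_cases hq : q' = q <;> simp [hp, hq]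

theorem outerSpan_le_vanishing {R : Type u} [CommRing R] {M : ℕ}
    {L : Submodule R⟦X⟧ (Oct R⸨X⸩)} (h : L ≤ vanishing R (Fin 8) (-M)) :
    outerSpan L ≤ vanishing R (Fin 8 × Fin 8) (-(M + M : ℕ)) := by
  refine Submodule.span_le.2 ?_
  rintro _ ⟨x, hx, y, hy, rfl⟩ ⟨p, q⟩
  obtain ⟨a, ha⟩ := (exists_eq_single_mul_iff _ _).2 (h hx p)
  obtain ⟨b, hb⟩ := (exists_eq_single_mul_iff _ _).2 (h hy q)
  refine (exists_eq_single_mul_iff _ _).1 ⟨a * b, ?_⟩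
  rw [outer, ha, hb, map_mul, mul_mul_mul_comm, HahnSeries.single_mul_single, mul_one]
  congr 3
  push_cast
  ring

variable {R : Type u} [CommRing R] {J : Type} (S : J → Type u) [∀ j, CommRing (S j)]
  [∀ j, Algebra R (S j)]

/-- Self-dual orders form a separated presheaf. -/
theorem SelfDualOrder.eq_of_forall_map_eq (hS : IsFpqcFamily S fun j => algebraMap R (S j))
    {L L' : SelfDualOrder R}
    (h : ∀ j, L.map (algebraMap R (S j)) = L'.map (algebraMap R (S j))) : L = L' := by
  have key : ∀ L L' : SelfDualOrder R,
      (∀ j, L.map (algebraMap R (S j)) = L'.map (algebraMap R (S j))) → L.1 ≤ L'.1 := by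
    intro L L' h x hx
    obtain ⟨M, hM⟩ := L'.2.1.exists_le_vanishing
    obtain ⟨N, hN⟩ := L'.2.1.exists_vanishing_le
    refine mem_of_forall_mapPi_mem_span S hS hN hM fun j => ?_
    have : mapVec (laurentMap (algebraMap R (S j))) x ∈ (L'.map (algebraMap R (S j))).1 := by
      rw [← h j]
      exact SelfDualOrder.mapVec_mem _ L hx
    exact this
  exact Subtype.ext (le_antisymm (key L L' h) (key L' L fun j => (h j).symm))

/-- The vectors over `R((t))` that lie in `L j` for all `j`. -/
noncomputable def glue (L : ∀ j, SelfDualOrder (S j)) : Submodule R⟦X⟧ (Oct R⸨X⸩) where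
  carrier := {x | ∀ j, mapPi (algebraMap R (S j)) x ∈ (L j).1}
  add_mem' {x y} hx hy j := by
    rw [mapPi_add]
    exact (L j).1.add_mem (hx j) (hy j)
  zero_mem' j := by
    have : mapPi (algebraMap R (S j)) (0 : Oct R⸨X⸩) = 0 := funext fun _ => map_zero _
    rw [this]
    exact (L j).1.zero_mem
  smul_mem' p x hx j := by
    rw [mapPi_smul]
    exact (L j).1.smul_mem _ (hx j)

/-- Self-dual orders glue along fpqc families. -/
theorem SelfDualOrder.exists_glue [Finite J] (hS : IsFpqcFamily S fun j => algebraMap R (S j))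
    (L : ∀ j, SelfDualOrder (S j))
    (hL : ∀ i j, (L j).map (Algebra.TensorProduct.includeLeftRingHom : S j →+* S j ⊗[R] S i) =
      (L i).map (Algebra.TensorProduct.includeRight : S i →ₐ[R] S j ⊗[R] S i).toRingHom) :
    ∃ L₀ : SelfDualOrder R, ∀ j, L₀.map (algebraMap R (S j)) = L j := by
  have hflat : ∀ j, Module.Flat R (S j) := fun j => RingHom.flat_algebraMap_iff.1 (hS.1 j)
  choose M hM using fun j => (L j).2.1.exists_le_vanishing
  choose N hN using fun j => (L j).2.1.exists_vanishing_le
  obtain ⟨M₀, hM₀⟩ := Finite.exists_le M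
  obtain ⟨N₀, hN₀⟩ := Finite.exists_le N
  have hM' : ∀ j, (L j).1 ≤ vanishing (S j) (Fin 8) (-M₀) := fun j =>
    (hM j).trans (vanishing_antitone (by have := hM₀ j; lia))
  have hN' : ∀ j, vanishing (S j) (Fin 8) N₀ ≤ (L j).1 := fun j =>
    (vanishing_antitone (by have := hN₀ j; lia)).trans (hN j)
  let G := glue (R := R) S L
  have hGN : vanishing R (Fin 8) N₀ ≤ G := fun x hx j => hN' j (mapPi_mem_vanishing _ hx)
  have hGM : G ≤ vanishing R (Fin 8) (-M₀) := fun x hx =>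
    mem_vanishing_of_forall S hS fun j => hM' j (hx j)
  have hbc : ∀ j, baseChange (S j)⟦X⟧ (laurentMap (algebraMap R (S j))) G = (L j).1 := by
    intro j
    refine le_antisymm (Submodule.span_le.2 ?_) ?_
    · rintro _ ⟨x, hx, rfl⟩
      exact hx j
    · refine le_span_of_compatible S (fun j => (L j).1) hN' hM' (fun i j x hx => ?_) j
      have := SelfDualOrder.mapVec_mem
        (Algebra.TensorProduct.includeLeftRingHom : S j →+* S j ⊗[R] S i) (L j) hx
      rw [hL i j] at this
      exact this
  have hint : ∀ x ∈ G, ∀ y ∈ G, ∃ c, algebraMap R⟦X⟧ R⸨X⸩ c = bilin x y := by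
    intro x hx y hy
    rw [exists_algebraMap_eq_iff]
    intro m hm
    refine eq_zero_of_forall_algebraMap_eq_zero S hS _ fun j => ?_
    obtain ⟨ψ, hψ⟩ := (L j).2.2.1
    have h : ∃ c, algebraMap (S j)⟦X⟧ (S j)⸨X⸩ c = laurentMap (algebraMap R (S j)) (bilin x y) := by
      rw [← mapVec_bilin]
      exact ⟨_, hψ ⟨_, hx j⟩ ⟨_, hy j⟩⟩
    exact (exists_algebraMap_eq_iff _).1 h m hm
  have hcas : casimir R⸨X⸩ ∈ outerSpan G := by
    refine mem_of_forall_mapPi_mem_span S hS (vanishing_le_outerSpan hGN)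
      (outerSpan_le_vanishing hGM) fun j => ?_
    have h1 : mapPi (algebraMap R (S j)) (casimir R⸨X⸩) = casimir (S j)⸨X⸩ := funext fun k => by
      rw [mapPi, casimir, casimir]
      split_ifs
      · exact map_one _
      · exact map_zero _
    rw [h1]
    have h2 := casimir_mem_outerSpan (L j).2.1 (L j).2.2.1
    refine (Submodule.span_le.2 ?_ : outerSpan (L j).1 ≤ _) h2
    rintro _ ⟨x, hx, y, hy, rfl⟩
    rw [← hbc j] at hx hy
    refine outer_mem_of_mem_span ?_ hx hy
    rintro _ ⟨x, hx, rfl⟩ _ ⟨y, hy, rfl⟩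
    exact Submodule.subset_span ⟨outer x y, Submodule.subset_span ⟨x, hx, y, hy, rfl⟩,
      funext fun k => map_mul _ _ _⟩
  obtain ⟨n, x, y, hx, hy, hxy⟩ := exists_dual_basis_of_casimir_mem hcas
  obtain ⟨h1, h2, h3⟩ := of_dual_basis algebraMap_laurent_injective hint x y hx hy fun z _ => hxy z
  have hspan : Submodule.span R⸨X⸩ (G : Set (Oct R⸨X⸩)) = ⊤ := by
    refine eq_top_iff.2 fun z _ => ?_
    rw [hxy z]
    exact Submodule.sum_mem _ fun i _ => Submodule.smul_mem _ _ (Submodule.subset_span (hx i))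
  have hord : IsOrder G := by
    refine ⟨fun j => ?_, fun x hx y hy j => ?_⟩
    · have := (L j).2.2.2.unit_mem
      rwa [← mapVec_paraUnit (laurentMap (algebraMap R (S j)))] at this
    · have := (L j).2.2.2.mul_mem _ (hx j) _ (hy j)
      exact Eq.mp (congrArg (· ∈ (L j).1)
        (mapVec_paraMul (laurentMap (algebraMap R (S j))) x y)) this
  exact ⟨⟨G, ⟨h1, h2, hspan⟩, h3, hord⟩, fun j => Subtype.ext (hbc j)⟩

end Gluing

/-! ### The sheaf of self-dual orders -/

section LatticeSheaf

variable {k : Type u} [Field k]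

/-- The form of `SelfDualOrder.eq_of_forall_map_eq` in terms of morphisms of `k`-algebras. -/
theorem eq_of_forall_latticeFunctor_map_eq {X : AffineSchemes k} {J : Type}
    (A : J → CommAlgCat.{u} k) (f : ∀ j, X.unop ⟶ A j)
    (hf : IsFpqcFamily (fun j => A j) fun j => (f j).hom.toRingHom) {L L' : SelfDualOrder X.unop}
    (h : ∀ j, L.map (f j).hom.toRingHom = L'.map (f j).hom.toRingHom) : L = L' := by
  let _ : ∀ j, Algebra X.unop (A j) := fun j => (f j).hom.toRingHom.toAlgebra
  exact SelfDualOrder.eq_of_forall_map_eq (fun j => A j) hf h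

theorem isSeparatedFor_of_mem {X : AffineSchemes k} {T : Sieve X} (hT : T ∈ fpqcTopology k X) :
    T.arrows.IsSeparatedFor (latticeFunctor k) := by
  obtain ⟨J, _, A, f, hT, hf⟩ := hT
  intro x t t' ht ht'
  refine eq_of_forall_latticeFunctor_map_eq A f hf fun j => ?_
  exact (ht _ (hT j)).trans (ht' _ (hT j)).symm

/-- Compatibility of a family is only used on the tensor products `A j ⊗ A i`. -/
theorem isSheafFor_of_isFpqcFamily {X : AffineSchemes k} {J : Type} [Finite J]
    (A : J → CommAlgCat.{u} k) (f : ∀ j, X.unop ⟶ A j)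
    (hf : IsFpqcFamily (fun j => A j) fun j => (f j).hom.toRingHom) :
    (Presieve.ofArrows (fun j => Opposite.op (A j)) fun j => (f j).op).IsSheafFor
      (latticeFunctor k) := by
  let _ : ∀ j, Algebra X.unop (A j) := fun j => (f j).hom.toRingHom.toAlgebra
  have hk : ∀ j, IsScalarTower k X.unop (A j) := fun j =>
    IsScalarTower.of_algebraMap_eq fun a => ((f j).hom.commutes a).symm
  rw [Presieve.isSheafFor_arrows_iff]
  intro L hL
  let T : J → J → CommAlgCat.{u} k := fun i j => CommAlgCat.of k (TensorProduct X.unop (A j) (A i))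
  let inl : ∀ i j, A j ⟶ T i j := fun i j =>
    CommAlgCat.ofHom { Algebra.TensorProduct.includeLeftRingHom with commutes' := fun _ => rfl }
  let inr : ∀ i j, A i ⟶ T i j := fun i j =>
    CommAlgCat.ofHom
      { (Algebra.TensorProduct.includeRight :
          A i →ₐ[X.unop] TensorProduct X.unop (A j) (A i)).toRingHom with
        commutes' := fun a => by
          have h := (Algebra.TensorProduct.includeRight :
            A i →ₐ[X.unop] TensorProduct X.unop (A j) (A i)).commutes (algebraMap k X.unop a)
          rw [← IsScalarTower.algebraMap_apply k X.unop (A i)] at h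
          refine h.trans ?_
          rw [Algebra.TensorProduct.algebraMap_apply, Algebra.TensorProduct.algebraMap_apply,
            ← IsScalarTower.algebraMap_apply k X.unop (A j)] }
  obtain ⟨L₀, hL₀⟩ := SelfDualOrder.exists_glue (R := X.unop) (fun j => A j) hf (fun j => L j)
    fun i j => hL j i (Opposite.op (T i j)) (inl i j).op (inr i j).op (by
      apply Quiver.Hom.unop_inj
      ext x
      exact Algebra.TensorProduct.tmul_one_eq_one_tmul (A := A j) (B := A i) x)
  exact ⟨L₀, hL₀, fun L' hL' => eq_of_forall_latticeFunctor_map_eq A f hf fun j =>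
    (hL' j).trans (hL₀ j).symm⟩

/-- Self-dual orders form a sheaf for the fpqc topology. -/
theorem isSheaf_latticePresheaf : Presheaf.IsSheaf (fpqcTopology k) (latticePresheaf k) := by
  rw [isSheaf_iff_isSheaf_of_type]
  intro X T hT
  rw [Presieve.isSheafFor_comp_uliftFunctor_iff]
  obtain ⟨J, _, A, f, hT, hf⟩ := hT
  have h := isSheafFor_of_isFpqcFamily A f hf
  rw [Presieve.isSheafFor_iff_generate] at h
  refine Presieve.isSheafFor_subsieve_aux _ ?_ h fun Y g _ => isSeparatedFor_of_mem
    ((fpqcTopology k).pullback_stable g ?_)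
  · rintro Y _ ⟨Z, g, _, ⟨j⟩, rfl⟩
    exact T.downward_closed (hT j) g
  · exact ⟨J, inferInstance, A, f, fun j => Sieve.le_generate _ _ _ (Presieve.ofArrows.mk j), hf⟩

end LatticeSheaf

/-! ### Comparison with the affine Grassmannian -/

section Comparison

/-- The map `LG(R) / L⁺G(R) → {self-dual orders}`, `g ↦ g(Λ ⊗ R[[t]])`. -/
noncomputable def cosetOrbit {R : Type u} [CommRing R] (x : LoopGroup R ⧸ positiveLoopGroup R) :
    SelfDualOrder R :=
  Quotient.lift (fun g : LoopGroup R => g • SelfDualOrder.standard R) (fun g h hgh => by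
    have := (mem_positiveLoopGroup_iff _).1 (QuotientGroup.leftRel_apply.1 hgh)
    rw [mul_smul, inv_smul_eq_iff] at this
    exact this.symm) x

theorem cosetOrbit_injective {R : Type u} [CommRing R] :
    Function.Injective (cosetOrbit (R := R)) := by
  intro x y h
  induction x using QuotientGroup.induction_on with | H g => ?_
  induction y using QuotientGroup.induction_on with | H g' => ?_
  have h' : g • SelfDualOrder.standard R = g' • SelfDualOrder.standard R := h
  refine QuotientGroup.eq.2 ((mem_positiveLoopGroup_iff _).2 ?_)
  rw [mul_smul, inv_smul_eq_iff, h']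

theorem cosetOrbit_quotientMap {R S : Type u} [CommRing R] [CommRing S] (f : R →+* S)
    (x : LoopGroup R ⧸ positiveLoopGroup R) :
    cosetOrbit (quotientMap f x) = (cosetOrbit x).map f := by
  induction x using QuotientGroup.induction_on with | H g => ?_
  change loopMap f g • SelfDualOrder.standard S = (g • SelfDualOrder.standard R).map f
  rw [SelfDualOrder.map_smul, SelfDualOrder.map_standard]

theorem cosetOrbit_leftTranslate {R : Type u} [CommRing R] (g : LoopGroup R)
    (x : LoopGroup R ⧸ positiveLoopGroup R) :
    cosetOrbit (leftTranslate _ g x) = g • cosetOrbit x := by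
  induction x using QuotientGroup.induction_on with | H h => ?_
  exact mul_smul g h (SelfDualOrder.standard R)

variable (k : Type u) [Field k]

/-- The orbit map on cosets, as a morphism of presheaves. -/
noncomputable def cosetOrbitMap : quotientPresheaf k ⟶ latticePresheaf k where
  app X := TypeCat.ofHom fun p =>
    let x : LoopGroup X.unop.unop ⧸ positiveLoopGroup X.unop.unop := p.down
    ULift.up (cosetOrbit x)
  naturality X Y f := by
    ext ⟨x⟩
    exact congrArg ULift.up (cosetOrbit_quotientMap f.unop.unop.hom.toRingHom x)

theorem quotientProjection_cosetOrbitMap : quotientProjection k ≫ cosetOrbitMap k = orbitMap k :=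
  rfl

theorem quotientAction_cosetOrbitMap :
    quotientAction k ≫ cosetOrbitMap k = loopPresheaf k ◁ cosetOrbitMap k ≫ latticeAction k := by
  ext X ⟨⟨g⟩, ⟨x⟩⟩
  exact congrArg ULift.up (cosetOrbit_leftTranslate (R := X.unop.unop) g x)

theorem cosetOrbitMap_injective (X : (AffineSchemes k)ᵒᵖ) :
    Function.Injective ((cosetOrbitMap k).app X) := by
  rintro ⟨x⟩ ⟨y⟩ h
  exact congrArg ULift.up (cosetOrbit_injective (congrArg ULift.down h))

variable {k}

/-- The orbit map becomes an isomorphism after sheafification: its fibres are the cosets of the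
positive loop group, and every self-dual order is fpqc locally a translate of the standard one. -/
theorem W_cosetOrbitMap (hk : (2 : k) ≠ 0) : (fpqcTopology k).W (cosetOrbitMap k) := by
  have h1 : Presheaf.IsLocallyInjective (fpqcTopology k) (cosetOrbitMap k) :=
    Presheaf.isLocallyInjective_of_injective _ _ (cosetOrbitMap_injective k)
  have h2 : Presheaf.IsLocallySurjective (fpqcTopology k) (cosetOrbitMap k) := by
    refine ⟨fun {X} s => ?_⟩
    refine (fpqcTopology k).superset_covering ?_ (trivialSieve_mem hk (X := X) s.down)
    rintro Y f ⟨g, hg⟩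
    exact ⟨ULift.up (QuotientGroup.mk (s := positiveLoopGroup Y.unop) g), congrArg ULift.up hg⟩
  exact (fpqcTopology k).W_of_isLocallyBijective _

end Comparison

end ParaOctonion

open ParaOctonion in
theorem theorem1p1 (k : Type u) [Field k] [PerfectField k] (hk : (2 : k) ≠ 0) :
    ∃ φ : (ParaOctonion.affineGrassmannian k).obj ≅ ParaOctonion.latticePresheaf k,
      ParaOctonion.grassmannianAction k ≫ φ.hom =
        ParaOctonion.loopPresheaf k ◁ φ.hom ≫ ParaOctonion.latticeAction k ∧
      ParaOctonion.quotientProjection k ≫ ParaOctonion.toGrassmannian k ≫ φ.hom =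
        ParaOctonion.orbitMap k := by
  have hW : (fpqcTopology k).W (toGrassmannian k) :=
    (fpqcTopology k).W_toSheafify (quotientPresheaf k)
  have hW' := W_cosetOrbitMap hk
  obtain ⟨a, (ha : toGrassmannian k ≫ a = _)⟩ := (hW _ isSheaf_latticePresheaf).2 (cosetOrbitMap k)
  obtain ⟨b, (hb : cosetOrbitMap k ≫ b = _)⟩ :=
    (hW' _ (affineGrassmannian k).property).2 (toGrassmannian k)
  refine ⟨⟨a, b, (hW _ (affineGrassmannian k).property).1 ?_,
    (hW' _ isSheaf_latticePresheaf).1 ?_⟩, ?_, ?_⟩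
  · change toGrassmannian k ≫ a ≫ b = toGrassmannian k ≫ 𝟙 _
    rw [← Category.assoc, ha, hb, Category.comp_id]
  · change cosetOrbitMap k ≫ b ≫ a = cosetOrbitMap k ≫ 𝟙 _
    rw [← Category.assoc, hb, ha, Category.comp_id]
  · refine ((hW.whiskerLeft (loopPresheaf k)) _ isSheaf_latticePresheaf).1 ?_
    change loopPresheaf k ◁ toGrassmannian k ≫ grassmannianAction k ≫ a =
      loopPresheaf k ◁ toGrassmannian k ≫ loopPresheaf k ◁ a ≫ latticeAction k
    rw [← Category.assoc, grassmannianAction_spec, Category.assoc, ha,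
      quotientAction_cosetOrbitMap, ← Category.assoc, ← whiskerLeft_comp, ha]
  · change quotientProjection k ≫ toGrassmannian k ≫ a = _
    rw [ha, quotientProjection_cosetOrbitMap]
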